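/- Write $s=i\sqrt2$. Let $G$ be the group of affine transformations of $\mathbb{C}^2$ generated by $R_j(z)=A_jz+v_j$ ($j=1,2,3$), where $$A_1=\begin{pmatrix}1&0\\1-s&-1\end{pmatrix},\quad A_2=\begin{pmatrix}-1+s&2\\1+s&1-s\end{pmatrix},\quad A_3=\begin{pmatrix}1&-1-s\\0&-1\end{pmatrix},\quad v_1=v_2=0,\quad v_3=\begin{pmatrix}\tfrac{1+s}{2}\\1\end{pmatrix}.$$ Let $X=G\backslash\mathbb{C}^2$, with the quotient topology and the quotient analytic structure (a function on an open subset of $X$ is holomorphic when its pullback to $\mathbb{C}^2$ is), let $p:\mathbb{C}^2\to X$ be the projection, and let $M\subset X$ be the image of the union of the mirrors of all complex reflections in $G$ (affine transformations of finite order whose fixed point set is a complex line). Let $\Lambda=(\mathbb{Z}\oplus i\sqrt2\,\mathbb{Z})^2\subset\mathbb{C}^2$, and let $G_{12}\subset GL_2(\mathbb{C})$ be the Shephard--Todd group, generated by the reflections $\frac1{\sqrt2}\begin{pmatrix}1&-1\\-1&-1\end{pmatrix}$, $\frac1{\sqrt2}\begin{pmatrix}1&1\\1&-1\end{pmatrix}$,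 $\begin{pmatrix}0&\zeta\\ \zeta^{-1}&0\end{pmatrix}$ with $\zeta=\frac{1+i}{\sqrt2}$. **Theorem.** 1. $G$ is an affine crystallographic complex reflection group: it is generated by complex reflections, its linear parts preserve a positive definite Hermitian form, and it acts properly discontinuously and cocompactly on $\mathbb{C}^2$. There is an extension $$1\to\Lambda\to G\to G_{12}\to1$$ in which $\Lambda$ is included as the group of translations by its elements and $G\to G_{12}$ is the linear part followed by conjugation by an element of $GL_2(\mathbb{C})$; this extension does not split. 2. The pair $(X,\frac12M)$ is a complex orbifold: $X$ is Hausdorff and second countable, and every point of $X$ has an open neighbourhood biholomorphic to a quotient $B/\Gamma$, where $\Gamma\subset GL_2(\mathbb{C})$ is finite and $B$ is a $\Gamma$-invariant connected open neighbourhood of $0$ in $\mathbb{C}^2$, such that $B\to B/\Gamma$ ramifies in codimension one exactly over $M$, with ramification order $2$ along every mirror of $\Gamma$. 3. The pair $(X,\frac12M)$ is uniformized by $\mathbb{C}^2$: the map $p$ is an orbifold covering, i.e. every point of $X$ has a chart $q:B\to B/\Gamma\cong q(B)\subset X$ as in 2 such that on each connected component of $p^{-1}(q(B))$ the map $p$ is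 biholomorphically identified with $q$. Its deck group, i.e. the group of homeomorphisms $\varphi$ of $\mathbb{C}^2$ with $p\circ\varphi=p$, is $G$. 4. Let $X_{sm}$ be the set of smooth points of $X$. Then $X_{sm}\setminus M$ is path connected, and for every base point $x_0\in X_{sm}\setminus M$ the orbifold fundamental group $$\pi_1^{orb}(X,\tfrac12M)=\pi_1(X_{sm}\setminus M,x_0)\,/\,\langle\langle\mu^2:\ \mu\text{ a meridian of }M\rangle\rangle$$ is isomorphic to $G$. Here a meridian is the class of a loop that follows a path from $x_0$, then the boundary circle of a disc transverse to $M$ at a point where $X$ and $M$ are smooth and meeting $M$ only at its centre, and then returns along the same path. -/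

import Mathlib

open scoped Matrix

noncomputable section

namespace AffineG12

/-- The complex plane `ℂ²`. -/
abbrev C2 : Type := Fin 2 → ℂ

/-! ### Spaces with holomorphic functions, quotient charts, orbifold pairs -/

/-- A (reduced) analytic structure on a topological space, given by its sheaf of holomorphic
functions, a sheaf of `ℂ`-algebras of `ℂ`-valued functions: `IsHol U f` says that (the restriction
to `U` of) `f` is holomorphic on `U`. -/
structure AnalyticStructure (X : Type) [TopologicalSpace X] where
  IsHol : TopologicalSpace.Opens X → (X → ℂ) → Prop
  congr : ∀ (U : TopologicalSpace.Opens X) (f g : X → ℂ), Set.EqOn f g U → IsHol U f → IsHol U g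
  mono : ∀ (U V : TopologicalSpace.Opens X) (f : X → ℂ), U ≤ V → IsHol V f → IsHol U f
  glue : ∀ (U : TopologicalSpace.Opens X) (f : X → ℂ), (∀ x ∈ U, ∃ V, x ∈ V ∧ IsHol V f) → IsHol U f
  const : ∀ U (c : ℂ), IsHol U (fun _ => c)
  add : ∀ U f g, IsHol U f → IsHol U g → IsHol U (f + g)
  mul : ∀ U f g, IsHol U f → IsHol U g → IsHol U (f * g)

/-- The quotient analytic structure along `p : ℂ² → X`: a function on an open set `U` of `X` is
holomorphic when its pullback to `p⁻¹(U)` is. -/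
def quotientStructure {X : Type} [TopologicalSpace X] (p : C2 → X) (hp : Continuous p) :
    AnalyticStructure X where
  IsHol U f := DifferentiableOn ℂ (f ∘ p) (p ⁻¹' U)
  congr U f g h hf := hf.congr fun z hz => (h hz).symm
  mono U V f h hf := hf.mono (Set.preimage_mono h)
  glue U f h z hz := by
    obtain ⟨V, hV, hf⟩ := h (p z) hz
    exact (hf.differentiableAt ((V.isOpen.preimage hp).mem_nhds hV)).differentiableWithinAt
  const U c := differentiableOn_const c
  add U f g hf hg := DifferentiableOn.add hf hg
  mul U f g hf hg := DifferentiableOn.mul hf hg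

/-- A linear complex reflection of `ℂ²`: an invertible linear map of finite order whose fixed
space is a complex line. -/
def IsReflection (γ : C2 ≃ₗ[ℂ] C2) : Prop :=
  IsOfFinOrder γ ∧
    Module.finrank ℂ (LinearMap.ker ((γ : C2 →ₗ[ℂ] C2) - LinearMap.id)) = 1

section Pairs

variable {X : Type} [TopologicalSpace X]

/-- `q` identifies the quotient of a connected open neighbourhood `B` of `0` in `ℂ²`, invariant
under the linear group `Γ`, with an open subset `q(B)` of `X`, as spaces with holomorphic
functions. For `Γ = ⊥`, `q` is the inverse of an ordinary holomorphic chart of `X`. -/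
structure IsQuotientChart (O : AnalyticStructure X) (Γ : Subgroup (C2 ≃ₗ[ℂ] C2))
    (B : Set C2) (q : C2 → X) : Prop where
  isOpen : IsOpen B
  isConnected : IsConnected B
  zero_mem : (0 : C2) ∈ B
  invariant : ∀ γ ∈ Γ, ∀ b ∈ B, γ b ∈ B
  continuousOn : ContinuousOn q B
  isOpen_image : ∀ V : Set C2, V ⊆ B → IsOpen V → IsOpen (q '' V)
  fiber : ∀ b ∈ B, ∀ b' ∈ B, q b = q b' ↔ ∃ γ ∈ Γ, γ b = b'
  isHol_iff : ∀ U : TopologicalSpace.Opens X, (U : Set X) ⊆ q '' B → ∀ f : X → ℂ,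
    O.IsHol U f ↔ DifferentiableOn ℂ (f ∘ q) (B ∩ q ⁻¹' U)

/-- An orbifold chart of the pair `(X, (1 - 1/m) D)`: a quotient chart `q : B → B/Γ ≅ q(B)` with
`Γ` finite, whose branch locus (the image of the mirrors of the reflections in `Γ`) is `D ∩ q(B)`,
and which ramifies with order exactly `m` along each mirror. -/
structure IsOrbifoldChart (O : AnalyticStructure X) (D : Set X) (m : ℕ)
    (Γ : Subgroup (C2 ≃ₗ[ℂ] C2)) (B : Set C2) (q : C2 → X) : Prop
    extends IsQuotientChart O Γ B q where
  finite : Finite Γ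
  branch : ∀ b ∈ B, q b ∈ D ↔ ∃ γ ∈ Γ, IsReflection γ ∧ γ b = b
  index : ∀ γ ∈ Γ, IsReflection γ →
    Nat.card {δ : C2 ≃ₗ[ℂ] C2 // δ ∈ Γ ∧ ∀ v, γ v = v → δ v = v} = m

/-- The pair `(X, (1 - 1/m) D)` is a (two-dimensional complex) orbifold. -/
def IsOrbifoldPair (O : AnalyticStructure X) (D : Set X) (m : ℕ) : Prop :=
  T2Space X ∧ SecondCountableTopology X ∧
    ∀ x : X, ∃ Γ B q, IsOrbifoldChart O D m Γ B q ∧ q 0 = x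

/-- `p : ℂ² → X` uniformizes the pair `(X, (1 - 1/m) D)`: it is a surjective orbifold covering
from the (simply connected) manifold `ℂ²`. That is, every point of `X` has an orbifold chart
`q : B → X` around it such that on every connected component of `p⁻¹(q(B))` the map `p` is
biholomorphically identified with `q : B → q(B)`. -/
def IsUniformization (O : AnalyticStructure X) (D : Set X) (m : ℕ) (p : C2 → X) : Prop :=
  Continuous p ∧ Function.Surjective p ∧
    ∀ x : X, ∃ Γ B q, IsOrbifoldChart O D m Γ B q ∧ q 0 = x ∧
      ∀ y ∈ p ⁻¹' (q '' B), ∃ h : OpenPartialHomeomorph C2 C2,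
        h.source = B ∧ h.target = connectedComponentIn (p ⁻¹' (q '' B)) y ∧
        DifferentiableOn ℂ h h.source ∧ DifferentiableOn ℂ h.symm h.target ∧
        ∀ b ∈ B, p (h b) = q b

/-! ### The orbifold fundamental group of a pair -/

/-- `x` is a smooth point of `X`: near `x`, `X` is biholomorphic to an open subset of `ℂ²`. -/
def IsSmoothPoint (O : AnalyticStructure X) (x : X) : Prop :=
  ∃ B q, IsQuotientChart O ⊥ B q ∧ q 0 = x

/-- The complement of `D` in the smooth locus of `X`. -/
def smoothComplement (O : AnalyticStructure X) (D : Set X) : Set X :=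
  {x | IsSmoothPoint O x ∧ x ∉ D}

/-- The meridians of `D` in `π₁(X_smooth ∖ D, x₀)`: in a holomorphic chart of `X` in which `D` is
the line `{b₁ = 0}` and which contains the closed disc `{(w, 0) : |w| ≤ 1}`, take the boundary
circle of that disc, and join it to the base point by a path. -/
def meridians (O : AnalyticStructure X) (D : Set X) (x₀ : smoothComplement O D) :
    Set (FundamentalGroup (smoothComplement O D) x₀) :=
  {c | ∃ (B : Set C2) (q : C2 → X), IsQuotientChart O ⊥ B q ∧
    (∀ b ∈ B, q b ∈ D ↔ b 0 = 0) ∧ (∀ w : ℂ, ‖w‖ ≤ 1 → ![w, 0] ∈ B) ∧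
    ∃ (y : smoothComplement O D) (l : Path y y) (a : Path x₀ y),
      (∀ t, (l t : X) = q ![Complex.exp (2 * Real.pi * Complex.I * (t : ℝ)), 0]) ∧
      c = FundamentalGroup.fromPath (Path.Homotopic.Quotient.mk ((a.trans l).trans a.symm))}

/-- The orbifold fundamental group of `(X, (1 - 1/m) D)`: the quotient of `π₁(X_smooth ∖ D, x₀)`
by the normal subgroup generated by the `m`-th powers of the meridians of `D`. -/
abbrev OrbifoldFundamentalGroup (O : AnalyticStructure X) (D : Set X) (m : ℕ)
    (x₀ : smoothComplement O D) : Type :=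
  FundamentalGroup (smoothComplement O D) x₀ ⧸
    Subgroup.normalClosure {c | ∃ μ ∈ meridians O D x₀, c = μ ^ m}

end Pairs

/-! ### Affine groups -/

open scoped ComplexOrder

/-- Affine transformations act on `ℂ²`. -/
instance : MulAction (C2 ≃ᵃ[ℂ] C2) C2 where
  smul g z := g z
  one_smul _ := rfl
  mul_smul _ _ _ := rfl

/-- An affine complex reflection of `ℂ²`: an affine transformation of finite order whose set of
fixed points (its mirror) is an affine complex line. -/
def IsAffineReflection (g : C2 ≃ᵃ[ℂ] C2) : Prop :=
  IsOfFinOrder g ∧ ∃ L : AffineSubspace ℂ C2, (L : Set C2).Nonempty ∧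
    Module.finrank ℂ L.direction = 1 ∧ {z | g z = z} = (L : Set C2)

/-- Affine crystallographic complex reflection groups in dimension two: the linear parts preserve
some positive definite Hermitian form (so it is a group of isometries), the action on `ℂ²` is
properly discontinuous and cocompact, and the group is generated by affine complex reflections. -/
def IsAffineCrystallographicReflectionGroup (G : Subgroup (C2 ≃ᵃ[ℂ] C2)) : Prop :=
  (∃ H : Matrix (Fin 2) (Fin 2) ℂ, H.PosDef ∧ ∀ g ∈ G, ∀ z w : C2,
    star (g.linear w) ⬝ᵥ (H *ᵥ g.linear z) = star w ⬝ᵥ (H *ᵥ z)) ∧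
  ProperlyDiscontinuousSMul G C2 ∧
  CompactSpace (MulAction.orbitRel.Quotient G C2) ∧
  Subgroup.closure {g | g ∈ G ∧ IsAffineReflection g} = G

/-- The linear involution with matrix `A`. -/
def linearInvolution (A : Matrix (Fin 2) (Fin 2) ℂ) (h : A * A = 1) : C2 ≃ₗ[ℂ] C2 :=
  Matrix.toLin'OfInv h h

/-- The affine map `z ↦ A z + v`, for `A` of order two. -/
def affineOf (A : Matrix (Fin 2) (Fin 2) ℂ) (h : A * A = 1) (v : C2) : C2 ≃ᵃ[ℂ] C2 :=
  (linearInvolution A h).toAffineEquiv.trans (AffineEquiv.constVAdd ℂ C2 v)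

theorem affineOf_apply (A : Matrix (Fin 2) (Fin 2) ℂ) (h : A * A = 1) (v z : C2) :
    affineOf A h v z = A *ᵥ z + v := by
  change v + Matrix.toLin' A z = A *ᵥ z + v
  rw [Matrix.toLin'_apply, add_comm]

/-- The complex number `i√2`. -/
def s : ℂ := Complex.I * (Real.sqrt 2 : ℝ)

theorem s_mul_s : s * s = -2 := by
  have h : ((Real.sqrt 2 : ℝ) : ℂ) * ((Real.sqrt 2 : ℝ) : ℂ) = 2 := by
    rw [← Complex.ofReal_mul, Real.mul_self_sqrt (by norm_num)]; norm_num
  calc s * s = (Complex.I * Complex.I) * (((Real.sqrt 2 : ℝ) : ℂ) * ((Real.sqrt 2 : ℝ) : ℂ)) := by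
        unfold s; ring
    _ = -2 := by rw [h, Complex.I_mul_I]; ring

/-- The linear parts of the three generators. -/
def A₁ : Matrix (Fin 2) (Fin 2) ℂ := !![1, 0; 1 - s, -1]
def A₂ : Matrix (Fin 2) (Fin 2) ℂ := !![-1 + s, 2; 1 + s, 1 - s]
def A₃ : Matrix (Fin 2) (Fin 2) ℂ := !![1, -1 - s; 0, -1]

theorem A₁_sq : A₁ * A₁ = 1 := by
  ext i j
  fin_cases i <;> fin_cases j <;> simp [A₁, Matrix.mul_apply, Fin.sum_univ_two]

theorem A₂_sq : A₂ * A₂ = 1 := by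
  have h := s_mul_s
  ext i j
  fin_cases i <;> fin_cases j <;> simp [A₂, Matrix.mul_apply, Fin.sum_univ_two] <;>
    first | ring1 | linear_combination h

theorem A₃_sq : A₃ * A₃ = 1 := by
  ext i j
  fin_cases i <;> fin_cases j <;> simp [A₃, Matrix.mul_apply, Fin.sum_univ_two]
  ring

/-- The three generating reflections. -/
def R₁ : C2 ≃ᵃ[ℂ] C2 := affineOf A₁ A₁_sq 0
def R₂ : C2 ≃ᵃ[ℂ] C2 := affineOf A₂ A₂_sq 0
def R₃ : C2 ≃ᵃ[ℂ] C2 := affineOf A₃ A₃_sq ![(1 + s) / 2, 1]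

/-- The affine group `G`. -/
def G : Subgroup (C2 ≃ᵃ[ℂ] C2) := Subgroup.closure {R₁, R₂, R₃}

/-- The lattice `Λ = (ℤ ⊕ i√2 ℤ)²`. -/
def Λ : AddSubgroup C2 := AddSubgroup.pi Set.univ fun _ => AddSubgroup.closure {1, s}

/-- `1/√2`. -/
def r : ℂ := ((Real.sqrt 2 : ℝ) : ℂ) / 2

theorem two_r_mul_r : 2 * (r * r) = 1 := by
  have h : ((Real.sqrt 2 : ℝ) : ℂ) * ((Real.sqrt 2 : ℝ) : ℂ) = 2 := by
    rw [← Complex.ofReal_mul, Real.mul_self_sqrt (by norm_num)]; norm_num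
  unfold r
  linear_combination h / 2

/-- The standard generators of the Shephard-Todd group `G₁₂`: three reflections of order two,
`(1/√2) (1, -1; -1, -1)`, `(1/√2) (1, 1; 1, -1)` and `(0, u; 1/u, 0)`, where `u = (1 + i)/√2` is a
primitive eighth root of unity. -/
def S₁ : Matrix (Fin 2) (Fin 2) ℂ := !![r, -r; -r, -r]
def S₂ : Matrix (Fin 2) (Fin 2) ℂ := !![r, r; r, -r]
def S₃ : Matrix (Fin 2) (Fin 2) ℂ := !![0, r * (1 + Complex.I); r * (1 - Complex.I), 0]

theorem S₁_sq : S₁ * S₁ = 1 := by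
  have h := two_r_mul_r
  ext i j
  fin_cases i <;> fin_cases j <;> simp [S₁, Matrix.mul_apply, Fin.sum_univ_two] <;>
    linear_combination h

theorem S₂_sq : S₂ * S₂ = 1 := by
  have h := two_r_mul_r
  ext i j
  fin_cases i <;> fin_cases j <;> simp [S₂, Matrix.mul_apply, Fin.sum_univ_two] <;>
    linear_combination h

theorem S₃_sq : S₃ * S₃ = 1 := by
  have h := two_r_mul_r
  have hI := Complex.I_mul_I
  ext i j
  fin_cases i <;> fin_cases j <;> simp [S₃, Matrix.mul_apply, Fin.sum_univ_two] <;>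
    linear_combination h - r * r * hI

/-- The Shephard-Todd group `G₁₂`, as a linear reflection group on `ℂ²`. -/
def G₁₂ : Subgroup (C2 ≃ₗ[ℂ] C2) :=
  Subgroup.closure {linearInvolution S₁ S₁_sq, linearInvolution S₂ S₂_sq,
    linearInvolution S₃ S₃_sq}

/-! ### The pair `(X, ½ M)` -/

/-- The quotient `X = G \ ℂ²`. -/
abbrev X : Type := MulAction.orbitRel.Quotient G C2

/-- The quotient map `ℂ² → X`. -/
def proj : C2 → X := Quotient.mk (MulAction.orbitRel G C2)

theorem continuous_proj : Continuous proj := continuous_quotient_mk'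

/-- The quotient analytic structure of `X`. -/
def OX : AnalyticStructure X := quotientStructure proj continuous_proj

/-- The discriminant curve `M`: the image in `X` of the union of the mirrors of the complex
reflections in `G`. -/
def M : Set X := proj '' {z | ∃ g ∈ G, IsAffineReflection g ∧ g z = z}

end AffineG12

end

/-!
The group `G` is understood through three elementary facts about its elements.

* They are integral: in coordinates over `ℤ[i√2]` the linear part has integral entries and the
  translation part has entries in `½ ℤ[i√2]`. Reduction modulo two leaves a finite set of residues
  (`parityStep_mem_parityOrbit`), in which a trivial linear part forces a trivial translation part
  (`parityOrbit_one`). Hence the translations in `G` are those by elements of `Λ`; conversely the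
  commutator of `R₃` with `-1 = (R₁ R₂)²` generates all of them (`Λ_le_translationVectors`).
* The linear parts preserve the definite form `formH`. Together with integrality this gives proper
  discontinuity (`finite_setOf_norm_le`); compactness of the quotient comes from `Λ`.
* The linear parts have determinant `±1`. Hence a nontrivial element with two fixed points is a
  reflection of order two, and it is determined by its mirror (`eq_one_of_fixed_of_det`).

A splitting of the extension would lift `-1` to a point reflection whose centre lies in `½ Λ` and is
fixed by lifts of the generators; congruences modulo two exclude such a centre
(`isEmpty_extension_splitting`).

Orbifold charts are slices: small invariant convex neighbourhoods of a point modulo its stabilizer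
(`IsSlice.isOrbifoldChart`). The components of their preimages are translates of the slice, so that
`proj` is an orbifold covering. The points with trivial stabilizer form the complement of countably
many complex lines and points, which is connected and dense by a dimension count; a deck
transformation agrees with one element of `G` there (`deck_iff`).

For the fundamental group, the smooth points of `X` off `M` are exactly the images of the points
with trivial stabilizer (`smoothComplement_eq`): at any other point off `M`, a punctured smooth
chart, being simply connected, would lift to `ℂ²`, where the stabilizer acts on its image. Thus
`freePoints → smoothComplement OX M` is a covering with group `G` and connected total space, and
`π₁` maps onto `G` (up to the order of multiplication, `deckHom`). It remains to see that the kernel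
is generated by the squares of the meridians (`ker_deckHom`).

The square of a meridian is in the kernel, because the circle can be pushed close to a branch point
whose preimages are not isolated fixed points, and whose stabilizers have therefore order two
(`mul_self_eq_one_of_meridian`).

Conversely, let a loop of points with trivial stabilizer be given, and take its image in `π₁` modulo
the squares of the meridians as a holonomy. Locally, near a generic point of a mirror, the loop is
homotopic to a power of the circle around the mirror, whose image in `X` runs twice around a
meridian: in the coordinates `(u₀, u₁)` in which the reflection is `u₀ ↦ -u₀`, the functions
`(u₀², u₁)` form a chart of `X`, by a removable singularity theorem
(`IsMirrorFrame.isQuotientChart`). So the holonomy is trivial locally on the complement of the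
isolated fixed points. This complement of a countable closed set in real dimension four is simply
connected (`isSimplyConnected_diff_countable`), so the holonomy is trivial (`holonomy_eq_one`).
-/

noncomputable section

namespace AffineG12

open scoped ComplexOrder

/-! ### Integrality -/

/-- The vector of `Λ` with integer coordinates `(a, b, c, d)`, namely `(a + b s, c + d s)`. -/
def latticeVec (x : ℤ × ℤ × ℤ × ℤ) : C2 :=
  ![(x.1 : ℂ) + x.2.1 * s, (x.2.2.1 : ℂ) + x.2.2.2 * s]

theorem s_re : s.re = 0 := by simp [s]
theorem s_im : s.im = Real.sqrt 2 := by simp [s]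

theorem s_pow_two : s ^ 2 = -2 := by rw [sq, s_mul_s]

theorem intCast_add_mul_s_inj {a b c d : ℤ} (h : (a : ℂ) + b * s = c + d * s) : a = c ∧ b = d := by
  have h1 := congrArg Complex.re h
  have h2 := congrArg Complex.im h
  simp [s_re, s_im] at h1 h2
  exact ⟨h1, h2⟩

theorem latticeVec_injective : Function.Injective latticeVec := by
  rintro ⟨a, b, c, d⟩ ⟨a', b', c', d'⟩ h
  have h0 := congrFun h 0
  have h1 := congrFun h 1
  simp only [latticeVec, Matrix.cons_val_zero, Matrix.cons_val_one] at h0 h1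
  obtain ⟨rfl, rfl⟩ := intCast_add_mul_s_inj h0
  obtain ⟨rfl, rfl⟩ := intCast_add_mul_s_inj h1
  rfl

theorem mem_closure_one_s {x : ℂ} :
    x ∈ AddSubgroup.closure {1, s} ↔ ∃ a b : ℤ, x = a + b * s := by
  rw [AddSubgroup.mem_closure_pair]
  simp [eq_comm]

theorem mem_Λ {v : C2} : v ∈ Λ ↔ ∃ x, latticeVec x = v := by
  simp only [Λ, AddSubgroup.mem_pi, Set.mem_univ, true_imp_iff, mem_closure_one_s,
    Fin.forall_fin_two, Prod.exists, latticeVec]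
  constructor
  · rintro ⟨⟨a, b, h⟩, c, d, h'⟩
    refine ⟨a, b, c, d, ?_⟩
    ext i; fin_cases i
    · exact h.symm
    · exact h'.symm
  · rintro ⟨a, b, c, d, rfl⟩
    exact ⟨⟨a, b, rfl⟩, c, d, rfl⟩

/-- The three linear parts in the integer coordinates of `Λ`. -/
def intAct : Fin 3 → ℤ × ℤ × ℤ × ℤ → ℤ × ℤ × ℤ × ℤ
  | 0, (a, b, c, d) => (a, b, a + 2 * b - c, b - a - d)
  | 1, (a, b, c, d) => (-a - 2 * b + 2 * c, a - b + 2 * d, a - 2 * b + c + 2 * d, a + b + d - c)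
  | 2, (a, b, c, d) => (a - c + 2 * d, b - c - d, -c, -d)

/-- Twice the translation parts of the three generators, in the integer coordinates of `Λ`. -/
def intShift : Fin 3 → ℤ × ℤ × ℤ × ℤ
  | 0 => 0
  | 1 => 0
  | 2 => (1, 1, 2, 0)

/-- The three generators, indexed. -/
def gen : Fin 3 → (C2 ≃ᵃ[ℂ] C2)
  | 0 => R₁
  | 1 => R₂
  | 2 => R₃

/-- The linear parts of the three generators, indexed. -/
def genMat : Fin 3 → Matrix (Fin 2) (Fin 2) ℂ
  | 0 => A₁
  | 1 => A₂
  | 2 => A₃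

theorem latticeVec_add (x y) : latticeVec (x + y) = latticeVec x + latticeVec y := by
  ext i; fin_cases i <;> simp [latticeVec] <;> ring

theorem genMat_mulVec_latticeVec (j : Fin 3) (x) :
    genMat j *ᵥ latticeVec x = latticeVec (intAct j x) := by
  obtain ⟨a, b, c, d⟩ := x
  have h := s_mul_s
  fin_cases j <;> ext i <;> fin_cases i <;>
    simp [genMat, A₁, A₂, A₃, latticeVec, intAct, Matrix.mulVec, dotProduct, Fin.sum_univ_two] <;>
    first | ring1 | linear_combination (-(b : ℂ)) * h | linear_combination (b : ℂ) * h |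
      linear_combination (b - d : ℂ) * h | linear_combination (-(d : ℂ)) * h

theorem gen_apply (j : Fin 3) (z : C2) :
    gen j z = genMat j *ᵥ z + (2 : ℂ)⁻¹ • latticeVec (intShift j) := by
  fin_cases j
  · change affineOf A₁ A₁_sq 0 z = _
    rw [affineOf_apply]; congr 1; ext i; fin_cases i <;> simp [latticeVec, intShift]
  · change affineOf A₂ A₂_sq 0 z = _
    rw [affineOf_apply]; congr 1; ext i; fin_cases i <;> simp [latticeVec, intShift]
  · change affineOf A₃ A₃_sq _ z = _
    rw [affineOf_apply]; congr 1; ext i; fin_cases i <;> simp [latticeVec, intShift]; ring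

theorem gen_linear (j : Fin 3) (z : C2) : (gen j).linear z = genMat j *ᵥ z := by
  fin_cases j <;> exact Matrix.toLin'_apply _ z

theorem G_eq_closure_range_gen : G = Subgroup.closure (Set.range gen) := by
  unfold G
  congr 1
  ext g
  simp [Fin.exists_fin_succ, gen, eq_comm]

theorem gen_mem (j : Fin 3) : gen j ∈ G := by
  rw [G_eq_closure_range_gen]; exact Subgroup.subset_closure ⟨j, rfl⟩

theorem genMat_sq (j : Fin 3) : genMat j * genMat j = 1 := by
  fin_cases j
  exacts [A₁_sq, A₂_sq, A₃_sq]

theorem gen_mul_self (j : Fin 3) : gen j * gen j = 1 := by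
  ext1 z
  change gen j (gen j z) = z
  rw [gen_apply, gen_apply, Matrix.mulVec_add, Matrix.mulVec_mulVec, genMat_sq, Matrix.one_mulVec,
    add_assoc, Matrix.mulVec_smul, ← smul_add, genMat_mulVec_latticeVec, ← latticeVec_add]
  have : intAct j (intShift j) + intShift j = 0 := by revert j; decide
  rw [this]
  ext i; fin_cases i <;> simp [latticeVec]

theorem gen_inv (j : Fin 3) : (gen j)⁻¹ = gen j := inv_eq_of_mul_eq_one_left (gen_mul_self j)

/-- Induction over words in the three generators. -/
theorem G_induction {p : (C2 ≃ᵃ[ℂ] C2) → Prop} (one : p 1)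
    (step : ∀ j g, g ∈ G → p g → p (gen j * g)) {g : C2 ≃ᵃ[ℂ] C2} (hg : g ∈ G) : p g := by
  have hG := G_eq_closure_range_gen
  rw [hG] at hg
  induction hg using Subgroup.closure_induction_left with
  | one => exact one
  | mul_left x hx y hy h =>
    obtain ⟨j, rfl⟩ := hx
    exact step j y (hG ▸ hy) h
  | inv_mul_cancel x hx y hy h =>
    obtain ⟨j, rfl⟩ := hx
    rw [gen_inv]
    exact step j y (hG ▸ hy) h

/-! ### Translations in the group -/

/-- Reduction modulo two of integer coordinates. -/
def parity (x : ℤ × ℤ × ℤ × ℤ) : Bool × Bool × Bool × Bool :=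
  (x.1.bodd, x.2.1.bodd, x.2.2.1.bodd, x.2.2.2.bodd)

/-- `intAct` modulo two. -/
def parityAct : Fin 3 → Bool × Bool × Bool × Bool → Bool × Bool × Bool × Bool
  | 0, (a, b, c, d) => (a, b, xor a c, xor (xor b a) d)
  | 1, (a, b, c, d) => (a, xor a b, xor a c, xor (xor (xor a b) d) c)
  | 2, (a, b, c, d) => (xor a c, xor (xor b c) d, c, d)

/-- `intShift` modulo two. -/
def parityShift : Fin 3 → Bool × Bool × Bool × Bool
  | 0 => (false, false, false, false)
  | 1 => (false, false, false, false)
  | 2 => (true, true, false, false)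

/-- Addition of vectors modulo two. -/
def parityAdd (x y : Bool × Bool × Bool × Bool) : Bool × Bool × Bool × Bool :=
  (xor x.1 y.1, xor x.2.1 y.2.1, xor x.2.2.1 y.2.2.1, xor x.2.2.2 y.2.2.2)

theorem parity_add (x y) : parity (x + y) = parityAdd (parity x) (parity y) := by
  simp [parity, parityAdd]

theorem parity_intAct (j : Fin 3) (x) : parity (intAct j x) = parityAct j (parity x) := by
  obtain ⟨a, b, c, d⟩ := x
  fin_cases j <;>
    simp [parity, intAct, parityAct, sub_eq_add_neg, Int.bodd_add, Int.bodd_mul, Int.bodd_neg,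
      show Int.bodd 2 = false from rfl]

theorem parity_intShift (j : Fin 3) : parity (intShift j) = parityShift j := by
  fin_cases j <;> rfl

/-- Left multiplication by a generator, on triples (columns of the linear part, twice the
translation part) modulo two. -/
def parityStep (j : Fin 3) (t : (Bool × Bool × Bool × Bool) × (Bool × Bool × Bool × Bool) ×
    (Bool × Bool × Bool × Bool)) :=
  (parityAct j t.1, parityAct j t.2.1, parityAdd (parityAct j t.2.2) (parityShift j))

/-- Words in the generators representing the residues modulo two of the elements of `G`; the linear
parts are those of `G₁₂` modulo `±1`. -/
def parityWords : List (List (Fin 3)) :=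
  [[], [0], [1], [2], [1, 0], [2, 0], [2, 1], [0, 2], [1, 2], [2, 1, 0], [0, 2, 0], [1, 2, 0],
   [0, 2, 1], [1, 2, 1], [1, 0, 2], [0, 2, 1, 0], [1, 2, 1, 0], [1, 0, 2, 0], [1, 0, 2, 1],
   [2, 1, 0, 2], [1, 0, 2, 1, 0], [2, 1, 0, 2, 0], [2, 1, 0, 2, 1], [2, 1, 0, 2, 1, 0]]

/-- The residues modulo two of the elements of `G`, as triples consisting of the columns of the
linear part and of twice the translation part. Closure under `parityStep` is a finite check. -/
def parityOrbit : List ((Bool × Bool × Bool × Bool) × (Bool × Bool × Bool × Bool) ×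
    (Bool × Bool × Bool × Bool)) :=
  parityWords.map fun w => w.foldr parityStep
    ((true, false, false, false), (false, false, true, false), (false, false, false, false))

set_option maxRecDepth 100000 in
theorem parityStep_mem_parityOrbit :
    ∀ j : Fin 3, ∀ t ∈ parityOrbit, parityStep j t ∈ parityOrbit := by
  decide

set_option maxRecDepth 100000 in
/-- The translation part of an element of `G`, modulo `Λ`, is a function of the residue modulo two
of its linear part. -/
theorem parityOrbit_one : ∀ t ∈ parityOrbit, t.1 = (true, false, false, false) →
    t.2.1 = (false, false, true, false) → t.2.2 = (false, false, false, false) := by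
  decide

/-- `g` has the linear part with columns `x` and `y`, and the translation part `w / 2`, in the
integer coordinates of `Λ`. -/
def HasCoords (g : C2 ≃ᵃ[ℂ] C2) (x y w : ℤ × ℤ × ℤ × ℤ) : Prop :=
  ∀ z, g z = z 0 • latticeVec x + z 1 • latticeVec y + (2 : ℂ)⁻¹ • latticeVec w

/-- Elements of `G` are integral, apart from the denominator two in the translation part, and their
residues modulo two lie in the finite list `parityOrbit`. -/
theorem exists_hasCoords {g : C2 ≃ᵃ[ℂ] C2} (hg : g ∈ G) :
    ∃ x y w, HasCoords g x y w ∧ (parity x, parity y, parity w) ∈ parityOrbit := by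
  refine G_induction (p := fun g => ∃ x y w, HasCoords g x y w ∧
    (parity x, parity y, parity w) ∈ parityOrbit) ?_ ?_ hg
  · refine ⟨(1, 0, 0, 0), (0, 0, 1, 0), 0, fun z => ?_, by decide⟩
    ext i; fin_cases i <;> simp [latticeVec]
  · rintro j g - ⟨x, y, w, h, hp⟩
    refine ⟨intAct j x, intAct j y, intAct j w + intShift j, fun z => ?_, ?_⟩
    · change gen j (g z) = _
      rw [gen_apply, h, Matrix.mulVec_add, Matrix.mulVec_add, Matrix.mulVec_smul,
        Matrix.mulVec_smul, Matrix.mulVec_smul, genMat_mulVec_latticeVec, genMat_mulVec_latticeVec,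
        genMat_mulVec_latticeVec, latticeVec_add, smul_add, add_assoc]
    · have := parityStep_mem_parityOrbit j _ hp
      simpa [parityStep, parity_intAct, parity_add, parity_intShift] using this

theorem HasCoords.linear_apply {g : C2 ≃ᵃ[ℂ] C2} {x y w} (h : HasCoords g x y w) (z : C2) :
    g.linear z = z 0 • latticeVec x + z 1 • latticeVec y := by
  have : g.linear z = g z - g 0 := by
    have := g.map_vadd 0 z
    simp only [vadd_eq_add, add_zero] at this
    rw [this, add_sub_cancel_right]
  rw [this, h, h]
  simp

theorem apply_eq_linear_add (g : C2 ≃ᵃ[ℂ] C2) (z : C2) : g z = g.linear z + g 0 := by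
  have := g.map_vadd 0 z
  simpa only [vadd_eq_add, add_zero] using this

theorem apply_add (g : C2 ≃ᵃ[ℂ] C2) (z b : C2) : g (z + b) = g z + g.linear b := by
  have := g.map_vadd z b
  simp only [vadd_eq_add] at this
  rw [add_comm z, this, add_comm]

theorem HasCoords.ext {g g' : C2 ≃ᵃ[ℂ] C2} {x y w} (h : HasCoords g x y w)
    (h' : HasCoords g' x y w) : g = g' := by
  ext1 z; rw [h z, h' z]

theorem parity_eq_false {w : ℤ × ℤ × ℤ × ℤ} (h : parity w = (false, false, false, false)) :
    ∃ u, w = u + u := by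
  obtain ⟨a, b, c, d⟩ := w
  simp only [parity, Prod.mk.injEq] at h
  have key : ∀ {n : ℤ}, n.bodd = false → ∃ k, n = k + k := fun {n} hn => by
    have := Int.bodd_add_div2 n
    rw [hn] at this
    exact ⟨n.div2, by simp at this; omega⟩
  obtain ⟨a', rfl⟩ := key h.1
  obtain ⟨b', rfl⟩ := key h.2.1
  obtain ⟨c', rfl⟩ := key h.2.2.1
  obtain ⟨d', rfl⟩ := key h.2.2.2
  exact ⟨(a', b', c', d'), rfl⟩

/-- The only translations in `G` are those by elements of `Λ`. -/
theorem exists_translation_of_linear_eq_one {g : C2 ≃ᵃ[ℂ] C2} (hg : g ∈ G)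
    (h1 : g.linear = 1) : ∃ v ∈ Λ, g = AffineEquiv.constVAdd ℂ C2 v := by
  obtain ⟨x, y, w, h, hp⟩ := exists_hasCoords hg
  have hl : ∀ z, z = z 0 • latticeVec x + z 1 • latticeVec y := fun z => by
    rw [← h.linear_apply z, h1]; rfl
  have hx : x = (1, 0, 0, 0) := latticeVec_injective <| by
    have := (hl ![1, 0]).symm
    simp at this; rw [this]; ext i; fin_cases i <;> simp [latticeVec]
  have hy : y = (0, 0, 1, 0) := latticeVec_injective <| by
    have := (hl ![0, 1]).symm
    simp at this; rw [this]; ext i; fin_cases i <;> simp [latticeVec]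
  subst hx hy
  obtain ⟨u, rfl⟩ := parity_eq_false (parityOrbit_one _ hp rfl rfl)
  refine ⟨latticeVec u, mem_Λ.2 ⟨u, rfl⟩, ?_⟩
  ext1 z
  rw [h z, ← hl z, latticeVec_add, ← two_smul ℂ, smul_smul]
  simp [add_comm]

/-- The translation by `v`. -/
abbrev translation (v : C2) : C2 ≃ᵃ[ℂ] C2 := AffineEquiv.constVAdd ℂ C2 v

theorem translation_add (v w : C2) : translation (v + w) = translation v * translation w := by
  ext1 z; exact add_assoc v w z

theorem translation_neg (v : C2) : translation (-v) = (translation v)⁻¹ := by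
  rw [eq_inv_iff_mul_eq_one, ← translation_add, neg_add_cancel]
  ext1 z; exact zero_add z

theorem conj_translation (g : C2 ≃ᵃ[ℂ] C2) (v : C2) :
    g * translation v * g⁻¹ = translation (g.linear v) := by
  rw [mul_inv_eq_iff_eq_mul]
  ext1 z
  change g (v + z) = g.linear v + g z
  rw [add_comm, apply_add, add_comm]

/-- The vectors by which the translation belongs to `G`. -/
def translationVectors : AddSubgroup C2 where
  carrier := {v | translation v ∈ G}
  zero_mem' := by
    have : translation (0 : C2) = 1 := by ext1 z; exact zero_add z
    change translation (0 : C2) ∈ G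
    rw [this]; exact one_mem G
  add_mem' {v w} hv hw := by
    change translation (v + w) ∈ G
    rw [translation_add]; exact mul_mem hv hw
  neg_mem' {v} hv := by
    change translation (-v) ∈ G
    rw [translation_neg]; exact inv_mem hv

theorem genMat_mulVec_mem_translationVectors {v : C2} (j : Fin 3) (hv : v ∈ translationVectors) :
    genMat j *ᵥ v ∈ translationVectors := by
  change translation _ ∈ G
  rw [← gen_linear, ← conj_translation]
  exact mul_mem (mul_mem (gen_mem j) hv) (inv_mem (gen_mem j))

theorem intAct_mem_translationVectors {x} (j : Fin 3)
    (hx : latticeVec x ∈ translationVectors) : latticeVec (intAct j x) ∈ translationVectors := by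
  rw [← genMat_mulVec_latticeVec]
  exact genMat_mulVec_mem_translationVectors j hx

theorem latticeVec_neg (x) : latticeVec (-x) = -latticeVec x := by
  ext i; fin_cases i <;> simp [latticeVec] <;> ring

theorem latticeVec_zero : latticeVec 0 = 0 := by
  ext i; fin_cases i <;> simp [latticeVec]

theorem latticeVec_zsmul (n : ℤ) (x) : latticeVec (n • x) = n • latticeVec x :=
  map_zsmul (AddMonoidHom.mk' latticeVec latticeVec_add) n x

/-- The central symmetry `-1` belongs to `G`. -/
theorem sq_gen_zero_mul_gen_one_apply (z : C2) : ((gen 0 * gen 1) * (gen 0 * gen 1)) z = -z := by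
  change gen 0 (gen 1 (gen 0 (gen 1 z))) = -z
  have h := s_mul_s
  simp only [gen_apply, intShift, latticeVec_zero, smul_zero, add_zero, Matrix.mulVec_mulVec]
  have : genMat 0 * (genMat 1 * (genMat 0 * genMat 1)) = -1 := by
    ext i j
    fin_cases i <;> fin_cases j <;>
      simp [genMat, A₁, A₂, Matrix.mul_apply, Fin.sum_univ_two]
    · linear_combination -h
    · ring
    · ring
    · linear_combination -h
  rw [this, Matrix.neg_mulVec, Matrix.one_mulVec]

/-- The commutator of `R₃` and `-1` is the translation by `(1 + s, 2)`, and the images of this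
vector under the linear parts of `G` generate `Λ`. -/
theorem Λ_le_translationVectors : Λ ≤ translationVectors := by
  have h0 : latticeVec (1, 1, 2, 0) ∈ translationVectors := by
    have key : translation (latticeVec (1, 1, 2, 0)) =
        gen 2 * ((gen 0 * gen 1) * (gen 0 * gen 1)) * gen 2 *
          ((gen 0 * gen 1) * (gen 0 * gen 1)) := by
      ext1 z
      change _ = gen 2 (((gen 0 * gen 1) * (gen 0 * gen 1)) (gen 2
        (((gen 0 * gen 1) * (gen 0 * gen 1)) z)))
      rw [sq_gen_zero_mul_gen_one_apply, sq_gen_zero_mul_gen_one_apply, gen_apply, gen_apply,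
        neg_add, Matrix.mulVec_neg, neg_neg, Matrix.mulVec_add, Matrix.mulVec_neg,
        Matrix.mulVec_smul, Matrix.mulVec_mulVec, genMat_sq, Matrix.one_mulVec,
        genMat_mulVec_latticeVec,
        show intAct 2 (intShift 2) = -(1, 1, 2, 0) by decide, latticeVec_neg, smul_neg, neg_neg]
      change latticeVec (1, 1, 2, 0) + z = _ + (2 : ℂ)⁻¹ • latticeVec (1, 1, 2, 0)
      rw [add_assoc, ← add_smul, add_comm]
      norm_num
    change translation _ ∈ G
    rw [key]
    have := mul_mem (mul_mem (gen_mem 0) (gen_mem 1)) (mul_mem (gen_mem 0) (gen_mem 1))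
    exact mul_mem (mul_mem (mul_mem (gen_mem 2) this) (gen_mem 2)) this
  have comb : ∀ {x y}, latticeVec x ∈ translationVectors → latticeVec y ∈ translationVectors →
      ∀ m n : ℤ, latticeVec (m • x + n • y) ∈ translationVectors := fun hx hy m n => by
    rw [latticeVec_add, latticeVec_zsmul, latticeVec_zsmul]
    exact add_mem (zsmul_mem hx m) (zsmul_mem hy n)
  have h1 : latticeVec (0, 0, 1, 0) ∈ translationVectors := by
    simpa using! comb h0 (intAct_mem_translationVectors 0 h0) 1 (-1)
  have h2 : latticeVec (1, 1, 0, 0) ∈ translationVectors := by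
    simpa using! comb h0 h1 1 (-2)
  have h3 : latticeVec (2, 0, 0, -1) ∈ translationVectors := by
    simpa using! comb (intAct_mem_translationVectors 1 h1) h1 1 (-1)
  have h4 : latticeVec (-3, 0, 0, 2) ∈ translationVectors := by
    simpa using! comb (intAct_mem_translationVectors 1 h2) h1 1 1
  have h5 : latticeVec (1, 0, 0, 0) ∈ translationVectors := by
    simpa using! comb h3 h4 2 1
  have h6 : latticeVec (0, 1, 0, 0) ∈ translationVectors := by
    simpa using! comb h2 h5 1 (-1)
  have h7 : latticeVec (0, 0, 0, 1) ∈ translationVectors := by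
    simpa using! comb h3 h5 (-1) 2
  intro v hv
  obtain ⟨⟨a, b, c, d⟩, rfl⟩ := mem_Λ.1 hv
  have := comb (x := (a, b, 0, 0)) (y := (0, 0, c, d)) (by simpa using! comb h5 h6 a b)
    (by simpa using! comb h1 h7 c d) 1 1
  simpa using! this

/-! ### The invariant Hermitian form -/

/-- The matrix of a Hermitian form invariant under the linear parts of `G`. -/
def formH : Matrix (Fin 2) (Fin 2) ℂ := !![2, -(1 + s); -(1 - s), 2]

theorem star_s : (starRingEnd ℂ) s = -s := by
  apply Complex.ext <;> simp [s]

theorem formH_apply (z w : C2) : star w ⬝ᵥ (formH *ᵥ z) =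
    star (w 0) * (2 * z 0 - (1 + s) * z 1) + star (w 1) * (2 * z 1 - (1 - s) * z 0) := by
  simp [formH, Matrix.mulVec, dotProduct, Fin.sum_univ_two]
  ring

theorem formH_re (z : C2) : (star z ⬝ᵥ (formH *ᵥ z)).re =
    2 * ‖z 0‖ ^ 2 + 2 * ‖z 1‖ ^ 2 - 2 * ((z 0).re * (z 1).re + (z 0).im * (z 1).im) +
      2 * Real.sqrt 2 * ((z 0).re * (z 1).im - (z 0).im * (z 1).re) := by
  have h : ∀ w : ℂ, ‖w‖ ^ 2 = w.re ^ 2 + w.im ^ 2 := fun w => by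
    rw [Complex.sq_norm, Complex.normSq_apply]; ring
  rw [formH_apply, h, h]
  simp [s_re, s_im]
  ring

theorem sq_norm_eq_or (z : C2) : ‖z‖ ^ 2 = ‖z 0‖ ^ 2 ∨ ‖z‖ ^ 2 = ‖z 1‖ ^ 2 := by
  have h : ‖z‖ = max ‖z 0‖ ‖z 1‖ := by
    apply le_antisymm
    · rw [pi_norm_le_iff_of_nonneg (by positivity)]
      intro i; fin_cases i <;> simp
    · exact max_le (norm_le_pi_norm z 0) (norm_le_pi_norm z 1)
  rcases max_choice ‖z 0‖ ‖z 1‖ with h' | h' <;> rw [h, h'] <;> simp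

theorem formH_lower_bound (z : C2) :
    (1 / 2 : ℝ) * ‖z‖ ^ 2 ≤ (star z ⬝ᵥ (formH *ᵥ z)).re := by
  have h : ∀ w : ℂ, ‖w‖ ^ 2 = w.re ^ 2 + w.im ^ 2 := fun w => by
    rw [Complex.sq_norm, Complex.normSq_apply]; ring
  have h2 : Real.sqrt 2 ^ 2 = 2 := Real.sq_sqrt (by norm_num)
  rw [formH_re]
  -- complete the square in the coordinate that does not realize the maximum
  rcases sq_norm_eq_or z with hz | hz <;> rw [hz, h, h]
  · nlinarith [sq_nonneg (2 * (z 1).re - (z 0).re - Real.sqrt 2 * (z 0).im),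
      sq_nonneg (2 * (z 1).im - (z 0).im + Real.sqrt 2 * (z 0).re)]
  · nlinarith [sq_nonneg (2 * (z 0).re - (z 1).re + Real.sqrt 2 * (z 1).im),
      sq_nonneg (2 * (z 0).im - (z 1).im - Real.sqrt 2 * (z 1).re)]

theorem formH_upper_bound (z : C2) :
    (star z ⬝ᵥ (formH *ᵥ z)).re ≤ 8 * ‖z‖ ^ 2 := by
  have h : ∀ w : ℂ, ‖w‖ ^ 2 = w.re ^ 2 + w.im ^ 2 := fun w => by
    rw [Complex.sq_norm, Complex.normSq_apply]; ring
  have h2 : Real.sqrt 2 ^ 2 = 2 := Real.sq_sqrt (by norm_num)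
  have h0 := pow_le_pow_left₀ (norm_nonneg _) (norm_le_pi_norm z 0) 2
  have h1 := pow_le_pow_left₀ (norm_nonneg _) (norm_le_pi_norm z 1) 2
  rw [formH_re]
  rw [h] at h0 h1 ⊢
  rw [h]
  nlinarith [sq_nonneg (2 * (z 1).re + (z 0).re + Real.sqrt 2 * (z 0).im),
      sq_nonneg (2 * (z 1).im + (z 0).im - Real.sqrt 2 * (z 0).re)]

theorem formH_isHermitian : formH.IsHermitian := by
  ext i j
  fin_cases i <;> fin_cases j <;> simp [formH, star_s] <;> ring

theorem formH_posDef : formH.PosDef := by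
  rw [Matrix.posDef_iff_dotProduct_mulVec]
  refine ⟨formH_isHermitian, fun z hz => ?_⟩
  rw [Complex.lt_def]
  constructor
  · have := formH_lower_bound z
    have hz' : 0 < ‖z‖ := norm_pos_iff.2 hz
    have : 0 < ‖z‖ ^ 2 := by positivity
    simp only [Complex.zero_re]
    linarith
  · rw [formH_apply]
    simp [s_re, s_im]
    ring

theorem formH_genMat (j : Fin 3) (z w : C2) :
    star (genMat j *ᵥ w) ⬝ᵥ (formH *ᵥ (genMat j *ᵥ z)) = star w ⬝ᵥ (formH *ᵥ z) := by
  have h := s_mul_s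
  rw [formH_apply, formH_apply]
  fin_cases j <;>
    simp [genMat, A₁, A₂, A₃, Matrix.mulVec, dotProduct, Fin.sum_univ_two, star_s] <;>
    ring_nf <;> simp [s_pow_two]
  linear_combination s * (-((starRingEnd ℂ) (w 0)) * z 1 + (starRingEnd ℂ) (w 1) * z 0) * h

theorem mul_linear_apply (g h : C2 ≃ᵃ[ℂ] C2) (z : C2) :
    (g * h).linear z = g.linear (h.linear z) := rfl

theorem formH_invariant {g : C2 ≃ᵃ[ℂ] C2} (hg : g ∈ G) : ∀ z w : C2,
    star (g.linear w) ⬝ᵥ (formH *ᵥ g.linear z) = star w ⬝ᵥ (formH *ᵥ z) := by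
  refine G_induction (p := fun g => ∀ z w : C2,
    star (g.linear w) ⬝ᵥ (formH *ᵥ g.linear z) = star w ⬝ᵥ (formH *ᵥ z)) ?_ ?_ hg
  · intro z w; rfl
  · intro j g _ ih z w
    rw [mul_linear_apply, mul_linear_apply, gen_linear, gen_linear, formH_genMat, ih]

theorem norm_linear_le {g : C2 ≃ᵃ[ℂ] C2} (hg : g ∈ G) (z : C2) : ‖g.linear z‖ ≤ 4 * ‖z‖ := by
  have h1 := formH_lower_bound (g.linear z)
  rw [formH_invariant hg] at h1
  have h2 := formH_upper_bound z
  refine abs_le_of_sq_le_sq' ?_ (by positivity) |>.2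
  nlinarith

theorem det_linear {g : C2 ≃ᵃ[ℂ] C2} (hg : g ∈ G) :
    LinearMap.det (g.linear : C2 →ₗ[ℂ] C2) = 1 ∨ LinearMap.det (g.linear : C2 →ₗ[ℂ] C2) = -1 := by
  refine G_induction (p := fun g => LinearMap.det (g.linear : C2 →ₗ[ℂ] C2) = 1 ∨
    LinearMap.det (g.linear : C2 →ₗ[ℂ] C2) = -1) ?_ ?_ hg
  · left; exact LinearMap.det_id
  · intro j g _ ih
    have h : ((gen j * g).linear : C2 →ₗ[ℂ] C2) =
      Matrix.toLin' (genMat j) ∘ₗ (g.linear : C2 →ₗ[ℂ] C2) := by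
      refine LinearMap.ext fun z => ?_
      change (gen j).linear (g.linear z) = Matrix.toLin' (genMat j) (g.linear z)
      rw [gen_linear, Matrix.toLin'_apply]
    have hs := s_mul_s
    have hd : (genMat j).det = -1 := by
      fin_cases j <;> simp [genMat, A₁, A₂, A₃, Matrix.det_fin_two]
      linear_combination -hs
    rw [h, LinearMap.det_comp, LinearMap.det_toLin', hd]
    rcases ih with ih | ih <;> rw [ih] <;> simp

/-! ### Proper discontinuity and compactness of the quotient -/

theorem abs_le_of_norm_latticeVec_le {x : ℤ × ℤ × ℤ × ℤ} {N : ℕ} (h : ‖latticeVec x‖ ≤ N) :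
    x ∈ Set.Icc (-(N : ℤ)) N ×ˢ Set.Icc (-(N : ℤ)) N ×ˢ Set.Icc (-(N : ℤ)) N ×ˢ
      Set.Icc (-(N : ℤ)) N := by
  have key : ∀ a b : ℤ, ‖(a : ℂ) + b * s‖ ≤ N → |a| ≤ N ∧ |b| ≤ N := fun a b hab => by
    have h1 := (Complex.abs_re_le_norm _).trans hab
    have h2 := (Complex.abs_im_le_norm _).trans hab
    simp [s_re, s_im] at h1 h2
    refine ⟨by exact_mod_cast h1, ?_⟩
    have : |(b : ℝ)| ≤ N := by
      rw [abs_of_nonneg (Real.sqrt_nonneg 2)] at h2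
      have : (1 : ℝ) ≤ Real.sqrt 2 := Real.one_le_sqrt.2 (by norm_num)
      nlinarith [abs_nonneg (b : ℝ)]
    exact_mod_cast this
  obtain ⟨a, b, c, d⟩ := x
  have h0 := key a b ((norm_le_pi_norm (latticeVec (a, b, c, d)) 0).trans h)
  have h1 := key c d ((norm_le_pi_norm (latticeVec (a, b, c, d)) 1).trans h)
  simp only [abs_le] at h0 h1
  exact ⟨h0.1, h0.2, h1.1, h1.2⟩

/-- Only finitely many elements of `G` move some point of the ball of radius `N` into that
ball. -/
theorem finite_setOf_norm_le (N : ℕ) : {g : G | ∃ z : C2, ‖z‖ ≤ N ∧ ‖g • z‖ ≤ N}.Finite := by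
  choose x y w h _ using fun g : G => exists_hasCoords g.2
  have hinj : Function.Injective fun g : G => (x g, y g, w g) := fun g g' hgg' => by
    simp only [Prod.mk.injEq] at hgg'
    have h1 := h g
    rw [hgg'.1, hgg'.2.1, hgg'.2.2] at h1
    exact Subtype.ext (h1.ext (h g'))
  let I : ℕ → Set (ℤ × ℤ × ℤ × ℤ) := fun N => Set.Icc (-(N : ℤ)) N ×ˢ Set.Icc (-(N : ℤ)) N ×ˢ
      Set.Icc (-(N : ℤ)) N ×ˢ Set.Icc (-(N : ℤ)) N
  have hI : ∀ N, (I N).Finite := fun N => by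
    have := Set.finite_Icc (-(N : ℤ)) N
    exact this.prod (this.prod (this.prod this))
  refine Set.Finite.subset (((hI 4).prod ((hI 4).prod (hI (10 * N)))).preimage hinj.injOn) ?_
  rintro g ⟨z, hz, hgz⟩
  have hcol : ∀ e : C2, ‖e‖ ≤ 1 → ‖(g : C2 ≃ᵃ[ℂ] C2).linear e‖ ≤ (4 : ℕ) := fun e he =>
    (norm_linear_le g.2 e).trans (by push_cast; linarith)
  refine ⟨abs_le_of_norm_latticeVec_le ?_, abs_le_of_norm_latticeVec_le ?_,
    abs_le_of_norm_latticeVec_le ?_⟩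
  · have := hcol ![1, 0] ((pi_norm_le_iff_of_nonneg zero_le_one).2 fun i => by
      fin_cases i <;> simp)
    rw [(h g).linear_apply] at this
    simpa using this
  · have := hcol ![0, 1] ((pi_norm_le_iff_of_nonneg zero_le_one).2 fun i => by
      fin_cases i <;> simp)
    rw [(h g).linear_apply] at this
    simpa using this
  · have e : latticeVec (w g) = (2 : ℂ) • (g • z - (g : C2 ≃ᵃ[ℂ] C2).linear z) := by
      change _ = (2 : ℂ) • ((g : C2 ≃ᵃ[ℂ] C2) z - _)
      rw [(h g).linear_apply, h g z, add_sub_cancel_left, smul_smul]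
      norm_num
    rw [e, norm_smul]
    have h1 := norm_sub_le (g • z) ((g : C2 ≃ᵃ[ℂ] C2).linear z)
    have h2 := norm_linear_le g.2 z
    simp only [Complex.norm_ofNat]
    push_cast
    linarith

instance : ProperlyDiscontinuousSMul G C2 where
  finite_disjoint_inter_image {K L} hK hL := by
    obtain ⟨R, hR⟩ := (hK.isBounded.union hL.isBounded).exists_norm_le
    obtain ⟨N, hN⟩ := exists_nat_ge R
    refine (finite_setOf_norm_le N).subset ?_
    rintro g ⟨_, ⟨z, hz, rfl⟩, hgz⟩
    exact ⟨z, (hR z (Or.inl hz)).trans hN, (hR _ (Or.inr hgz)).trans hN⟩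

instance : ContinuousConstSMul G C2 where
  continuous_const_smul g := (g : C2 ≃ᵃ[ℂ] C2).toAffineMap.continuous_of_finiteDimensional

instance : Countable G := by
  have : (Set.univ : Set G) ⊆ ⋃ N : ℕ, {g : G | ∃ z : C2, ‖z‖ ≤ N ∧ ‖g • z‖ ≤ N} := by
    intro g _
    obtain ⟨N, hN⟩ := exists_nat_ge ‖g • (0 : C2)‖
    exact Set.mem_iUnion.2 ⟨N, 0, by simp, hN⟩
  exact Set.countable_univ_iff.1
    ((Set.countable_iUnion fun N => (finite_setOf_norm_le N).countable).mono this)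

theorem proj_eq_iff {z w : C2} : proj z = proj w ↔ ∃ g ∈ G, g z = w := by
  unfold proj
  rw [eq_comm, Quotient.eq]
  change w ∈ MulAction.orbit G z ↔ _
  exact ⟨fun ⟨g, h⟩ => ⟨g, g.2, h⟩, fun ⟨g, hg, h⟩ => ⟨⟨g, hg⟩, h⟩⟩

theorem proj_apply {g : C2 ≃ᵃ[ℂ] C2} (hg : g ∈ G) (z : C2) : proj (g z) = proj z :=
  (proj_eq_iff.2 ⟨g, hg, rfl⟩).symm

theorem surjective_proj : Function.Surjective proj := Quotient.mk_surjective

theorem isOpenMap_proj : IsOpenMap proj := isOpenMap_quotient_mk'_mul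

instance : CompactSpace X := by
  let f : (Fin 4 → ℝ) → C2 := fun t => ![(t 0 : ℂ) + t 1 * s, (t 2 : ℂ) + t 3 * s]
  have hf : Continuous f := by
    refine continuous_pi fun i => ?_
    fin_cases i <;> simp [f] <;> fun_prop
  have hK : IsCompact (proj '' (f '' Set.Icc 0 1)) :=
    (isCompact_Icc.image hf).image continuous_proj
  refine ⟨?_⟩
  convert hK
  refine (Set.eq_univ_of_forall fun x => ?_).symm
  obtain ⟨z, rfl⟩ := surjective_proj x
  have hc : ∀ w : ℂ, w = (w.re : ℂ) + ((w.im / Real.sqrt 2 : ℝ) : ℂ) * s := fun w => by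
    have : Real.sqrt 2 ≠ 0 := by positivity
    apply Complex.ext <;> simp [s_re, s_im, this]
  let t : Fin 4 → ℝ := ![(z 0).re, (z 0).im / Real.sqrt 2, (z 1).re, (z 1).im / Real.sqrt 2]
  have hz : z = f t := by
    ext i; fin_cases i
    · exact hc (z 0)
    · exact hc (z 1)
  refine ⟨f fun i => Int.fract (t i), ⟨_, ⟨fun i => Int.fract_nonneg _,
    fun i => (Int.fract_lt_one _).le⟩, rfl⟩, ?_⟩
  refine proj_eq_iff.2 ⟨translation (latticeVec (⌊t 0⌋, ⌊t 1⌋, ⌊t 2⌋, ⌊t 3⌋)),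
    Λ_le_translationVectors (mem_Λ.2 ⟨_, rfl⟩), ?_⟩
  rw [hz]
  have key : ∀ i, (t i : ℂ) = (⌊t i⌋ : ℂ) + ((Int.fract (t i) : ℝ) : ℂ) := fun i => by
    exact_mod_cast (Int.floor_add_fract (t i)).symm
  ext i; fin_cases i <;> simp [f, latticeVec, key] <;> ring

/-! ### Linear and affine reflections -/

/-- A linear map of `ℂ²` other than the identity which fixes a nonzero vector fixes exactly a
line. -/
theorem finrank_ker_sub_id {f : C2 →ₗ[ℂ] C2} (h1 : f ≠ LinearMap.id) {v : C2} (hv : v ≠ 0)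
    (hfv : f v = v) : Module.finrank ℂ (LinearMap.ker (f - LinearMap.id)) = 1 := by
  have h2 : Module.finrank ℂ C2 = 2 := by simp
  have hlt : LinearMap.ker (f - LinearMap.id) < ⊤ := by
    rw [lt_top_iff_ne_top, Ne, LinearMap.ker_eq_top, sub_eq_zero]
    exact h1
  have := Submodule.finrank_lt hlt.ne
  have hpos : 0 < Module.finrank ℂ (LinearMap.ker (f - LinearMap.id)) := by
    rw [Module.finrank_pos_iff]
    exact ⟨⟨v, by simp [hfv]⟩, 0, fun h => hv (congrArg Subtype.val h)⟩
  omega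

theorem isOfFinOrder_of_apply_eq {g : C2 ≃ᵃ[ℂ] C2} (hg : g ∈ G) {z : C2} (hz : g z = z) :
    IsOfFinOrder g := by
  have : Finite (MulAction.stabilizer G z) :=
    ProperlyDiscontinuousSMul.finite_stabilizer z
  let γ : MulAction.stabilizer G z := ⟨⟨g, hg⟩, hz⟩
  have h := isOfFinOrder_of_finite γ
  have h' : (MulAction.stabilizer G z).subtype γ = ⟨g, hg⟩ := rfl
  exact (G.subtype.isOfFinOrder ((MulAction.stabilizer G z).subtype.isOfFinOrder h))

/-- In `G` finite order is automatic for elements with a fixed point, by proper discontinuity. -/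
theorem isAffineReflection_iff {g : C2 ≃ᵃ[ℂ] C2} (hg : g ∈ G) :
    IsAffineReflection g ↔ (∃ z, g z = z) ∧
      Module.finrank ℂ (LinearMap.ker ((g.linear : C2 →ₗ[ℂ] C2) - LinearMap.id)) = 1 := by
  have key : ∀ z, g z = z → ∀ w, g w = w ↔
      w - z ∈ LinearMap.ker ((g.linear : C2 →ₗ[ℂ] C2) - LinearMap.id) := fun z hz w => by
    have := apply_add g z (w - z)
    rw [add_sub_cancel, hz] at this
    rw [LinearMap.mem_ker, LinearMap.sub_apply, sub_eq_zero, this]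
    simp only [LinearEquiv.coe_coe, LinearMap.id_apply]
    rw [eq_sub_iff_add_eq, add_comm]
  constructor
  · rintro ⟨_, L, ⟨z, hz⟩, hL, hfix⟩
    have hz' : g z = z := by
      have : z ∈ {z | g z = z} := hfix ▸ hz
      exact this
    refine ⟨⟨z, hz'⟩, ?_⟩
    have hdir : LinearMap.ker ((g.linear : C2 →ₗ[ℂ] C2) - LinearMap.id) = L.direction := by
      ext v
      rw [← AffineSubspace.vadd_mem_iff_mem_direction v hz]
      have h1 : v +ᵥ z ∈ L ↔ g (v +ᵥ z) = v +ᵥ z := by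
        rw [← SetLike.mem_coe, ← hfix]; rfl
      rw [h1, key z hz']
      simp
    rw [hdir, hL]
  · rintro ⟨⟨z, hz⟩, h1⟩
    refine ⟨isOfFinOrder_of_apply_eq hg hz,
      AffineSubspace.mk' z (LinearMap.ker ((g.linear : C2 →ₗ[ℂ] C2) - LinearMap.id)),
      ⟨z, AffineSubspace.self_mem_mk' _ _⟩, ?_, ?_⟩
    · rw [AffineSubspace.direction_mk', h1]
    · ext w
      rw [Set.mem_ofPred_eq, key z hz, SetLike.mem_coe, AffineSubspace.mem_mk', vsub_eq_sub]

theorem isAffineReflection_gen (j : Fin 3) : IsAffineReflection (gen j) := by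
  rw [isAffineReflection_iff (gen_mem j)]
  constructor
  · refine ⟨(4 : ℂ)⁻¹ • latticeVec (intShift j), ?_⟩
    rw [gen_apply, Matrix.mulVec_smul, genMat_mulVec_latticeVec,
      show intAct j (intShift j) = -intShift j by revert j; decide, latticeVec_neg, smul_neg,
      ← neg_smul, ← add_smul]
    norm_num
  · have hs := s_mul_s
    refine finrank_ker_sub_id (v := ![![2, 1 - s], ![2, 2 - s], ![1, 0]] j) ?_ ?_ ?_
    · intro h
      have h2 : genMat j *ᵥ ![0, 1] = ![0, 1] := by
        rw [← gen_linear]; exact LinearMap.congr_fun h ![0, 1]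
      have h3 := congrFun h2 0
      have h4 := congrFun h2 1
      fin_cases j <;> simp [genMat, A₁, A₂, A₃] at h3 h4
      all_goals norm_num at h4
    · intro h
      have h3 := congrFun h 0
      fin_cases j <;> simp at h3
    · change (gen j).linear _ = _
      rw [gen_linear]
      fin_cases j <;> ext i <;> fin_cases i <;>
        simp [genMat, A₁, A₂, A₃] <;> first | ring1 | linear_combination hs

theorem isAffineCrystallographicReflectionGroup_G :
    IsAffineCrystallographicReflectionGroup G := by
  refine ⟨⟨formH, formH_posDef, fun g hg z w => formH_invariant hg z w⟩, inferInstance,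
    inferInstanceAs (CompactSpace X), le_antisymm ?_ ?_⟩
  · rw [Subgroup.closure_le]
    exact fun g hg => hg.1
  · conv_lhs => rw [G_eq_closure_range_gen]
    apply Subgroup.closure_mono
    rintro _ ⟨j, rfl⟩
    exact ⟨gen_mem j, isAffineReflection_gen j⟩

/-! ### The extension -/

theorem r_pow_two : r ^ 2 = 1 / 2 := by linear_combination two_r_mul_r / 2
theorem r_pow_three : r ^ 3 = r / 2 := by linear_combination r * two_r_mul_r / 2

theorem s_eq : s = 2 * r * Complex.I := by
  unfold s r; ring

/-- A matrix conjugating the linear parts of `G` into the standard form of `G₁₂`. -/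
def conjMat : Matrix (Fin 2) (Fin 2) ℂ :=
  !![1, r * (1 - Complex.I); Complex.I * (1 + 2 * r), (1 + r) * (1 - Complex.I)]

theorem isUnit_det_conjMat : IsUnit conjMat.det := by
  have h : conjMat.det = -2 * Complex.I * (1 + r) := by
    have h1 := r_pow_two
    have h2 := Complex.I_sq
    simp [conjMat, Matrix.det_fin_two]
    ring_nf
    simp [h1, h2]
    ring
  have hr : (1 + r : ℂ) = ((1 + Real.sqrt 2 / 2 : ℝ) : ℂ) := by simp [r]
  rw [isUnit_iff_ne_zero, h, hr]
  have : (1 + Real.sqrt 2 / 2 : ℝ) ≠ 0 := by positivity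
  simp only [mul_ne_zero_iff, Complex.ofReal_ne_zero]
  exact ⟨⟨by norm_num, Complex.I_ne_zero⟩, this⟩

/-- The linear map of `conjMat`. -/
def conjEquiv : C2 ≃ₗ[ℂ] C2 :=
  Matrix.toLin'OfInv (Matrix.nonsing_inv_mul _ isUnit_det_conjMat)
    (Matrix.mul_nonsing_inv _ isUnit_det_conjMat)

theorem conjEquiv_apply (z : C2) : conjEquiv z = conjMat *ᵥ z :=
  Matrix.toLin'_apply conjMat z

theorem conjMat_mul_A₁ : conjMat * A₁ = S₁ * conjMat := by
  have h1 := r_pow_two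
  have h2 := Complex.I_sq
  rw [conjMat, A₁, S₁, s_eq]
  ext i j
  fin_cases i <;> fin_cases j <;> simp [Matrix.mul_apply, Fin.sum_univ_two] <;>
    ring_nf <;> simp [h1, h2] <;> ring_nf

theorem conjMat_mul_A₂ : conjMat * A₂ = S₂ * conjMat := by
  have h1 := r_pow_two
  have h2 := Complex.I_sq
  rw [conjMat, A₂, S₂, s_eq]
  ext i j
  fin_cases i <;> fin_cases j <;> simp [Matrix.mul_apply, Fin.sum_univ_two] <;>
    ring_nf <;> simp [h1, h2] <;> ring_nf

theorem conjMat_mul_A₃ : conjMat * A₃ = S₁ * S₃ * S₁ * conjMat := by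
  have h1 := r_pow_two
  have h2 := Complex.I_sq
  have h3 := r_pow_three
  have h5 : r ^ 4 = 1 / 4 := by rw [show r ^ 4 = (r ^ 2) ^ 2 by ring, h1]; norm_num
  rw [conjMat, A₃, S₁, S₃, s_eq]
  ext i j
  fin_cases i <;> fin_cases j <;> simp [Matrix.mul_apply, Fin.sum_univ_two] <;>
    ring_nf <;> simp [h1, h2, h3, h5] <;> ring_nf

/-- The linear part, conjugated into `G₁₂`. -/
def linHom : (C2 ≃ᵃ[ℂ] C2) →* (C2 ≃ₗ[ℂ] C2) :=
  (MulAut.conj conjEquiv).toMonoidHom.comp AffineEquiv.linearHom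

theorem linHom_apply (g : C2 ≃ᵃ[ℂ] C2) : linHom g = conjEquiv * g.linear * conjEquiv⁻¹ := rfl

theorem linHom_gen_eq {j : Fin 3} {f : C2 ≃ₗ[ℂ] C2} {T : Matrix (Fin 2) (Fin 2) ℂ}
    (hf : ∀ z, f z = T *ᵥ z) (h : conjMat * genMat j = T * conjMat) : linHom (gen j) = f := by
  rw [linHom_apply, mul_inv_eq_iff_eq_mul]
  refine LinearEquiv.ext fun z => ?_
  change conjEquiv ((gen j).linear z) = f (conjEquiv z)
  rw [conjEquiv_apply, conjEquiv_apply, hf, gen_linear, Matrix.mulVec_mulVec,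
    Matrix.mulVec_mulVec, h]

theorem linHom_gen_zero : linHom (gen 0) = linearInvolution S₁ S₁_sq :=
  linHom_gen_eq (fun z => Matrix.toLin'_apply _ z) conjMat_mul_A₁

theorem linHom_gen_one : linHom (gen 1) = linearInvolution S₂ S₂_sq :=
  linHom_gen_eq (fun z => Matrix.toLin'_apply _ z) conjMat_mul_A₂

theorem linHom_gen_two : linHom (gen 2) = linearInvolution S₁ S₁_sq *
    linearInvolution S₃ S₃_sq * linearInvolution S₁ S₁_sq := by
  refine linHom_gen_eq (T := S₁ * S₃ * S₁) (fun z => ?_) conjMat_mul_A₃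
  rw [← Matrix.mulVec_mulVec, ← Matrix.mulVec_mulVec]
  change Matrix.toLin' S₁ (Matrix.toLin' S₃ (Matrix.toLin' S₁ z)) = _
  simp only [Matrix.toLin'_apply]

theorem linearInvolution_mul_self (A : Matrix (Fin 2) (Fin 2) ℂ) (h : A * A = 1) :
    linearInvolution A h * linearInvolution A h = 1 := by
  refine LinearEquiv.ext fun z => ?_
  change Matrix.toLin' A (Matrix.toLin' A z) = z
  rw [Matrix.toLin'_apply, Matrix.toLin'_apply, Matrix.mulVec_mulVec, h, Matrix.one_mulVec]

theorem map_linHom_G : G.map linHom = G₁₂ := by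
  have h1 := linearInvolution_mul_self S₁ S₁_sq
  apply le_antisymm
  · rw [G_eq_closure_range_gen, MonoidHom.map_closure, Subgroup.closure_le]
    have m : ∀ x ∈ ({linearInvolution S₁ S₁_sq, linearInvolution S₂ S₂_sq,
      linearInvolution S₃ S₃_sq} : Set (C2 ≃ₗ[ℂ] C2)), x ∈ G₁₂ :=
      fun x hx => Subgroup.subset_closure hx
    simp only [Set.mem_insert_iff, Set.mem_singleton_iff, forall_eq_or_imp, forall_eq] at m
    rintro _ ⟨_, ⟨j, rfl⟩, rfl⟩
    fin_cases j
    · exact linHom_gen_zero ▸ m.1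
    · exact linHom_gen_one ▸ m.2.1
    · exact linHom_gen_two ▸ mul_mem (mul_mem m.1 m.2.2) m.1
  · unfold G₁₂
    have m0 : linearInvolution S₁ S₁_sq ∈ G.map linHom :=
      linHom_gen_zero ▸ Subgroup.mem_map_of_mem _ (gen_mem 0)
    have m1 : linearInvolution S₂ S₂_sq ∈ G.map linHom :=
      linHom_gen_one ▸ Subgroup.mem_map_of_mem _ (gen_mem 1)
    have m2 := Subgroup.mem_map_of_mem linHom (gen_mem 2)
    rw [linHom_gen_two] at m2
    rw [Subgroup.closure_le]
    rintro _ (rfl | rfl | rfl)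
    · exact m0
    · exact m1
    · have := mul_mem (mul_mem m0 m2) m0
      rwa [mul_assoc _ (linearInvolution S₃ S₃_sq), ← mul_assoc, ← mul_assoc, h1, one_mul,
        mul_assoc, h1, mul_one] at this

theorem linHom_eq_one_iff {g : C2 ≃ᵃ[ℂ] C2} : linHom g = 1 ↔ g.linear = 1 := by
  rw [linHom_apply, mul_inv_eq_one, mul_eq_left]

/-- The extension `1 → Λ → G → G₁₂ → 1`. -/
def extension : GroupExtension (Multiplicative Λ) G G₁₂ where
  inl :=
    { toFun := fun v => ⟨translation (v.toAdd : C2), Λ_le_translationVectors v.toAdd.2⟩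
      map_one' := by
        refine Subtype.ext ?_
        ext1 z; exact zero_add z
      map_mul' := fun v w => Subtype.ext (translation_add _ _) }
  rightHom :=
    { toFun := fun g => ⟨linHom g, map_linHom_G ▸ Subgroup.mem_map_of_mem _ g.2⟩
      map_one' := Subtype.ext (map_one linHom)
      map_mul' := fun g h => Subtype.ext (map_mul linHom _ _) }
  inl_injective v w h := by
    have h1 := DFunLike.congr_fun (congrArg Subtype.val h) (0 : C2)
    change (v.toAdd : C2) + 0 = (w.toAdd : C2) + 0 at h1
    rw [add_zero, add_zero] at h1
    exact Subtype.ext h1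
  range_inl_eq_ker_rightHom := by
    ext g
    rw [MonoidHom.mem_range, MonoidHom.mem_ker, Subtype.ext_iff]
    change _ ↔ linHom g = 1
    rw [linHom_eq_one_iff]
    constructor
    · rintro ⟨v, rfl⟩
      rfl
    · intro h
      obtain ⟨v, hv, h'⟩ := exists_translation_of_linear_eq_one g.2 h
      exact ⟨Multiplicative.ofAdd ⟨v, hv⟩, Subtype.ext h'.symm⟩
  rightHom_surjective := by
    rintro ⟨f, hf⟩
    obtain ⟨g, hg, rfl⟩ := map_linHom_G.symm ▸ hf
    exact ⟨⟨g, hg⟩, rfl⟩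

/-- A splitting would give a lift of `-1` and lifts of the three generating reflections commuting
with it; the latter would have to fix the centre of the former, which lies in `Λ / 2`, but no point
of `Λ / 2` is fixed modulo `Λ` by all three generators. -/
theorem isEmpty_extension_splitting : IsEmpty extension.Splitting := by
  refine ⟨fun σ => ?_⟩
  let c : G := (⟨gen 0, gen_mem 0⟩ * ⟨gen 1, gen_mem 1⟩) * (⟨gen 0, gen_mem 0⟩ * ⟨gen 1, gen_mem 1⟩)
  have hc : ∀ z, (c : C2 ≃ᵃ[ℂ] C2) z = -z := sq_gen_zero_mul_gen_one_apply
  -- a lift of the image of an element of `G` differs from it by a lattice translation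
  have lift : ∀ g : G, ∃ x, ∀ z, (σ (extension.rightHom g) : C2 ≃ᵃ[ℂ] C2) z =
      latticeVec x + (g : C2 ≃ᵃ[ℂ] C2) z := fun g => by
    have h1 : linHom (σ (extension.rightHom g) : C2 ≃ᵃ[ℂ] C2) = linHom g :=
      congrArg Subtype.val (σ.rightHom_splitting (extension.rightHom g))
    have h2 : ((σ (extension.rightHom g) : C2 ≃ᵃ[ℂ] C2) * (g : C2 ≃ᵃ[ℂ] C2)⁻¹).linear = 1 := by
      rw [← linHom_eq_one_iff, map_mul, map_inv, h1, mul_inv_cancel]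
    obtain ⟨v, hv, h3⟩ := exists_translation_of_linear_eq_one
      (mul_mem (SetLike.coe_mem _) (inv_mem g.2)) h2
    obtain ⟨x, rfl⟩ := mem_Λ.1 hv
    refine ⟨x, fun z => ?_⟩
    rw [mul_inv_eq_iff_eq_mul] at h3
    rw [h3]; rfl
  obtain ⟨t, ht⟩ := lift c
  have fix : ∀ j : Fin 3, ∃ x, gen j ((2 : ℂ)⁻¹ • latticeVec t) + latticeVec x =
      (2 : ℂ)⁻¹ • latticeVec t := fun j => by
    obtain ⟨x, hx⟩ := lift ⟨gen j, gen_mem j⟩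
    refine ⟨x, ?_⟩
    set T := (σ (extension.rightHom c) : C2 ≃ᵃ[ℂ] C2)
    set Tj := (σ (extension.rightHom ⟨gen j, gen_mem j⟩) : C2 ≃ᵃ[ℂ] C2)
    have comm : T * Tj = Tj * T := by
      have hcj : extension.rightHom c * extension.rightHom ⟨gen j, gen_mem j⟩ =
          extension.rightHom ⟨gen j, gen_mem j⟩ * extension.rightHom c := by
        refine Subtype.ext ?_
        change linHom c * linHom (gen j) = linHom (gen j) * linHom c
        have hl : ∀ z, (c : C2 ≃ᵃ[ℂ] C2).linear z = -z := fun z => by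
          have := apply_eq_linear_add (c : C2 ≃ᵃ[ℂ] C2) z
          rw [hc, hc, neg_zero, add_zero] at this
          exact this.symm
        have hm : ∀ f : C2 ≃ₗ[ℂ] C2, (c : C2 ≃ᵃ[ℂ] C2).linear * f =
            f * (c : C2 ≃ᵃ[ℂ] C2).linear := fun f => LinearEquiv.ext fun z => by
          change (c : C2 ≃ᵃ[ℂ] C2).linear (f z) = f ((c : C2 ≃ᵃ[ℂ] C2).linear z)
          rw [hl, hl, map_neg]
        have hlc : linHom c = (c : C2 ≃ᵃ[ℂ] C2).linear := by
          rw [linHom_apply, ← hm, mul_inv_cancel_right]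
        rw [hlc, hm]
      have := congrArg (fun g => ((σ g : G) : C2 ≃ᵃ[ℂ] C2)) hcj
      simpa using! this
    have hT : ∀ z, T z = z ↔ z = (2 : ℂ)⁻¹ • latticeVec t := fun z => by
      rw [ht, hc, eq_inv_smul_iff₀ two_ne_zero, two_smul, ← sub_eq_add_neg, sub_eq_iff_eq_add,
        eq_comm]
    have h4 := DFunLike.congr_fun comm ((2 : ℂ)⁻¹ • latticeVec t)
    change T (Tj _) = Tj (T _) at h4
    rw [(hT _).2 rfl, hT, hx] at h4
    rw [add_comm]; exact h4
  obtain ⟨⟨a0, b0, c0, d0⟩, h0⟩ := fix 0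
  obtain ⟨⟨a1, b1, c1, d1⟩, h1⟩ := fix 1
  obtain ⟨⟨a2, b2, c2, d2⟩, h2⟩ := fix 2
  have clear : ∀ (j : Fin 3) (x), gen j ((2 : ℂ)⁻¹ • latticeVec t) + latticeVec x =
      (2 : ℂ)⁻¹ • latticeVec t → intAct j t + intShift j + (x + x) = t := fun j x h => by
    apply latticeVec_injective
    rw [gen_apply, Matrix.mulVec_smul, genMat_mulVec_latticeVec, ← smul_add, ← latticeVec_add,
      eq_inv_smul_iff₀ two_ne_zero, smul_add, smul_inv_smul₀ two_ne_zero, two_smul,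
      ← latticeVec_add, ← latticeVec_add] at h
    exact h
  have h0' := clear 0 _ h0
  have h1' := clear 1 _ h1
  have h2' := clear 2 _ h2
  obtain ⟨a, b, c, d⟩ := t
  simp only [intAct, intShift, Prod.mk_add_mk, Prod.fst_zero, Prod.snd_zero,
    Prod.fst_add, Prod.snd_add, Prod.ext_iff] at h0' h1' h2'
  -- the congruences modulo two on the coordinates of `t` are inconsistent
  omega

/-! ### General position in real dimension four -/

section GeneralPosition

open Set Filter
open scoped unitInterval Topology

variable {E : Type*} [NormedAddCommGroup E] [NormedSpace ℝ E] [FiniteDimensional ℝ E]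

/-- A nonempty open set is not covered by countably many `C¹` images of spaces of smaller
dimension. -/
theorem exists_mem_notMem_range {ι F : Type*} [Countable ι] [NormedAddCommGroup F]
    [NormedSpace ℝ F] [FiniteDimensional ℝ F] {f : ι → F → E} (hf : ∀ i, ContDiff ℝ 1 (f i))
    (hdim : Module.finrank ℝ F < Module.finrank ℝ E) {U : Set E} (hU : IsOpen U)
    (hne : U.Nonempty) : ∃ v ∈ U, ∀ i x, f i x ≠ v := by
  have h : dimH (⋃ i, range (f i)) < Module.finrank ℝ E := by
    rw [dimH_iUnion]
    refine lt_of_le_of_lt (iSup_le fun i => (hf i).dimH_range_le) ?_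
    exact_mod_cast hdim
  obtain ⟨v, hvU, hv⟩ := (dense_compl_of_dimH_lt_finrank h).inter_open_nonempty U hU hne
  refine ⟨v, hvU, fun i x hx => hv ?_⟩
  exact mem_iUnion.2 ⟨i, x, hx⟩

/-- The complement of countably many `C¹` images of spaces of real codimension at least two, in a
nonempty convex open set, is path connected: two points are joined by two segments through a third
point in general position. -/
theorem isPathConnected_inter_compl_iUnion_range {ι F : Type*} [Countable ι]
    [NormedAddCommGroup F] [NormedSpace ℝ F] [FiniteDimensional ℝ F] {f : ι → F → E}
    (hf : ∀ i, ContDiff ℝ 1 (f i)) (hdim : Module.finrank ℝ F + 1 < Module.finrank ℝ E)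
    {U : Set E} (hU : IsOpen U) (hconv : Convex ℝ U) (hne : U.Nonempty) :
    IsPathConnected (U ∩ (⋃ i, range (f i))ᶜ) := by
  set A := ⋃ i, range (f i)
  obtain ⟨a, haU, ha⟩ := exists_mem_notMem_range hf (by omega) hU hne
  have haA : a ∉ A := by
    intro h
    obtain ⟨i, x, hx⟩ := mem_iUnion.1 h
    exact ha i x hx
  have hdim' : Module.finrank ℝ (ℝ × F) < Module.finrank ℝ E := by
    rw [Module.finrank_prod, Module.finrank_self]; omega
  have joined : ∀ {y v}, y ∈ U → v ∈ U → y ∉ A → (∀ i (p : ℝ × F),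
      y + p.1 • (f i p.2 - y) ≠ v) → JoinedIn (U ∩ Aᶜ) y v := by
    intro y v hy hv hyA hgen
    refine JoinedIn.of_segment_subset fun w hw => ⟨hconv.segment_subset hy hv hw, fun hwA => ?_⟩
    obtain ⟨i, x, rfl⟩ := mem_iUnion.1 hwA
    rw [segment_eq_image'] at hw
    obtain ⟨t, -, ht⟩ := hw
    beta_reduce at ht
    rcases eq_or_ne t 0 with rfl | ht0
    · apply hyA
      rw [zero_smul, add_zero] at ht
      rwa [ht]
    · refine hgen i (t⁻¹, x) ?_
      rw [← ht, add_sub_cancel_left, smul_smul, inv_mul_cancel₀ ht0, one_smul, add_sub_cancel]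
  refine ⟨a, ⟨haU, haA⟩, fun {y} hy => ?_⟩
  obtain ⟨v, hvU, hv⟩ := exists_mem_notMem_range (ι := Bool × ι) (F := ℝ × F)
    (f := fun i p => (if i.1 then a else y) + p.1 • (f i.2 p.2 - if i.1 then a else y))
    (fun i => by have := hf i.2; fun_prop) hdim' hU hne
  exact (joined haU hvU haA fun i p => hv (true, i) p).trans
    (joined hy.1 hvU hy.2 fun i p => hv (false, i) p).symm

omit [FiniteDimensional ℝ E] in
/-- Two paths in a subset of a vector space are homotopic in it as soon as the segments between
corresponding points stay in it. -/
theorem homotopic_of_lineMap_mem {S : Set E} {x y : S} (γ γ' : Path x y)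
    (h : ∀ s t : I, AffineMap.lineMap (γ t : E) (γ' t : E) (s : ℝ) ∈ S) : γ.Homotopic γ' :=
  ⟨{ toFun := fun p => ⟨AffineMap.lineMap (γ p.2 : E) (γ' p.2 : E) (p.1 : ℝ), h p.1 p.2⟩
     continuous_toFun := by
       simp only [AffineMap.lineMap_apply_module]
       fun_prop
     map_zero_left := fun t => by simp
     map_one_left := fun t => by simp
     prop' := by
       rintro t x (rfl | rfl) <;> simp }⟩

omit [FiniteDimensional ℝ E] in
theorem lineMap_mem_ball {c a b : E} {δ s : ℝ} (ha : a ∈ Metric.ball c δ)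
    (hb : b ∈ Metric.ball c δ) (hs : s ∈ I) : AffineMap.lineMap a b s ∈ Metric.ball c δ :=
  (convex_ball c δ).segment_subset ha hb (segment_eq_image_lineMap ℝ a b ▸ ⟨s, hs, rfl⟩)

/-- Removing a countable relatively closed set from a convex open set of real dimension at least
four leaves a simply connected set: a loop is approximated by a polynomial loop, and the latter is
perturbed so that the straight-line contraction to the base point misses the removed points. -/
theorem isSimplyConnected_diff_countable {U P : Set E} (hdim : 3 < Module.finrank ℝ E)
    (hU : IsOpen U) (hconv : Convex ℝ U) (hne : U.Nonempty) (hP : P.Countable)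
    (hUP : IsOpen (U \ P)) : IsSimplyConnected (U \ P) := by
  have : Countable P := hP.to_subtype
  have hpc : IsPathConnected (U \ P) := by
    have := isPathConnected_inter_compl_iUnion_range (ι := P) (F := ℝ) (f := fun p _ => (p : E))
      (fun i => contDiff_const) (by rw [Module.finrank_self]; omega) hU hconv hne
    convert this
    ext x
    simp [mem_compl_iff]
  rw [IsSimplyConnected, simply_connected_iff_loops_nullhomotopic]
  refine ⟨isPathConnected_iff_pathConnectedSpace.1 hpc, fun x γ => ?_⟩
  have hx : (x : E) ∈ U \ P := x.2
  let g : C(I, E) := ⟨fun t => (γ t : E), by fun_prop⟩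
  obtain ⟨δ, hδ, hthick⟩ := (isCompact_range g.continuous).exists_thickening_subset_open hUP
    (by rintro _ ⟨t, rfl⟩; exact (γ t).2)
  have hball : ∀ t, Metric.ball (g t) δ ⊆ U \ P := fun t =>
    (Metric.ball_subset_thickening (mem_range_self t) δ).trans hthick
  obtain ⟨n, hn0, hn⟩ : ∃ n : ℕ, n ≠ 0 ∧ dist (bernsteinApproximation n g) g < δ / 2 :=
    ((eventually_ne_atTop 0).and ((bernsteinApproximation_uniform g).eventually
      (Metric.ball_mem_nhds g (half_pos hδ)))).exists
  let β : ℝ → E := fun t => ∑ k : Fin (n + 1),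
    ((n.choose k : ℝ) * t ^ (k : ℕ) * (1 - t) ^ (n - k)) • g (bernstein.z k)
  have hβ : ∀ t : I, β t = bernsteinApproximation n g t := fun t => by
    rw [bernsteinApproximation.apply]
    simp only [bernstein_apply, β]
  -- the polynomial loop extends smoothly to `ℝ`
  have hβsmooth : ContDiff ℝ 1 β := by fun_prop
  have hβ0 : β 0 = x := by
    have := hβ 0
    rw [bernsteinApproximation.apply_zero] at this
    simpa [g] using this
  have hβ1 : β 1 = x := by
    have := hβ 1
    rw [bernsteinApproximation.apply_one hn0] at this
    simpa [g] using this
  -- a perturbation `v` outside the values for which some segment from `x` to the perturbed loop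
  -- meets `P`: these form a countable union of images of three-dimensional spaces
  obtain ⟨v, hvδ, hv⟩ := exists_mem_notMem_range (ι := P) (F := ℝ × ℝ × ℝ)
    (f := fun p q => q.2.1 • ((x : E) + q.2.2 • ((p : E) - x) - β q.1))
    (fun i => by fun_prop) (by simpa using hdim) (U := Metric.ball (0 : E) (δ / 2))
    Metric.isOpen_ball ⟨0, Metric.mem_ball_self (half_pos hδ)⟩
  rw [mem_ball_zero_iff] at hvδ
  let η : ℝ → E := fun t => β t + (t * (1 - t)) • v
  have hηcont : Continuous η := by have := hβsmooth.continuous; fun_prop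
  have hηball : ∀ t : I, η t ∈ Metric.ball (g t) δ := fun t => by
    have h1 : dist (β t) (g t) < δ / 2 := by
      rw [hβ]; exact (ContinuousMap.dist_apply_le_dist t).trans_lt hn
    have h2 : ‖((t : ℝ) * (1 - t)) • v‖ ≤ ‖v‖ := by
      rw [norm_smul, Real.norm_eq_abs, abs_of_nonneg (mul_nonneg t.2.1 (sub_nonneg.2 t.2.2))]
      refine mul_le_of_le_one_left (norm_nonneg v) ?_
      nlinarith [t.2.1, t.2.2]
    rw [Metric.mem_ball, dist_eq_norm, show η t - g t = (β t - g t) + ((t : ℝ) * (1 - t)) • v by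
      simp only [η]; abel]
    rw [dist_eq_norm] at h1
    exact (norm_add_le _ _).trans_lt (by linarith)
  let γ' : Path x x :=
    { toFun := fun t => ⟨η t, hball t (hηball t)⟩
      continuous_toFun := by fun_prop
      source' := Subtype.ext (by simp [η, hβ0])
      target' := Subtype.ext (by simp [η, hβ1]) }
  have h1 : γ.Homotopic γ' := homotopic_of_lineMap_mem γ γ' fun s t =>
    hball t (lineMap_mem_ball (Metric.mem_ball_self hδ) (hηball t) s.2)
  refine h1.trans (homotopic_of_lineMap_mem γ' (Path.refl x) fun s t => ⟨?_, fun hmem => ?_⟩)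
  · exact hconv.segment_subset (hball t (hηball t)).1 hx.1
      (segment_eq_image_lineMap ℝ (η t) (x : E) ▸ ⟨s, s.2, rfl⟩)
  · set p := AffineMap.lineMap (γ' t : E) ((Path.refl x) t : E) (s : ℝ) with hp
    have hp' : p = (1 - (s : ℝ)) • η t + (s : ℝ) • (x : E) := by
      rw [hp, AffineMap.lineMap_apply_module]; rfl
    have hηx : η t = x → False := fun h => by
      rw [h, ← add_smul, sub_add_cancel, one_smul] at hp'
      exact hx.2 (hp' ▸ hmem)
    have ht0 : (t : ℝ) ≠ 0 := fun h => hηx (by simp [η, h, hβ0])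
    have ht1 : 1 - (t : ℝ) ≠ 0 := fun h => hηx (by
      rw [← sub_eq_zero.1 h]; simp [η, hβ1])
    have hs1 : 1 - (s : ℝ) ≠ 0 := fun h => hx.2 (by
      rw [h, zero_smul, zero_add, ← sub_eq_zero.1 h, one_smul] at hp'
      exact hp' ▸ hmem)
    -- solving `p = (1 - s) • η t + s • x` for `v` exhibits `v` as an excluded value
    refine hv ⟨p, hmem⟩ (t, ((t : ℝ) * (1 - t))⁻¹, (1 - (s : ℝ))⁻¹) ?_
    have h2 : (1 - (s : ℝ))⁻¹ • (p - (x : E)) = η t - x := by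
      have : p - (x : E) = (1 - (s : ℝ)) • (η t - x) := by
        rw [hp']; module
      rw [this, smul_smul, inv_mul_cancel₀ hs1, one_smul]
    change ((t : ℝ) * (1 - t))⁻¹ • ((x : E) + (1 - (s : ℝ))⁻¹ • (p - (x : E)) - β t) = v
    rw [h2, add_sub_cancel, add_sub_cancel_left, smul_smul,
      inv_mul_cancel₀ (mul_ne_zero ht0 ht1), one_smul]

end GeneralPosition

/-! ### A monodromy principle -/

section Monodromy

open Set Filter
open scoped unitInterval Topology

/-- On a simply connected space, a locally constant Čech cocycle with values in a group is a
coboundary: it defines a covering space, which has a section. -/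
theorem exists_cochain_of_cocycle {B ι Q : Type*} [TopologicalSpace B] [SimplyConnectedSpace B]
    [LocallyPathConnectedSpace B] [Group Q] {U : ι → Set B} (hU : ∀ i, IsOpen (U i))
    (idx : B → ι) (hidx : ∀ x, x ∈ U (idx x)) (g : ι → ι → Q)
    (hg : ∀ i j k, (U i ∩ U j ∩ U k).Nonempty → g i j * g j k = g i k) :
    ∃ f : ι → B → Q, (∀ i S, S ⊆ U i → IsPreconnected S → ∀ x ∈ S, ∀ y ∈ S, f i x = f i y) ∧
      ∀ i j, ∀ x ∈ U i ∩ U j, f j x = f i x * g i j := by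
  let : TopologicalSpace Q := ⊥
  have : DiscreteTopology Q := ⟨rfl⟩
  have hself : ∀ i, ∀ x ∈ U i, g i i = 1 := fun i x hx => by
    have := hg i i i ⟨x, ⟨hx, hx⟩, hx⟩
    simpa using this
  let Z : FiberBundleCore ι B Q :=
    { baseSet := U
      isOpen_baseSet := hU
      indexAt := idx
      mem_baseSet_at := hidx
      coordChange := fun i j _ v => v * g i j
      coordChange_self := fun i x hx v => by rw [hself i x hx, mul_one]
      continuousOn_coordChange := fun i j => by
        have : Continuous fun v : Q => v * g i j := continuous_of_discreteTopology
        exact (this.comp continuous_snd).continuousOn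
      coordChange_comp := fun i j k x hx v => by rw [mul_assoc, hg i j k ⟨x, hx⟩] }
  have hcov : IsCoveringMap (Bundle.TotalSpace.proj : Bundle.TotalSpace Q Z.Fiber → B) :=
    FiberBundle.isCoveringMap
  obtain ⟨b⟩ : Nonempty B := inferInstance
  obtain ⟨sec, ⟨-, hsec⟩, -⟩ := hcov.existsUnique_continuousMap_lifts (ContinuousMap.id B) b
    ⟨b, (1 : Q)⟩ rfl
  have hsec' : ∀ x, (sec x).1 = x := fun x => congrFun hsec x
  refine ⟨fun i x => ((Z.localTriv i) (sec x)).2, fun i S hS hSc x hx y hy => ?_,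
    fun i j x hx => ?_⟩
  · refine hSc.constant (f := fun x => ((Z.localTriv i) (sec x)).2) ?_ hx hy
    refine continuous_snd.comp_continuousOn
      ((Z.localTriv i).continuousOn.comp sec.continuous.continuousOn fun x hx => ?_)
    rw [Z.mem_localTriv_source, hsec']
    exact hS hx
  · simp only [Z.localTriv_apply]
    let q : Q := (sec x).2
    change q * g (idx (sec x).1) j = q * g (idx (sec x).1) i * g i j
    rw [mul_assoc, hg _ _ _ ⟨x, ⟨by rw [hsec']; exact hidx x, hx.1⟩, hx.2⟩]

/-- Let `θ` be a multiplicative function on homotopy classes of paths in `Y ⊆ W`, with `W` simply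
connected. If `W` is covered by open sets `U z` such that `θ` is trivial on the loops in each
`Y ∩ U z`, then `θ` is trivial on all loops of `Y`, provided that the sets `Y ∩ U z ∩ U w` are path
connected and that `Y` meets all the nonempty triple intersections. -/
theorem holonomy_eq_one {E Q : Type*} [TopologicalSpace E] [Group Q] {W Y : Set E}
    [LocallyPathConnectedSpace W] (hW : IsSimplyConnected W) (hYW : Y ⊆ W)
    (θ : ∀ {y y' : Y}, Path.Homotopic.Quotient y y' → Q)
    (hθ : ∀ {y y' y'' : Y} (a : Path.Homotopic.Quotient y y')
      (b : Path.Homotopic.Quotient y' y''), θ (a.trans b) = θ a * θ b)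
    (U : W → Set E) (hUo : ∀ z, IsOpen (U z)) (hzU : ∀ z, (z : E) ∈ U z) (hUW : ∀ z, U z ⊆ W)
    (hUc : ∀ z, IsPreconnected (U z))
    (hpc : ∀ z w, (U z ∩ U w).Nonempty → IsPathConnected (U z ∩ U w ∩ Y))
    (htr : ∀ z w v, (U z ∩ U w ∩ U v).Nonempty → (U z ∩ U w ∩ U v ∩ Y).Nonempty)
    (hloc : ∀ z (y : Y) (γ : Path y y), (∀ t, (γ t : E) ∈ U z) →
      θ (Path.Homotopic.Quotient.mk γ) = 1)
    {y : Y} (γ : Path y y) : θ (Path.Homotopic.Quotient.mk γ) = 1 := by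
  have hθ_refl : ∀ y : Y, θ (Path.Homotopic.Quotient.mk (Path.refl y)) = 1 := fun y =>
    hloc ⟨y, hYW y.2⟩ y _ fun _ => hzU ⟨y, hYW y.2⟩
  have hθ_symm : ∀ {y y' : Y} (γ : Path y y'), θ (Path.Homotopic.Quotient.mk γ) *
      θ (Path.Homotopic.Quotient.mk γ.symm) = 1 := fun {y y'} γ => by
    rw [← hθ, ← Path.Homotopic.Quotient.mk_trans, ← hθ_refl y]
    congr 1
    exact Path.Homotopic.Quotient.eq.2 ⟨(Path.Homotopy.reflTransSymm γ).symm⟩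
  have hθ_cast : ∀ {x y x' y' : Y} (hx : x' = x) (hy : y' = y)
      (q : Path.Homotopic.Quotient x y), θ (q.cast hx hy) = θ q := by
    intro x y x' y' hx hy q
    subst hx hy
    simp
  -- a path in a path connected subset of `Y`, as a path of `Y`
  have inPath : ∀ {S : Set E} (_ : IsPathConnected (S ∩ Y)) (y y' : Y), (y : E) ∈ S →
      (y' : E) ∈ S → ∃ γ : Path y y', ∀ t, (γ t : E) ∈ S := by
    intro S hS y y' hy hy'
    obtain ⟨p, hp⟩ := hS.joinedIn (y : E) ⟨hy, y.2⟩ (y' : E) ⟨hy', y'.2⟩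
    exact ⟨{ toFun := fun t => ⟨p t, (hp t).2⟩
             continuous_toFun := by fun_prop
             source' := Subtype.ext p.source
             target' := Subtype.ext p.target }, fun t => (hp t).1⟩
  have hUpc : ∀ z, IsPathConnected (U z ∩ Y) := fun z => by
    have := hpc z z ⟨z, hzU z, hzU z⟩
    rwa [inter_self] at this
  -- a potential for `θ` on `U z ∩ Y`
  have hτ : ∀ z, ∃ τ : Y → Q, ∀ (y y' : Y) (γ : Path y y'), (∀ t, (γ t : E) ∈ U z) →
      τ y * θ (Path.Homotopic.Quotient.mk γ) = τ y' := by
    classical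
    intro z
    obtain ⟨c, hc⟩ := (hUpc z).nonempty
    have hp : ∀ y : Y, (y : E) ∈ U z →
        ∃ γ : Path (⟨c, hc.2⟩ : Y) y, ∀ t, (γ t : E) ∈ U z := fun y hy =>
      inPath (hUpc z) _ _ hc.1 hy
    choose p hp using hp
    refine ⟨fun y => if h : (y : E) ∈ U z then θ (Path.Homotopic.Quotient.mk (p y h)) else 1,
      fun y y' γ hγ => ?_⟩
    have hy : (y : E) ∈ U z := by have := hγ 0; rwa [γ.source] at this
    have hy' : (y' : E) ∈ U z := by have := hγ 1; rwa [γ.target] at this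
    simp only [dif_pos hy, dif_pos hy']
    rw [← hθ, ← Path.Homotopic.Quotient.mk_trans]
    have h1 := hloc z _ (((p y hy).trans γ).trans (p y' hy').symm) fun t => by
      have : (((p y hy).trans γ).trans (p y' hy').symm) t ∈
          range (((p y hy).trans γ).trans (p y' hy').symm) := mem_range_self t
      rw [Path.trans_range, Path.trans_range, Path.symm_range] at this
      rcases this with (⟨s, hs⟩ | ⟨s, hs⟩) | ⟨s, hs⟩ <;> rw [← hs]
      exacts [hp y hy s, hγ s, hp y' hy' s]
    rw [Path.Homotopic.Quotient.mk_trans, hθ] at h1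
    exact mul_right_cancel (h1.trans (hθ_symm (p y' hy')).symm)
  choose τ hτ using hτ
  classical
  let g : W → W → Q := fun z w => if h : (U z ∩ U w ∩ Y).Nonempty then
    τ z ⟨h.some, h.some_mem.2⟩ * (τ w ⟨h.some, h.some_mem.2⟩)⁻¹ else 1
  have hg : ∀ z w (u : Y), (u : E) ∈ U z ∩ U w → g z w = τ z u * (τ w u)⁻¹ := fun z w u hu => by
    have h : (U z ∩ U w ∩ Y).Nonempty := ⟨u, hu, u.2⟩
    obtain ⟨γ, hγ⟩ := inPath (hpc z w ⟨u, hu⟩) u ⟨h.some, h.some_mem.2⟩ hu h.some_mem.1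
    simp only [g, dif_pos h]
    rw [← hτ z _ _ γ fun t => (hγ t).1, ← hτ w _ _ γ fun t => (hγ t).2]
    group
  have := hW.simplyConnectedSpace
  obtain ⟨f, hfc, hf⟩ := exists_cochain_of_cocycle (B := W) (U := fun z => Subtype.val ⁻¹' U z)
    (fun z => (hUo z).preimage continuous_subtype_val) id hzU g (by
      rintro i j k ⟨x, hx⟩
      obtain ⟨u, ⟨⟨hi, hj⟩, hk⟩, huY⟩ := htr i j k ⟨x, hx⟩
      rw [hg i j ⟨u, huY⟩ ⟨hi, hj⟩, hg j k ⟨u, huY⟩ ⟨hj, hk⟩, hg i k ⟨u, huY⟩ ⟨hi, hk⟩]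
      group)
  let toW : Y → W := fun y => ⟨y, hYW y.2⟩
  -- the global potential
  let H : Y → Q := fun y => f (toW y) (toW y) * τ (toW y) y
  have hH : ∀ z (y : Y), (y : E) ∈ U z → H y = f z (toW y) * τ z y := fun z y hy => by
    have h1 := hf (toW y) z (toW y) ⟨hzU _, hy⟩
    rw [h1, hg (toW y) z y ⟨hzU (toW y), hy⟩]
    simp only [H]
    group
  have hHγ : ∀ z (y y' : Y) (γ : Path y y'), (∀ t, (γ t : E) ∈ U z) →
      H y * θ (Path.Homotopic.Quotient.mk γ) = H y' := fun z y y' γ hγ => by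
    have hy : (y : E) ∈ U z := by have := hγ 0; rwa [γ.source] at this
    have hy' : (y' : E) ∈ U z := by have := hγ 1; rwa [γ.target] at this
    have hcon : f z (toW y) = f z (toW y') := by
      refine hfc z _ Subset.rfl ?_ _ hy _ hy'
      rw [← Topology.IsInducing.subtypeVal.isPreconnected_image, Subtype.image_preimage_coe,
        inter_eq_right.2 (hUW z)]
      exact hUc z
    rw [hH z y hy, hH z y' hy', mul_assoc, hτ z y y' γ hγ, hcon]
  -- the discrepancy along the path is locally constant
  let k : I → Q := fun t => H (γ 0) * θ (Path.Homotopic.Quotient.mk (γ.subpath 0 t)) * (H (γ t))⁻¹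
  have hk : IsLocallyConstant k := by
    rw [IsLocallyConstant.iff_eventually_eq]
    intro t
    have hnh : {t' | (γ t' : E) ∈ U (toW (γ t))} ∈ 𝓝 t :=
      ((hUo _).preimage (continuous_subtype_val.comp γ.continuous)).mem_nhds (hzU (toW (γ t)))
    obtain ⟨ε, hε, hball⟩ := Metric.mem_nhds_iff.1 hnh
    filter_upwards [Metric.ball_mem_nhds t hε] with t' ht'
    have hsub : ∀ u, (γ.subpath t t' u : E) ∈ U (toW (γ t)) := fun u => by
      have hu : γ.subpath t t' u ∈ range (γ.subpath t t') := mem_range_self u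
      rw [Path.range_subpath] at hu
      obtain ⟨v, hv, hvu⟩ := hu
      rw [← hvu]
      refine hball ?_
      rw [Metric.mem_ball, Subtype.dist_eq, Real.dist_eq] at ht' ⊢
      refine lt_of_le_of_lt ?_ ht'
      have hv' : (v : ℝ) ∈ uIcc (t : ℝ) t' := by
        rw [mem_uIcc] at hv ⊢
        exact hv
      exact abs_sub_left_of_mem_uIcc hv'
    have h1 := hHγ _ _ _ _ hsub
    have h2 : θ (Path.Homotopic.Quotient.mk (γ.subpath 0 t')) =
        θ (Path.Homotopic.Quotient.mk (γ.subpath 0 t)) *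
        θ (Path.Homotopic.Quotient.mk (γ.subpath t t')) := by
      rw [← hθ, ← Path.Homotopic.Quotient.mk_trans]
      congr 1
      exact Path.Homotopic.Quotient.eq.2 ⟨(Path.Homotopy.subpathTransSubpath γ 0 t t').symm⟩
    simp only [k]
    rw [h2, ← h1]
    group
  have h01 := hk.apply_eq_of_preconnectedSpace 1 0
  simp only [k] at h01
  rw [Path.subpath_self, hθ_refl, mul_one, mul_inv_cancel, Path.subpath_zero_one,
    Path.Homotopic.Quotient.mk_cast, hθ_cast, γ.source, γ.target] at h01
  simpa [mul_inv_eq_one] using h01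

end Monodromy

open Set Filter
open scoped Topology unitInterval

/-! ### Fixed points and stabilizers -/

theorem exists_cayleyHamilton (f : C2 →ₗ[ℂ] C2) :
    ∃ t : ℂ, ∀ w, f (f w) = t • f w - LinearMap.det f • w := by
  obtain ⟨A, rfl⟩ := Matrix.toLin'.surjective f
  refine ⟨A 0 0 + A 1 1, fun w => ?_⟩
  rw [LinearMap.det_toLin', Matrix.det_fin_two]
  ext i
  fin_cases i <;> simp [Matrix.mulVec, dotProduct, Fin.sum_univ_two] <;> ring

/-- The characteristic polynomial of a linear map of `ℂ²` fixing a nonzero vector. -/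
theorem apply_apply_of_fixed {f : C2 →ₗ[ℂ] C2} {v : C2} (hv : v ≠ 0) (hf : f v = v) (w : C2) :
    f (f w) = (1 + LinearMap.det f) • f w - LinearMap.det f • w := by
  obtain ⟨t, ht⟩ := exists_cayleyHamilton f
  have h := ht v
  rw [hf, hf, ← sub_smul, eq_comm, ← sub_eq_zero] at h
  nth_rw 2 [← one_smul ℂ v] at h
  rw [← sub_smul, smul_eq_zero, or_iff_left hv] at h
  rw [ht, show t = 1 + LinearMap.det f by linear_combination h]

/-- A linear map of `ℂ²` of determinant one and finite order which fixes a nonzero vector is the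
identity. -/
theorem eq_one_of_det_eq_one {f : C2 →ₗ[ℂ] C2} (hfin : IsOfFinOrder f) {v : C2} (hv : v ≠ 0)
    (hf : f v = v) (hdet : LinearMap.det f = 1) : f = 1 := by
  obtain ⟨n, hn, hfn⟩ := isOfFinOrder_iff_pow_eq_one.1 hfin
  have key : ∀ (k : ℕ) (w : C2), (f ^ k) w = w + (k : ℂ) • (f w - w) := fun k => by
    induction k with
    | zero => intro w; simp
    | succ k ih =>
      intro w
      rw [pow_succ, Module.End.mul_apply, ih, apply_apply_of_fixed hv hf, hdet]
      push_cast
      module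
  refine LinearMap.ext fun w => ?_
  have h := key n w
  rw [hfn, Module.End.one_apply, left_eq_add, smul_eq_zero, Nat.cast_eq_zero,
    or_iff_right hn.ne', sub_eq_zero] at h
  exact h

theorem apply_eq_iff_linear {g : C2 ≃ᵃ[ℂ] C2} {z b : C2} (hz : g z = z) :
    g (z + b) = z + b ↔ g.linear b = b := by
  rw [apply_add, hz, add_right_inj]

theorem eq_one_of_linear_eq_one {g : C2 ≃ᵃ[ℂ] C2} {z : C2} (hz : g z = z)
    (h : ∀ b, g.linear b = b) : g = 1 := by
  ext1 w
  have := (apply_eq_iff_linear (b := w - z) hz).2 (h _)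
  rw [add_sub_cancel] at this
  exact this

theorem isAffineReflection_iff_ne_one {g : C2 ≃ᵃ[ℂ] C2} (hg : g ∈ G) :
    IsAffineReflection g ↔ g ≠ 1 ∧ ∃ z z', z ≠ z' ∧ g z = z ∧ g z' = z' := by
  rw [isAffineReflection_iff hg]
  constructor
  · rintro ⟨⟨z, hz⟩, h1⟩
    constructor
    · rintro rfl
      have h0 : LinearMap.ker (((1 : C2 ≃ᵃ[ℂ] C2).linear : C2 →ₗ[ℂ] C2) - LinearMap.id) = ⊤ := by
        rw [LinearMap.ker_eq_top, sub_eq_zero]; rfl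
      rw [h0, finrank_top] at h1
      simp at h1
    · obtain ⟨⟨v, hv⟩, hv0⟩ := (Module.finrank_pos_iff_exists_ne_zero (R := ℂ)).1
        (h1.symm ▸ Nat.one_pos)
      rw [LinearMap.mem_ker, LinearMap.sub_apply, sub_eq_zero] at hv
      refine ⟨z, z + v, fun h => hv0 ?_, hz, (apply_eq_iff_linear hz).2 hv⟩
      exact Subtype.ext (left_eq_add.1 h)
  · rintro ⟨h1, z, z', hne, hz, hz'⟩
    refine ⟨⟨z, hz⟩, finrank_ker_sub_id (v := z' - z) (fun h => h1 ?_) (sub_ne_zero.2 hne.symm) ?_⟩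
    · exact eq_one_of_linear_eq_one hz fun b => LinearMap.congr_fun h b
    · rw [← add_sub_cancel z z'] at hz'
      exact (apply_eq_iff_linear hz).1 hz'

theorem isOfFinOrder_linear {g : C2 ≃ᵃ[ℂ] C2} (hg : g ∈ G) {z : C2} (hz : g z = z) :
    IsOfFinOrder g.linear :=
  AffineEquiv.linearHom.isOfFinOrder (isOfFinOrder_of_apply_eq hg hz)

theorem isOfFinOrder_linearMap {f : C2 ≃ₗ[ℂ] C2} (hf : IsOfFinOrder f) :
    IsOfFinOrder (f : C2 →ₗ[ℂ] C2) :=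
  (LinearEquiv.automorphismGroup.toLinearMapMonoidHom (R := ℂ) (M := C2)).isOfFinOrder hf

theorem isReflection_linear_iff {g : C2 ≃ᵃ[ℂ] C2} (hg : g ∈ G) {z : C2} (hz : g z = z) :
    IsReflection g.linear ↔ IsAffineReflection g := by
  rw [isAffineReflection_iff hg, IsReflection, and_iff_right (isOfFinOrder_linear hg hz),
    and_iff_right ⟨z, hz⟩]

/-- An element of `G` with two fixed points is determined by its determinant `±1`; for determinant
one it is the identity. -/
theorem eq_one_of_fixed_of_det {g : C2 ≃ᵃ[ℂ] C2} (hg : g ∈ G) {z z' : C2} (hne : z ≠ z')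
    (hz : g z = z) (hz' : g z' = z') (hdet : LinearMap.det (g.linear : C2 →ₗ[ℂ] C2) = 1) :
    g = 1 := by
  rw [← add_sub_cancel z z'] at hz'
  refine eq_one_of_linear_eq_one hz fun b => LinearMap.congr_fun (eq_one_of_det_eq_one
    (isOfFinOrder_linearMap (isOfFinOrder_linear hg hz)) (sub_ne_zero.2 hne.symm)
      ((apply_eq_iff_linear hz).1 hz') hdet) b

theorem mul_self_eq_one_of_fixed {g : C2 ≃ᵃ[ℂ] C2} (hg : g ∈ G) {z z' : C2} (hne : z ≠ z')
    (hz : g z = z) (hz' : g z' = z') : g * g = 1 := by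
  rcases det_linear hg with hdet | hdet
  · rw [eq_one_of_fixed_of_det hg hne hz hz' hdet, one_mul]
  · rw [← add_sub_cancel z z'] at hz'
    have hz2 : (g * g) z = z := by change g (g z) = z; rw [hz, hz]
    refine eq_one_of_linear_eq_one hz2 fun b => ?_
    have := apply_apply_of_fixed (f := g.linear) (sub_ne_zero.2 hne.symm)
      ((apply_eq_iff_linear hz).1 hz') b
    rw [hdet] at this
    change g.linear (g.linear b) = b
    simpa using this

theorem det_linear_mul (g h : C2 ≃ᵃ[ℂ] C2) :
    LinearMap.det ((g * h).linear : C2 →ₗ[ℂ] C2) =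
      LinearMap.det (g.linear : C2 →ₗ[ℂ] C2) * LinearMap.det (h.linear : C2 →ₗ[ℂ] C2) := by
  rw [← LinearMap.det_comp]; rfl

/-- The points which are the unique fixed point of some element of `G`. -/
def isolatedPoints : Set C2 := {z | ∃ g ∈ G, g z = z ∧ ∀ w, g w = w → w = z}

/-- The points with trivial stabilizer. -/
def freePoints : Set C2 := {z | ∀ g ∈ G, g z = z → g = 1}

/-- At a point which is not an isolated fixed point the stabilizer has order at most two: nontrivial
elements of it have determinant `-1`, so that the product of two of them has determinant one and
fixes a second point. -/
theorem eq_of_fixed_of_notMem_isolatedPoints {z : C2} (hz : z ∉ isolatedPoints)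
    {g h : C2 ≃ᵃ[ℂ] C2} (hg : g ∈ G) (hh : h ∈ G) (hgz : g z = z) (hhz : h z = z) (hg1 : g ≠ 1)
    (hh1 : h ≠ 1) : g = h := by
  have other : ∀ k ∈ G, k z = z → ∃ w, z ≠ w ∧ k w = w := fun k hk hkz => by
    by_contra hcon
    push Not at hcon
    exact hz ⟨k, hk, hkz, fun w hw => by_contra fun hne => hcon w (Ne.symm hne) hw⟩
  have hdet : ∀ k ∈ G, k z = z → k ≠ 1 → LinearMap.det (k.linear : C2 →ₗ[ℂ] C2) = -1 :=
    fun k hk hkz hk1 => by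
      obtain ⟨w, hne, hw⟩ := other k hk hkz
      exact (det_linear hk).resolve_left fun hd => hk1 (eq_one_of_fixed_of_det hk hne hkz hw hd)
  have hghz : (g * h) z = z := by change g (h z) = z; rw [hhz, hgz]
  obtain ⟨w, hne, hw⟩ := other (g * h) (mul_mem hg hh) hghz
  have h1 : g * h = 1 := eq_one_of_fixed_of_det (mul_mem hg hh) hne hghz hw (by
    rw [det_linear_mul, hdet g hg hgz hg1, hdet h hh hhz hh1]; norm_num)
  obtain ⟨w, hne, hw⟩ := other g hg hgz
  have h2 := mul_self_eq_one_of_fixed hg hne hgz hw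
  exact mul_left_cancel (h2.trans h1.symm)

theorem proj_mem_M_iff {z : C2} : proj z ∈ M ↔ ∃ g ∈ G, IsAffineReflection g ∧ g z = z := by
  constructor
  · rintro ⟨w, ⟨g, hg, hr, hgw⟩, hw⟩
    obtain ⟨h, hh, rfl⟩ := proj_eq_iff.1 hw
    have hm : h * g * h⁻¹ ∈ G := mul_mem (mul_mem hh hg) (inv_mem hh)
    have hc : ∀ u, g u = u → (h * g * h⁻¹) (h u) = h u := fun u hu => by
      change h (g (h⁻¹ (h u))) = h u
      rw [show h⁻¹ (h u) = u from h.symm_apply_apply u, hu]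
    refine ⟨h * g * h⁻¹, hm, ?_, hc w hgw⟩
    rw [isAffineReflection_iff_ne_one hg] at hr
    obtain ⟨h1, a, b, hab, ha, hb⟩ := hr
    rw [isAffineReflection_iff_ne_one hm]
    exact ⟨fun h2 => h1 (conj_eq_one_iff.1 h2), h a, h b, h.injective.ne hab, hc a ha, hc b hb⟩
  · rintro ⟨g, hg, hr, hgz⟩
    exact ⟨z, ⟨g, hg, hr, hgz⟩, rfl⟩

/-- The linear parts of the elements of the stabilizer of `z`. -/
def linStab (z : C2) : Subgroup (C2 ≃ₗ[ℂ] C2) :=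
  (G ⊓ MulAction.stabilizer (C2 ≃ᵃ[ℂ] C2) z).map AffineEquiv.linearHom

theorem mem_linStab {z : C2} {γ : C2 ≃ₗ[ℂ] C2} :
    γ ∈ linStab z ↔ ∃ g ∈ G, g z = z ∧ g.linear = γ := by
  rw [linStab, Subgroup.mem_map]
  exact ⟨fun ⟨g, ⟨hg, hz⟩, h⟩ => ⟨g, hg, hz, h⟩, fun ⟨g, hg, hz, h⟩ => ⟨g, ⟨hg, hz⟩, h⟩⟩

instance finite_linStab (z : C2) : Finite (linStab z) := by
  have h : (linStab z : Set (C2 ≃ₗ[ℂ] C2)) ⊆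
      (fun g : G => (g : C2 ≃ᵃ[ℂ] C2).linear) '' (MulAction.stabilizer G z : Set G) := by
    intro γ hγ
    obtain ⟨g, hg, hz, rfl⟩ := mem_linStab.1 hγ
    exact ⟨⟨g, hg⟩, hz, rfl⟩
  exact (((ProperlyDiscontinuousSMul.finite_stabilizer z).image _).subset h).to_subtype

/-! ### Slices and orbifold charts -/

/-- `z + B` is a neighbourhood of `z` which meets only those of its translates by `G` that
coincide with it. -/
structure IsSlice (z : C2) (B : Set C2) : Prop where
  isOpen : IsOpen B
  convex : Convex ℝ B
  zero_mem : (0 : C2) ∈ B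
  invariant : ∀ γ ∈ linStab z, ∀ b ∈ B, γ b ∈ B
  fixed : ∀ g ∈ G, ∀ b ∈ B, ∀ b' ∈ B, g (z + b) = z + b' → g z = z

theorem exists_nhds_fixed (z : C2) : ∃ V ∈ 𝓝 z, ∀ g ∈ G, ∀ w ∈ V, g w ∈ V → g z = z := by
  obtain ⟨V, hV, h⟩ := ProperlyDiscontinuousSMul.exists_nhds_image_smul_eq_self G z
  exact ⟨V, hV, fun g hg w hw hgw => h ⟨g, hg⟩ ⟨_, ⟨w, hw, rfl⟩, hgw⟩⟩

theorem exists_isSlice (z : C2) {V : Set C2} (hV : V ∈ 𝓝 z) :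
    ∃ B, IsSlice z B ∧ ∀ b ∈ B, z + b ∈ V := by
  obtain ⟨V', hV', hfix⟩ := exists_nhds_fixed z
  obtain ⟨ε, hε, hball⟩ := Metric.mem_nhds_iff.1 (inter_mem hV hV')
  have hmem : ∀ b ∈ Metric.ball (0 : C2) ε, z + b ∈ V ∩ V' := fun b hb =>
    hball (by simpa [Metric.mem_ball, dist_eq_norm] using hb)
  refine ⟨{b | ∀ γ ∈ linStab z, γ b ∈ Metric.ball (0 : C2) ε}, ⟨?_, ?_, ?_, ?_, ?_⟩,
    fun b hb => (hmem b (hb 1 (one_mem _))).1⟩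
  · have h : {b : C2 | ∀ γ ∈ linStab z, γ b ∈ Metric.ball (0 : C2) ε} =
        ⋂ γ ∈ (linStab z : Set (C2 ≃ₗ[ℂ] C2)), {b : C2 | γ b ∈ Metric.ball (0 : C2) ε} := by
      ext b
      rw [mem_iInter₂]
      rfl
    rw [h]
    refine (finite_coe_iff.1 (finite_linStab z)).isOpen_biInter fun γ _ => ?_
    exact Metric.isOpen_ball.preimage
      (LinearMap.continuous_of_finiteDimensional (γ : C2 →ₗ[ℂ] C2))
  · intro a ha b hb t u ht hu htu γ hγ
    have h : γ (t • a + u • b) = t • γ a + u • γ b := by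
      rw [map_add]
      congr 1
      · exact (((γ : C2 →ₗ[ℂ] C2)).restrictScalars ℝ).map_smul t a
      · exact (((γ : C2 →ₗ[ℂ] C2)).restrictScalars ℝ).map_smul u b
    rw [h]
    exact convex_ball (0 : C2) ε (ha γ hγ) (hb γ hγ) ht hu htu
  · intro γ _
    rw [map_zero]
    exact Metric.mem_ball_self hε
  · intro γ hγ b hb δ hδ
    exact hb (δ * γ) (mul_mem hδ hγ)
  · intro g hg b hb b' hb' h
    exact hfix g hg (z + b) (hmem b (hb 1 (one_mem _))).2
      (h ▸ (hmem b' (hb' 1 (one_mem _))).2)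

theorem continuous_affine (g : C2 ≃ᵃ[ℂ] C2) : Continuous g :=
  g.toAffineMap.continuous_of_finiteDimensional

/-- Affine transformations are homeomorphisms. -/
def affineHomeo (g : C2 ≃ᵃ[ℂ] C2) : C2 ≃ₜ C2 where
  toEquiv := g.toEquiv
  continuous_toFun := continuous_affine g
  continuous_invFun := continuous_affine g⁻¹

theorem differentiable_affine (g : C2 ≃ᵃ[ℂ] C2) : Differentiable ℂ g := by
  have h : (g : C2 → C2) = fun z => LinearMap.toContinuousLinearMap (g.linear : C2 →ₗ[ℂ] C2) z +
      g 0 := funext fun z => apply_eq_linear_add g z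
  rw [h]
  exact (ContinuousLinearMap.differentiable _).add_const _

theorem IsSlice.isQuotientChart {z : C2} {B : Set C2} (h : IsSlice z B) :
    IsQuotientChart OX (linStab z) B fun b => proj (z + b) where
  isOpen := h.isOpen
  isConnected := ⟨⟨0, h.zero_mem⟩, h.convex.isPreconnected⟩
  zero_mem := h.zero_mem
  invariant := h.invariant
  continuousOn := (continuous_proj.comp (continuous_const_add z)).continuousOn
  isOpen_image V hVB hV := by
    have : (fun b => proj (z + b)) '' V = proj '' ((fun b => z + b) '' V) := (image_image ..).symm
    rw [this]
    exact isOpenMap_proj _ (isOpenMap_add_left z _ hV)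
  fiber b hb b' hb' := by
    rw [proj_eq_iff]
    constructor
    · rintro ⟨g, hg, hgb⟩
      have hz := h.fixed g hg b hb b' hb' hgb
      refine ⟨g.linear, mem_linStab.2 ⟨g, hg, hz, rfl⟩, ?_⟩
      rwa [apply_add, hz, add_right_inj] at hgb
    · rintro ⟨γ, hγ, rfl⟩
      obtain ⟨g, hg, hz, rfl⟩ := mem_linStab.1 hγ
      exact ⟨g, hg, by rw [apply_add, hz]⟩
  isHol_iff U hU f := by
    change DifferentiableOn ℂ (f ∘ proj) (proj ⁻¹' U) ↔ _
    constructor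
    · intro hf
      have h1 : DifferentiableOn ℂ (fun b : C2 => z + b) (B ∩ (fun b => proj (z + b)) ⁻¹' U) :=
        (differentiable_id.const_add z).differentiableOn
      exact DifferentiableOn.comp (g := f ∘ proj) (f := fun b : C2 => z + b)
        (t := proj ⁻¹' (U : Set X)) hf h1 fun b hb => hb.2
    · intro hf y hy
      obtain ⟨b, hb, hby⟩ := hU hy
      obtain ⟨g, hg, hgy⟩ := proj_eq_iff.1 hby.symm
      have heq : f ∘ proj = (f ∘ fun b => proj (z + b)) ∘ fun w => g w - z := by
        funext w
        simp only [Function.comp_apply, add_sub_cancel, proj_apply hg]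
      have hO : IsOpen (B ∩ (fun b => proj (z + b)) ⁻¹' U) :=
        h.isOpen.inter (U.isOpen.preimage (continuous_proj.comp (continuous_const_add z)))
      have hbO : g y - z ∈ B ∩ (fun b => proj (z + b)) ⁻¹' U := by
        rw [hgy, add_sub_cancel_left]
        refine ⟨hb, ?_⟩
        change proj (z + b) ∈ U
        rw [show proj (z + b) = proj y from hby]
        exact hy
      have h1 := (hf _ hbO).differentiableAt (hO.mem_nhds hbO)
      rw [heq]
      exact (h1.comp y ((differentiable_affine g y).sub_const z)).differentiableWithinAt

/-- In the linear part of a stabilizer, the pointwise stabilizer of a mirror has order two, since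
its elements are determined by their determinants `±1`. -/
theorem card_pointwise_stabilizer {z : C2} {γ : C2 ≃ₗ[ℂ] C2} (hγ : γ ∈ linStab z)
    (hr : IsReflection γ) :
    Nat.card {δ : C2 ≃ₗ[ℂ] C2 // δ ∈ linStab z ∧ ∀ v, γ v = v → δ v = v} = 2 := by
  obtain ⟨g, hg, hz, rfl⟩ := mem_linStab.1 hγ
  rw [isReflection_linear_iff hg hz, isAffineReflection_iff hg] at hr
  obtain ⟨⟨v, hv⟩, hv0⟩ := (Module.finrank_pos_iff_exists_ne_zero (R := ℂ)).1
    (hr.2.symm ▸ Nat.one_pos)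
  rw [LinearMap.mem_ker, LinearMap.sub_apply, sub_eq_zero] at hv
  have hv0' : v ≠ 0 := fun h => hv0 (Subtype.ext h)
  have hne : ∀ k : C2 ≃ᵃ[ℂ] C2, k z = z → k.linear v = v → k (z + v) = z + v :=
    fun k hkz hkv => (apply_eq_iff_linear hkz).2 hkv
  have hzv : z ≠ z + v := fun h => hv0' (left_eq_add.1 h)
  have h1 : g ≠ 1 := ((isAffineReflection_iff_ne_one hg).1
    ((isAffineReflection_iff hg).2 hr)).1
  have hdet : LinearMap.det (g.linear : C2 →ₗ[ℂ] C2) = -1 :=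
    (det_linear hg).resolve_left fun h => h1 (eq_one_of_fixed_of_det hg hzv hz (hne g hz hv) h)
  rw [Nat.card_eq_two_iff]
  refine ⟨⟨1, one_mem _, fun _ _ => rfl⟩, ⟨g.linear, hγ, fun _ h => h⟩, fun h => h1 ?_, ?_⟩
  · refine eq_one_of_linear_eq_one hz fun b => ?_
    exact (LinearEquiv.congr_fun (congrArg Subtype.val h) b).symm
  · refine eq_univ_of_forall ?_
    rintro ⟨δ, hδ, hfix⟩
    obtain ⟨k, hk, hkz, rfl⟩ := mem_linStab.1 hδ
    have hkv := hne k hkz (hfix v hv)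
    rcases det_linear hk with hd | hd
    · left
      refine Subtype.ext ?_
      change k.linear = 1
      rw [eq_one_of_fixed_of_det hk hzv hkz hkv hd]; rfl
    · right
      refine Subtype.ext ?_
      change k.linear = g.linear
      have hgk : g * k = 1 := eq_one_of_fixed_of_det (mul_mem hg hk) hzv
        (by change g (k z) = z; rw [hkz, hz])
        (by change g (k (z + v)) = z + v; rw [hkv, hne g hz hv])
        (by rw [det_linear_mul, hdet, hd]; norm_num)
      have hgg := mul_self_eq_one_of_fixed hg hzv hz (hne g hz hv)
      rw [mul_left_cancel (hgk.trans hgg.symm)]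

theorem IsSlice.isOrbifoldChart {z : C2} {B : Set C2} (h : IsSlice z B) :
    IsOrbifoldChart OX M 2 (linStab z) B fun b => proj (z + b) where
  toIsQuotientChart := h.isQuotientChart
  finite := finite_linStab z
  branch b hb := by
    rw [proj_mem_M_iff]
    constructor
    · rintro ⟨g, hg, hr, hgb⟩
      have hz := h.fixed g hg b hb b hb hgb
      exact ⟨g.linear, mem_linStab.2 ⟨g, hg, hz, rfl⟩, (isReflection_linear_iff hg hz).2 hr,
        (apply_eq_iff_linear hz).1 hgb⟩
    · rintro ⟨γ, hγ, hr, hγb⟩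
      obtain ⟨g, hg, hz, rfl⟩ := mem_linStab.1 hγ
      exact ⟨g, hg, (isReflection_linear_iff hg hz).1 hr, (apply_eq_iff_linear hz).2 hγb⟩
  index _ hγ hr := card_pointwise_stabilizer hγ hr

theorem isOrbifoldPair : IsOrbifoldPair OX M 2 := by
  refine ⟨inferInstanceAs (T2Space (Quotient (MulAction.orbitRel G C2))),
    isOpenMap_proj.isQuotientMap continuous_proj surjective_proj |>.secondCountableTopology
      isOpenMap_proj, fun x => ?_⟩
  obtain ⟨z, rfl⟩ := surjective_proj x
  obtain ⟨B, hB, -⟩ := exists_isSlice z univ_mem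
  exact ⟨_, B, _, hB.isOrbifoldChart, by simp⟩

/-! ### The uniformization and its deck group -/

/-- The translate of the slice `z + B` by `g`. -/
def tile (z : C2) (B : Set C2) (g : C2 ≃ᵃ[ℂ] C2) : Set C2 := (fun b => g (z + b)) '' B

theorem isOpen_tile {z : C2} {B : Set C2} (hB : IsOpen B) (g : C2 ≃ᵃ[ℂ] C2) :
    IsOpen (tile z B g) := by
  have : tile z B g = g '' ((fun b => z + b) '' B) := (image_image ..).symm
  rw [this]
  exact (affineHomeo g).isOpenMap _ (isOpenMap_add_left z _ hB)

theorem IsSlice.tile_subset {z : C2} {B : Set C2} (h : IsSlice z B) {g g' : C2 ≃ᵃ[ℂ] C2}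
    (hg : g ∈ G) (hg' : g' ∈ G) (hne : (tile z B g ∩ tile z B g').Nonempty) :
    (g'⁻¹ * g) z = z ∧ tile z B g ⊆ tile z B g' := by
  obtain ⟨_, ⟨b, hb, rfl⟩, b', hb', hbb'⟩ := hne
  have hk : g'⁻¹ * g ∈ G := mul_mem (inv_mem hg') hg
  have heq : ∀ w, g' ((g'⁻¹ * g) w) = g w := fun w => g'.apply_symm_apply (g w)
  have hz : (g'⁻¹ * g) z = z := h.fixed _ hk b hb b' hb'
    (g'.injective (by rw [heq]; exact hbb'.symm))
  refine ⟨hz, ?_⟩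
  rintro _ ⟨c, hc, rfl⟩
  refine ⟨(g'⁻¹ * g).linear c, h.invariant _ (mem_linStab.2 ⟨_, hk, hz, rfl⟩) c hc, ?_⟩
  beta_reduce
  rw [← heq (z + c), apply_add (g'⁻¹ * g), hz]

theorem preimage_image_eq_iUnion_tile (z : C2) (B : Set C2) :
    proj ⁻¹' ((fun b => proj (z + b)) '' B) = ⋃ g ∈ G, tile z B g := by
  ext w
  simp only [mem_preimage, mem_image, mem_iUnion, tile, exists_prop, proj_eq_iff]
  constructor
  · rintro ⟨b, hb, g, hg, rfl⟩
    exact ⟨g, hg, b, hb, rfl⟩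
  · rintro ⟨g, hg, b, hb, rfl⟩
    exact ⟨b, hb, g, hg, rfl⟩

/-- A connected set over a slice lies in a single translate of the slice. -/
theorem IsSlice.subset_tile {z : C2} {B : Set C2} (h : IsSlice z B) {S : Set C2}
    (hS : IsPreconnected S) (hSB : ∀ w ∈ S, ∃ g ∈ G, w ∈ tile z B g) {g : C2 ≃ᵃ[ℂ] C2}
    (hg : g ∈ G) (hne : (S ∩ tile z B g).Nonempty) : S ⊆ tile z B g := by
  refine hS.subset_left_of_subset_union (isOpen_tile h.isOpen g)
    (v := ⋃ k ∈ {k | k ∈ G ∧ Disjoint (tile z B k) (tile z B g)}, tile z B k)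
    (isOpen_biUnion fun k _ => isOpen_tile h.isOpen k) ?_ (fun w hw => ?_) hne
  · rw [disjoint_iUnion₂_right]
    exact fun k hk => hk.2.symm
  · obtain ⟨k, hk, hwk⟩ := hSB w hw
    by_cases hd : Disjoint (tile z B k) (tile z B g)
    · exact Or.inr (mem_biUnion ⟨hk, hd⟩ hwk)
    · exact Or.inl ((h.tile_subset hk hg (not_disjoint_iff_nonempty_inter.1 hd)).2 hwk)

theorem isUniformization_proj : IsUniformization OX M 2 proj := by
  refine ⟨continuous_proj, surjective_proj, fun x => ?_⟩
  obtain ⟨z, rfl⟩ := surjective_proj x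
  obtain ⟨B, hB, -⟩ := exists_isSlice z univ_mem
  refine ⟨_, B, _, hB.isOrbifoldChart, by simp, fun y hy => ?_⟩
  rw [preimage_image_eq_iUnion_tile] at hy ⊢
  obtain ⟨g, hg, hyg⟩ := mem_iUnion₂.1 hy
  have hcomp : (affineHomeo (g * translation z)) '' B = tile z B g := rfl
  refine ⟨(affineHomeo (g * translation z)).toOpenPartialHomeomorphOfImageEq B
    hB.isOpen (tile z B g) hcomp, rfl, ?_, ?_, ?_, fun b hb => proj_apply hg _⟩
  · refine Subset.antisymm ?_ ?_
    · refine IsPreconnected.subset_connectedComponentIn ?_ hyg ?_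
      · change IsPreconnected (tile z B g)
        rw [← hcomp]
        exact hB.convex.isPreconnected.image _ (Homeomorph.continuous _).continuousOn
      · exact fun w hw => mem_biUnion hg hw
    · refine hB.subset_tile isPreconnected_connectedComponentIn (fun w hw => ?_) hg
        ⟨y, mem_connectedComponentIn hy, hyg⟩
      obtain ⟨k, hk, hwk⟩ := mem_iUnion₂.1 (connectedComponentIn_subset _ _ hw)
      exact ⟨k, hk, hwk⟩
  · exact (differentiable_affine (g * translation z)).differentiableOn
  · exact (differentiable_affine (g * translation z)⁻¹).differentiableOn

/-! ### The locus of trivial stabilizers -/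

/-- The fixed point set of a nontrivial element of `G` is empty, a point or a complex line. -/
theorem exists_setOf_fixed_eq_range {g : C2 ≃ᵃ[ℂ] C2} {z : C2} (hg1 : g ≠ 1) (hz : g z = z) :
    ∃ v : C2, {w | g w = w} = range fun t : ℂ => z + t • v := by
  by_cases h : ∃ z', z ≠ z' ∧ g z' = z'
  · obtain ⟨z', hne, hz'⟩ := h
    have hv0 : z' - z ≠ 0 := sub_ne_zero.2 hne.symm
    have hv : g.linear (z' - z) = z' - z := by
      rwa [← apply_eq_iff_linear hz, add_sub_cancel]
    have hk := finrank_ker_sub_id (f := (g.linear : C2 →ₗ[ℂ] C2)) (v := z' - z) (fun h => hg1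
      (eq_one_of_linear_eq_one hz fun b => LinearMap.congr_fun h b)) hv0 hv
    refine ⟨z' - z, Subset.antisymm (fun w hw => ?_) ?_⟩
    · have hw' : g.linear (w - z) = w - z := by
        rwa [← apply_eq_iff_linear hz, add_sub_cancel]
      have hmem : ∀ {b : C2}, g.linear b = b →
          b ∈ LinearMap.ker ((g.linear : C2 →ₗ[ℂ] C2) - LinearMap.id) := fun {b} hb => by
        rw [LinearMap.mem_ker, LinearMap.sub_apply, sub_eq_zero]; exact hb
      obtain ⟨t, ht⟩ := (finrank_eq_one_iff_of_nonzero' (⟨_, hmem hv⟩ : LinearMap.ker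
        ((g.linear : C2 →ₗ[ℂ] C2) - LinearMap.id)) (fun h => hv0 (congrArg Subtype.val h))).1 hk
        ⟨_, hmem hw'⟩
      refine ⟨t, ?_⟩
      have := congrArg Subtype.val ht
      change t • (z' - z) = w - z at this
      beta_reduce
      rw [this, add_sub_cancel]
    · rintro _ ⟨t, rfl⟩
      change g (z + t • (z' - z)) = _
      rw [apply_eq_iff_linear hz, map_smul, hv]
  · push Not at h
    refine ⟨0, Subset.antisymm (fun w hw => ⟨0, ?_⟩) ?_⟩
    · by_contra hne
      exact h w (fun h' => hne (by simp [h'])) hw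
    · rintro _ ⟨t, rfl⟩
      simpa using hz

/-- The points of a convex open set with trivial stabilizer are path connected: the complement is
a countable union of complex lines and points. -/
theorem isPathConnected_inter_freePoints {U : Set C2} (hU : IsOpen U) (hconv : Convex ℝ U)
    (hne : U.Nonempty) : IsPathConnected (U ∩ freePoints) := by
  have hex : ∀ i : {g : G // (g : C2 ≃ᵃ[ℂ] C2) ≠ 1 ∧ ∃ z : C2, (g : C2 ≃ᵃ[ℂ] C2) z = z},
      ∃ z v : C2, {w | ((i : G) : C2 ≃ᵃ[ℂ] C2) w = w} = range fun t : ℂ => z + t • v :=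
    fun ⟨g, h1, z, hz⟩ => ⟨z, exists_setOf_fixed_eq_range h1 hz⟩
  choose z v hzv using hex
  have hfree : freePoints = (⋃ i, range fun t : ℂ => z i + t • v i)ᶜ := by
    ext w
    rw [mem_compl_iff, mem_iUnion, not_exists]
    constructor
    · intro h i hi
      rw [← hzv i] at hi
      exact i.2.1 (h i i.1.2 hi)
    · intro h g hg hgw
      by_contra h1
      refine h ⟨⟨g, hg⟩, h1, w, hgw⟩ ?_
      rw [← hzv]
      exact hgw
  rw [hfree]
  exact isPathConnected_inter_compl_iUnion_range (f := fun i (t : ℂ) => z i + t • v i)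
    (fun i => contDiff_const.add (contDiff_id.smul contDiff_const))
    (by rw [Complex.finrank_real_complex, finrank_real_of_complex]; simp) hU hconv hne

theorem isPathConnected_freePoints : IsPathConnected freePoints := by
  have := isPathConnected_inter_freePoints isOpen_univ convex_univ univ_nonempty
  rwa [univ_inter] at this

theorem dense_freePoints : Dense freePoints := by
  rw [Metric.dense_iff]
  intro z ε hε
  exact (isPathConnected_inter_freePoints Metric.isOpen_ball (convex_ball z ε)
    ⟨z, Metric.mem_ball_self hε⟩).nonempty

/-- A neighbourhood of a point with trivial stabilizer which is disjoint from its nontrivial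
translates. -/
theorem exists_nhds_free {z : C2} (hz : z ∈ freePoints) :
    ∃ V ∈ 𝓝 z, ∀ g ∈ G, ∀ w ∈ V, g w ∈ V → g = 1 := by
  obtain ⟨V, hV, h⟩ := exists_nhds_fixed z
  exact ⟨V, hV, fun g hg w hw hgw => hz g hg (h g hg w hw hgw)⟩

theorem isOpen_freePoints : IsOpen freePoints := by
  refine isOpen_iff_mem_nhds.2 fun z hz => ?_
  obtain ⟨V, hV, h⟩ := exists_nhds_free hz
  exact mem_of_superset hV fun w hw g hg hgw => h g hg w hw (hgw.symm ▸ hw)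

theorem apply_mem_freePoints {g : C2 ≃ᵃ[ℂ] C2} (hg : g ∈ G) {z : C2} (hz : z ∈ freePoints) :
    g z ∈ freePoints := fun k hk hkz => by
  have : g⁻¹ * k * g = 1 := hz _ (mul_mem (mul_mem (inv_mem hg) hk) hg) (by
    change g⁻¹ (k (g z)) = z
    rw [hkz]
    exact g.symm_apply_apply z)
  simpa [mul_assoc, inv_mul_eq_one, eq_comm] using this

theorem mem_freePoints_of_proj_eq {z w : C2} (hz : z ∈ freePoints) (h : proj z = proj w) :
    w ∈ freePoints := by
  obtain ⟨g, hg, rfl⟩ := proj_eq_iff.1 h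
  exact apply_mem_freePoints hg hz

theorem isOpen_compl_isolatedPoints : IsOpen isolatedPointsᶜ := by
  refine isOpen_iff_mem_nhds.2 fun z hz => ?_
  obtain ⟨V, hV, h⟩ := exists_nhds_fixed z
  refine mem_of_superset hV fun w hw ⟨g, hg, hgw, hu⟩ => hz ?_
  have hgz := h g hg w hw (hgw.symm ▸ hw)
  rw [hu z hgz]
  exact ⟨g, hg, hgw, hu⟩

theorem countable_isolatedPoints : isolatedPoints.Countable := by
  have h : isolatedPoints ⊆ ⋃ g : G, {z | (g : C2 ≃ᵃ[ℂ] C2) z = z ∧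
      ∀ w, (g : C2 ≃ᵃ[ℂ] C2) w = w → w = z} := by
    rintro z ⟨g, hg, hz⟩
    exact mem_iUnion.2 ⟨⟨g, hg⟩, hz⟩
  refine (countable_iUnion fun g => Set.Subsingleton.countable ?_).mono h
  rintro z ⟨hz, -⟩ w ⟨-, hw⟩
  exact hw z hz

theorem freePoints_subset_compl_isolatedPoints : freePoints ⊆ isolatedPointsᶜ := by
  rintro z hz ⟨g, hg, hgz, hu⟩
  obtain ⟨w, hw⟩ := exists_ne z
  exact hw (hu w (by rw [hz g hg hgz]; rfl))

theorem three_lt_finrank : 3 < Module.finrank ℝ C2 := by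
  rw [finrank_real_of_complex]; simp

theorem isSimplyConnected_compl_isolatedPoints : IsSimplyConnected isolatedPointsᶜ := by
  rw [compl_eq_univ_sdiff]
  exact isSimplyConnected_diff_countable three_lt_finrank isOpen_univ convex_univ univ_nonempty
    countable_isolatedPoints (by rw [← compl_eq_univ_sdiff]; exact isOpen_compl_isolatedPoints)

/-- The deck transformations of `proj` are the elements of `G`: on the connected dense set of points
with trivial stabilizer a deck transformation coincides with a single element of `G`. -/
theorem deck_iff (φ : C2 ≃ₜ C2) : (∀ z, proj (φ z) = proj z) ↔ ∃ g ∈ G, ∀ z, φ z = g z := by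
  constructor
  · intro h
    obtain ⟨z₀, hz₀⟩ := isPathConnected_freePoints.nonempty
    obtain ⟨g, hg, hgz⟩ := proj_eq_iff.1 (h z₀).symm
    refine ⟨g, hg, congrFun (Continuous.ext_on dense_freePoints φ.continuous
      (continuous_affine g) ?_)⟩
    have hpre : PreconnectedSpace freePoints :=
      isPreconnected_iff_preconnectedSpace.1 isPathConnected_freePoints.isConnected.isPreconnected
    have hclopen : IsClopen {y : freePoints | φ y = g y} := by
      refine ⟨isClosed_eq (φ.continuous.comp continuous_subtype_val)
        ((continuous_affine g).comp continuous_subtype_val), isOpen_iff_mem_nhds.2 fun y hy => ?_⟩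
      obtain ⟨V, hV, hfree⟩ := exists_nhds_free y.2
      have hcont : Continuous fun w => g⁻¹ (φ w) := (continuous_affine g⁻¹).comp φ.continuous
      have hy' : g⁻¹ (φ y) = y := by rw [show φ y = g y from hy]; exact g.symm_apply_apply _
      have hV' := hcont.continuousAt.preimage_mem_nhds (hy'.symm ▸ hV)
      refine mem_of_superset (continuous_subtype_val.continuousAt.preimage_mem_nhds
        (inter_mem hV hV')) fun w hw => ?_
      obtain ⟨k, hk, hkw⟩ := proj_eq_iff.1
        ((h (w : C2)).symm.trans (proj_apply (inv_mem hg) _).symm)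
      have hk1 : k = 1 := hfree k hk w hw.1 (hkw ▸ hw.2)
      rw [hk1] at hkw
      change φ w = g w
      exact (g.apply_symm_apply (φ w)).symm.trans (congrArg g hkw).symm
    exact fun y hy => (eq_univ_iff_forall.1 (hclopen.eq_univ ⟨⟨z₀, hz₀⟩, hgz.symm⟩)) ⟨y, hy⟩
  · rintro ⟨g, hg, h⟩ z
    rw [h, proj_apply hg]

/-! ### The regular part of the quotient as a quotient by a free action -/

instance : MulAction G freePoints where
  smul g z := ⟨(g : C2 ≃ᵃ[ℂ] C2) z, apply_mem_freePoints g.2 z.2⟩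
  one_smul _ := rfl
  mul_smul _ _ _ := rfl

/-- The restriction of `proj` to the points with trivial stabilizer, as a map to its image. -/
def regProj {S : Set X} (hS : S = proj '' freePoints) (z : freePoints) : S :=
  ⟨proj z, hS ▸ mem_image_of_mem proj z.2⟩

theorem isQuotientCoveringMap_regProj {S : Set X} (hS : S = proj '' freePoints) :
    IsQuotientCoveringMap (regProj hS) G := by
  have hcont : Continuous (regProj hS) :=
    (continuous_proj.comp continuous_subtype_val).subtype_mk _
  have hopen : IsOpenMap (regProj hS) := by
    intro V hV
    have h1 : IsOpen (proj '' ((↑) '' V)) :=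
      isOpenMap_proj _ (isOpen_freePoints.isOpenMap_subtype_val _ hV)
    convert h1.preimage (continuous_subtype_val (p := (· ∈ S)))
    ext x
    constructor
    · rintro ⟨y, hy, rfl⟩
      exact ⟨y, ⟨y, hy, rfl⟩, rfl⟩
    · rintro ⟨_, ⟨y, hy, rfl⟩, hx⟩
      exact ⟨y, hy, Subtype.ext hx⟩
  have hsurj : Function.Surjective (regProj hS) := by
    rintro ⟨x, hx⟩
    obtain ⟨z, hz, rfl⟩ := hS ▸ hx
    exact ⟨⟨z, hz⟩, rfl⟩
  refine { hopen.isQuotientMap hcont hsurj with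
    continuous_const_smul := fun g => ?_
    apply_eq_iff_mem_orbit := fun {a b} => ?_
    disjoint := fun z => ?_ }
  · exact ((continuous_affine g).comp continuous_subtype_val).subtype_mk _
  · rw [← Subtype.coe_inj, eq_comm]
    change proj b = proj a ↔ _
    rw [proj_eq_iff]
    exact ⟨fun ⟨g, hg, h⟩ => ⟨⟨g, hg⟩, Subtype.ext h⟩,
      fun ⟨g, h⟩ => ⟨g, g.2, congrArg Subtype.val h⟩⟩
  · obtain ⟨V, hV, h⟩ := exists_nhds_free z.2
    refine ⟨_, continuous_subtype_val.continuousAt.preimage_mem_nhds hV, fun g => ?_⟩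
    rintro ⟨_, ⟨w, hw, rfl⟩, hgw⟩
    exact Subtype.ext (h g g.2 w hw hgw)

/-! ### The smooth points off the discriminant -/

theorem linStab_eq_bot {z : C2} (hz : z ∈ freePoints) : linStab z = ⊥ := by
  rw [Subgroup.eq_bot_iff_forall]
  intro γ hγ
  obtain ⟨g, hg, hgz, rfl⟩ := mem_linStab.1 hγ
  rw [hz g hg hgz]
  rfl

theorem proj_mem_smoothComplement {z : C2} (hz : z ∈ freePoints) :
    proj z ∈ smoothComplement OX M := by
  obtain ⟨S, hS, -⟩ := exists_isSlice z univ_mem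
  have h := hS.isQuotientChart
  rw [linStab_eq_bot hz] at h
  refine ⟨⟨S, _, h, by simp⟩, fun hM => ?_⟩
  obtain ⟨g, hg, hr, hgz⟩ := proj_mem_M_iff.1 hM
  exact ((isAffineReflection_iff_ne_one hg).1 hr).1 (hz g hg hgz)

theorem IsQuotientChart.injOn {Y : Type} [TopologicalSpace Y] {O : AnalyticStructure Y}
    {B : Set C2} {q : C2 → Y} (h : IsQuotientChart O ⊥ B q) : InjOn q B := by
  intro b hb b' hb' hbb'
  obtain ⟨γ, hγ, rfl⟩ := (h.fiber b hb b' hb').1 hbb'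
  rw [Subgroup.mem_bot.1 hγ]
  rfl

theorem isSimplyConnected_diff_zero {U : Set C2} (hU : IsOpen U) (hconv : Convex ℝ U)
    (hne : U.Nonempty) : IsSimplyConnected (U \ {0}) :=
  isSimplyConnected_diff_countable three_lt_finrank hU hconv hne (countable_singleton 0)
    (hU.sdiff isClosed_singleton)

/-- At a smooth point of `X` off `M` the stabilizers are trivial. The complement of a point in a
chart is simply connected and so lifts to `ℂ²`; its lift is a neighbourhood of the punctured point
which is disjoint from its translates, whereas a nontrivial stabilizer would preserve it. -/
theorem mem_freePoints_of_isSmoothPoint {z : C2} (hs : IsSmoothPoint OX (proj z))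
    (hM : proj z ∉ M) : z ∈ freePoints := by
  obtain ⟨B, q, hq, hq0⟩ := hs
  have honly : ∀ g ∈ G, g z = z → g ≠ 1 → ∀ w, g w = w → w = z := by
    intro g hg hgz hg1 w hw
    by_contra hne
    exact hM (proj_mem_M_iff.2 ⟨g, hg, (isAffineReflection_iff_ne_one hg).2
      ⟨hg1, w, z, hne, hw, hgz⟩, hgz⟩)
  obtain ⟨S, hS, hSV⟩ := exists_isSlice z (((hq.isOpen_image B subset_rfl hq.isOpen).preimage
    continuous_proj).mem_nhds ⟨0, hq.zero_mem, hq0⟩)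
  have hne0 : ∀ {c : C2}, c ∈ S → c ≠ 0 → proj (z + c) ≠ proj z := fun {c} hc hc0 h => by
    obtain ⟨g, hg, hgz⟩ := proj_eq_iff.1 h
    have hfix := hS.fixed g hg c hc 0 hS.zero_mem (by rw [hgz, add_zero])
    exact hc0 (add_eq_left.1 (g.injective (hgz.trans hfix.symm)))
  have hSfree : ∀ {c : C2}, c ∈ S → c ≠ 0 → z + c ∈ freePoints := fun {c} hc hc0 g hg h => by
    by_contra hg1
    exact hc0 (add_eq_left.1 (honly g hg (hS.fixed g hg c hc c hc h) hg1 _ h))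
  have hO : IsOpen (B ∩ q ⁻¹' (proj '' ((fun b => z + b) '' S))) :=
    hq.continuousOn.isOpen_inter_preimage hq.isOpen
      (isOpenMap_proj _ (isOpenMap_add_left z _ hS.isOpen))
  obtain ⟨ε, hε, hball⟩ := Metric.isOpen_iff.1 hO 0
    ⟨hq.zero_mem, ⟨z, ⟨0, hS.zero_mem, add_zero z⟩, hq0.symm⟩⟩
  set P := Metric.ball (0 : C2) ε \ {0} with hP
  have hPS : ∀ b ∈ P, ∃ c ∈ S, c ≠ 0 ∧ proj (z + c) = q b := by
    rintro b ⟨hb, hb0⟩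
    obtain ⟨_, ⟨c, hc, rfl⟩, hcb⟩ := (hball hb).2
    refine ⟨c, hc, ?_, hcb⟩
    rintro rfl
    change proj (z + 0) = q b at hcb
    rw [add_zero, ← hq0] at hcb
    exact hb0 (hq.injOn hq.zero_mem (hball hb).1 hcb).symm
  have hPsc : IsSimplyConnected P := isSimplyConnected_diff_zero Metric.isOpen_ball
    (convex_ball _ _) ⟨0, Metric.mem_ball_self hε⟩
  have hPo : IsOpen P := Metric.isOpen_ball.sdiff isClosed_singleton
  have : SimplyConnectedSpace P := hPsc
  have : LocallyPathConnectedSpace P := hPo.locallyPathConnectedSpace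
  have hqP : ∀ b : P, q b ∈ proj '' freePoints := fun b => by
    obtain ⟨c, hc, hc0, hcb⟩ := hPS b b.2
    exact ⟨_, hSfree hc hc0, hcb⟩
  let f : C(P, proj '' freePoints) :=
    ⟨fun b => ⟨q b, hqP b⟩,
      (hq.continuousOn.comp_continuous continuous_subtype_val
        fun b => (hball b.2.1).1).subtype_mk hqP⟩
  obtain ⟨b₀, hb₀⟩ := hPsc.nonempty
  obtain ⟨c₀, hc₀, hc₀0, hcb₀⟩ := hPS b₀ hb₀
  -- the lift of the punctured ball `P` of the chart
  obtain ⟨F, ⟨hF0, hF⟩, -⟩ := (isQuotientCoveringMap_regProj rfl).isCoveringMap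
    |>.existsUnique_continuousMap_lifts f ⟨b₀, hb₀⟩ ⟨z + c₀, hSfree hc₀ hc₀0⟩ (Subtype.ext hcb₀)
  have hFq : ∀ b : P, proj (F b) = q b := fun b => congrArg Subtype.val (congrFun hF b)
  have hFc : Continuous fun b : P => (F b : C2) := continuous_subtype_val.comp F.continuous
  have hFS : ∀ b : P, ∃ c ∈ S, z + c = F b := fun b => by
    have htile : ∀ w, w ∈ tile z S 1 ↔ ∃ c ∈ S, z + c = w := fun w => Iff.rfl
    refine (htile _).1 (hS.subset_tile (isPreconnected_range hFc) ?_ (one_mem G)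
      ⟨F ⟨b₀, hb₀⟩, mem_range_self _, ?_⟩ (mem_range_self b))
    · rintro _ ⟨b, rfl⟩
      obtain ⟨c, hc, -, hcb⟩ := hPS b b.2
      obtain ⟨g, hg, hgc⟩ := proj_eq_iff.1 (hcb.trans (hFq b).symm)
      exact ⟨g, hg, c, hc, hgc⟩
    · rw [hF0]
      exact ⟨c₀, hc₀, rfl⟩
  have hFinj : ∀ {b b' : P}, proj (F b) = proj (F b') → b = b' := fun {b b'} h => by
    rw [hFq, hFq] at h
    exact Subtype.ext (hq.injOn (hball b.2.1).1 (hball b'.2.1).1 h)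
  set R := range fun b : P => (F b : C2) with hR
  have hRo : IsOpen R := by
    refine isOpen_iff_mem_nhds.2 ?_
    rintro _ ⟨b, rfl⟩
    obtain ⟨V, hV, hfree⟩ := exists_nhds_free (F b).2
    obtain ⟨V', hV'V, hV'o, hbV'⟩ := mem_nhds_iff.1 hV
    obtain ⟨T, hTo, hT⟩ := isOpen_induced_iff.1 (hV'o.preimage hFc)
    have hqT : IsOpen (q '' (P ∩ T)) := hq.isOpen_image _
      (fun b hb => (hball hb.1.1).1) (hPo.inter hTo)
    have hbT : (b : C2) ∈ T := by
      have : b ∈ ((↑) : P → C2) ⁻¹' T := by rw [hT]; exact hbV'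
      exact this
    refine mem_of_superset (inter_mem hV ((hqT.preimage continuous_proj).mem_nhds
      ⟨b, ⟨b.2, hbT⟩, (hFq b).symm⟩)) ?_
    rintro w ⟨hwV, b', ⟨hb'P, hb'T⟩, hb'w⟩
    have hb'V : (F ⟨b', hb'P⟩ : C2) ∈ V := hV'V (by
      have : (⟨b', hb'P⟩ : P) ∈ ((↑) : P → C2) ⁻¹' T := hb'T
      rw [hT] at this
      exact this)
    obtain ⟨k, hk, hkw⟩ := proj_eq_iff.1 ((hFq ⟨b', hb'P⟩).trans hb'w)
    have hk1 : k = 1 := hfree k hk _ hb'V (hkw ▸ hwV)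
    exact ⟨⟨b', hb'P⟩, by rw [hk1] at hkw; exact hkw⟩
  obtain ⟨S', hS', hS'V⟩ := exists_isSlice z
    (((hq.isOpen_image _ (fun b hb => (hball hb).1) Metric.isOpen_ball).preimage
      continuous_proj).mem_nhds ⟨0, Metric.mem_ball_self hε, hq0⟩)
  obtain ⟨S'', hS'', hS''S⟩ := exists_isSlice z (inter_mem
    ((isOpenMap_add_left z _ hS.isOpen).mem_nhds ⟨0, hS.zero_mem, add_zero z⟩)
    ((isOpenMap_add_left z _ hS'.isOpen).mem_nhds ⟨0, hS'.zero_mem, add_zero z⟩))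
  have hmem : ∀ {c : C2}, c ∈ S'' → c ∈ S ∧ c ∈ S' := fun {c} hc => by
    obtain ⟨⟨a, ha, hac⟩, b, hb, hbc⟩ := hS''S c hc
    rw [← add_left_cancel hac]
    exact ⟨ha, by rw [add_left_cancel (hac.trans hbc.symm)]; exact hb⟩
  -- the punctured slice `T` is connected and covered by the disjoint open translates of `R`
  set T := (fun b => z + b) '' (S'' \ {0}) with hT
  have hTc : IsPreconnected T := (isSimplyConnected_diff_zero hS''.isOpen hS''.convex
    ⟨0, hS''.zero_mem⟩).isPathConnected.isConnected.isPreconnected.image _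
      (continuous_const_add z).continuousOn
  have hTR : ∀ w ∈ T, ∃ k ∈ G, k w ∈ R := by
    rintro _ ⟨c, ⟨hc, hc0⟩, rfl⟩
    obtain ⟨b, hb, hbc⟩ := hS'V c (hmem hc).2
    have hb0 : b ∈ P := ⟨hb, fun h => hne0 (hmem hc).1 hc0 (by
      rw [← hbc, mem_singleton_iff.1 h, hq0])⟩
    obtain ⟨k, hk, hkb⟩ := proj_eq_iff.1 (hbc.symm.trans (hFq ⟨b, hb0⟩).symm)
    exact ⟨k, hk, ⟨b, hb0⟩, hkb.symm⟩
  obtain ⟨a₀, ha₀⟩ := (isSimplyConnected_diff_zero hS''.isOpen hS''.convex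
    ⟨0, hS''.zero_mem⟩).nonempty
  have hw₀ : z + a₀ ∈ T := ⟨a₀, ha₀, rfl⟩
  obtain ⟨k₀, hk₀, hk₀R⟩ := hTR _ hw₀
  have hTk : T ⊆ k₀ ⁻¹' R := by
    refine hTc.subset_left_of_subset_union (hRo.preimage (continuous_affine k₀))
      (v := ⋃ k ∈ {k | k ∈ G ∧ Disjoint (k ⁻¹' R) (k₀ ⁻¹' R)}, k ⁻¹' R)
      (isOpen_biUnion fun k _ => hRo.preimage (continuous_affine k)) ?_ (fun w hw => ?_)
      ⟨_, hw₀, hk₀R⟩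
    · rw [disjoint_iUnion₂_right]
      exact fun k hk => hk.2.symm
    · obtain ⟨k, hk, hkR⟩ := hTR w hw
      by_cases hd : Disjoint (k ⁻¹' R) (k₀ ⁻¹' R)
      · exact Or.inr (mem_biUnion (show k ∈ {k | k ∈ G ∧ Disjoint (k ⁻¹' R) (k₀ ⁻¹' R)} from
          ⟨hk, hd⟩) hkR)
      · left
        obtain ⟨u, ⟨b, hb⟩, b', hb'⟩ := not_disjoint_iff.1 hd
        have hb1 : (F b : C2) = k u := hb
        have hb2 : (F b' : C2) = k₀ u := hb'
        have hbb' := hFinj (b := b) (b' := b') (by rw [hb1, hb2, proj_apply hk, proj_apply hk₀])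
        have hu : u ∈ freePoints := mem_freePoints_of_proj_eq (F b).2
          (by rw [hb1, proj_apply hk])
        have hkk := hu (k₀⁻¹ * k) (mul_mem (inv_mem hk₀) hk) (by
          change k₀⁻¹ (k u) = u
          rw [← hb1, hbb', hb2]
          exact k₀.symm_apply_apply u)
        rw [← inv_mul_eq_one.1 hkk] at hkR
        exact hkR
  -- an element fixing `z` moves a point of `T` inside `T`, but `proj` is injective there
  intro g hg hgz
  by_contra hg1
  have hgw : g (z + a₀) = z + g.linear a₀ := by rw [apply_add, hgz]
  have hgT : z + g.linear a₀ ∈ T := by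
    refine ⟨_, ⟨hS''.invariant _ (mem_linStab.2 ⟨g, hg, hgz, rfl⟩) _ ha₀.1, fun h => ha₀.2 ?_⟩, rfl⟩
    exact (LinearEquiv.map_eq_zero_iff g.linear).1 h
  obtain ⟨b, hb⟩ := hTk hw₀
  obtain ⟨b', hb'⟩ := hTk hgT
  have hb1 : (F b : C2) = k₀ (z + a₀) := hb
  have hb2 : (F b' : C2) = k₀ (z + g.linear a₀) := hb'
  have hbb' := hFinj (b := b) (b' := b') (by
    rw [hb1, hb2, proj_apply hk₀, proj_apply hk₀, ← hgw, proj_apply hg])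
  rw [hbb', hb2] at hb1
  exact ha₀.2 (add_eq_left.1 (honly g hg hgz hg1 _ (hgw.trans (k₀.injective hb1))))

theorem smoothComplement_eq : smoothComplement OX M = proj '' freePoints := by
  refine Subset.antisymm (fun x hx => ?_) ?_
  · obtain ⟨z, rfl⟩ := surjective_proj x
    exact ⟨z, mem_freePoints_of_isSmoothPoint hx.1 hx.2, rfl⟩
  · rintro _ ⟨z, hz, rfl⟩
    exact proj_mem_smoothComplement hz

theorem isPathConnected_smoothComplement : IsPathConnected (smoothComplement OX M) := by
  rw [smoothComplement_eq]
  exact isPathConnected_freePoints.image continuous_proj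

/-! ### Meridians have order two in the deck group -/

section Charts

variable {Y : Type} [TopologicalSpace Y] {O : AnalyticStructure Y} {B : Set C2} {q : C2 → Y}

theorem IsQuotientChart.translate (h : IsQuotientChart O ⊥ B q) {b : C2} (hb : b ∈ B) :
    IsQuotientChart O ⊥ ((fun c => b + c) ⁻¹' B) fun c => q (b + c) where
  isOpen := h.isOpen.preimage (continuous_const_add b)
  isConnected := (Homeomorph.addLeft b).isConnected_preimage.2 h.isConnected
  zero_mem := by simpa using hb
  invariant γ hγ c hc := by rw [Subgroup.mem_bot.1 hγ]; exact hc
  continuousOn := h.continuousOn.comp (continuous_const_add b).continuousOn fun _ hc => hc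
  isOpen_image V hV hVo := by
    rw [← image_image q (fun c => b + c)]
    exact h.isOpen_image _ (image_subset_iff.2 hV) (isOpenMap_add_left b _ hVo)
  fiber c hc c' hc' := by
    rw [h.fiber _ hc _ hc']
    constructor
    · rintro ⟨γ, hγ, hγc⟩
      rw [Subgroup.mem_bot.1 hγ] at hγc
      exact ⟨1, one_mem _, add_left_cancel hγc⟩
    · rintro ⟨γ, hγ, rfl⟩
      rw [Subgroup.mem_bot.1 hγ]
      exact ⟨1, one_mem _, rfl⟩
  isHol_iff U hU f := by
    have hU' : (U : Set Y) ⊆ q '' B := hU.trans (by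
      rintro _ ⟨c, hc, rfl⟩
      exact ⟨b + c, hc, rfl⟩)
    rw [h.isHol_iff U hU' f]
    constructor
    · intro hf
      exact DifferentiableOn.comp (g := f ∘ q) (f := fun c : C2 => b + c)
        (t := B ∩ q ⁻¹' (U : Set Y)) hf (differentiable_id.const_add b).differentiableOn
        fun c hc => hc
    · intro hf
      have heq : f ∘ q = (f ∘ fun c => q (b + c)) ∘ fun c => -b + c := by
        funext c
        simp only [Function.comp_apply, add_neg_cancel_left]
      rw [heq]
      refine DifferentiableOn.comp hf (differentiable_id.const_add (-b)).differentiableOn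
        fun c hc => ?_
      change b + (-b + c) ∈ B ∧ q (b + (-b + c)) ∈ U
      rwa [add_neg_cancel_left]

theorem IsQuotientChart.isSmoothPoint (h : IsQuotientChart O ⊥ B q) {b : C2} (hb : b ∈ B) :
    IsSmoothPoint O (q b) :=
  ⟨_, _, h.translate hb, by simp⟩

end Charts

theorem isQuotientCoveringMap_smoothComplement :
    IsQuotientCoveringMap (regProj smoothComplement_eq) G :=
  isQuotientCoveringMap_regProj smoothComplement_eq

theorem exists_thickened_disc {B : Set C2} (hB : IsOpen B)
    (hdisc : ∀ w : ℂ, ‖w‖ ≤ 1 → ![w, 0] ∈ B) :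
    ∃ δ > 0, ∀ w b : ℂ, ‖w‖ ≤ 1 → ‖b‖ < δ → ![w, b] ∈ B := by
  have hc : Continuous fun w : ℂ => (![w, 0] : C2) := by fun_prop
  obtain ⟨δ, hδ, h⟩ := ((isCompact_closedBall (0 : ℂ) 1).image hc).exists_thickening_subset_open hB
    (by rintro _ ⟨w, hw, rfl⟩; exact hdisc w (by simpa using hw))
  refine ⟨δ, hδ, fun w b hw hb => h (Metric.mem_thickening_iff.2
    ⟨![w, 0], ⟨w, by simpa using hw, rfl⟩, ?_⟩)⟩
  rw [dist_pi_lt_iff hδ]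
  intro i
  fin_cases i
  · simpa using hδ
  · simpa using hb

/-- The lift of a meridian circle ends at an involutive translate of its starting point: push the
circle to a generic point of the branch curve, where the stabilizer has order two. -/
theorem mul_self_eq_one_of_meridian {B : Set C2} {q : C2 → X} (hq : IsQuotientChart OX ⊥ B q)
    (hD : ∀ b ∈ B, q b ∈ M ↔ b 0 = 0) (hdisc : ∀ w : ℂ, ‖w‖ ≤ 1 → ![w, 0] ∈ B)
    (γ : C(I, freePoints))
    (hγ : ∀ t : I, proj (γ t) = q ![Complex.exp (2 * Real.pi * Complex.I * (t : ℝ)), 0])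
    {k : G} (hk : γ 1 = k • γ 0) : k * k = 1 := by
  obtain ⟨δ, hδ, hB⟩ := exists_thickened_disc hq.isOpen hdisc
  obtain ⟨b₁, hb₁, hgen⟩ : ∃ b₁ : ℂ, ‖b₁‖ < δ ∧ q ![0, b₁] ∉ proj '' isolatedPoints := by
    have hcount : {b : ℂ | ‖b‖ < δ ∧ q ![0, b] ∈ proj '' isolatedPoints}.Countable := by
      refine MapsTo.countable_of_injOn (f := fun b => q ![0, b])
        (t := proj '' isolatedPoints) (fun b hb => hb.2) (fun b hb b' hb' h => ?_)
        (countable_isolatedPoints.image _)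
      have := hq.injOn (hB 0 b (by simp) hb.1) (hB 0 b' (by simp) hb'.1) h
      simpa using congrFun this 1
    obtain ⟨b, hb, hbδ⟩ := (hcount.dense_compl ℝ).exists_mem_open
      (Metric.isOpen_ball (x := (0 : ℂ)) (ε := δ)) ⟨0, Metric.mem_ball_self hδ⟩
    rw [mem_ball_zero_iff] at hbδ
    exact ⟨b, hbδ, fun h => hb ⟨hbδ, h⟩⟩
  -- a homotopy of circles in the chart, from the given one towards the branch point `(0, b₁)`
  let c : ℝ × ℝ → C2 := fun p => ![Complex.exp (-(p.1 : ℂ) ^ 2 + 2 * Real.pi * Complex.I * p.2),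
    b₁ * ((p.1 ^ 2 / (1 + p.1 ^ 2) : ℝ) : ℂ)]
  have hc0 : ∀ p, ‖c p 0‖ = Real.exp (-p.1 ^ 2) := fun p => by
    simp only [c, Matrix.cons_val_zero, Complex.norm_exp]
    congr 1
    have h1 : ((p.1 : ℂ) ^ 2).re = p.1 ^ 2 := by rw [← Complex.ofReal_pow, Complex.ofReal_re]
    simp [h1]
  have hcB : ∀ p, c p ∈ B := fun p => by
    refine hB _ _ ?_ ?_
    · have := hc0 p
      rw [show c p 0 = Complex.exp (-(p.1 : ℂ) ^ 2 + 2 * Real.pi * Complex.I * p.2) from rfl]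
        at this
      rw [this, Real.exp_le_one_iff]
      nlinarith [sq_nonneg p.1]
    · rw [norm_mul, Complex.norm_real, Real.norm_of_nonneg (by positivity)]
      refine lt_of_le_of_lt (mul_le_of_le_one_right (norm_nonneg _) ?_) hb₁
      rw [div_le_one (by positivity)]
      linarith
  have hcc : Continuous c := by
    refine continuous_pi fun i => ?_
    fin_cases i
    · simp only [c, Fin.zero_eta, Matrix.cons_val_zero]; fun_prop
    · simp only [c, Fin.mk_one, Matrix.cons_val_one]
      have : ∀ p : ℝ × ℝ, 1 + p.1 ^ 2 ≠ 0 := fun p => by positivity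
      fun_prop (disch := assumption)
  have hqc : ∀ p, q (c p) ∈ smoothComplement OX M := fun p =>
    ⟨hq.isSmoothPoint (hcB p), fun hM => by
      have := hc0 p
      rw [(hD _ (hcB p)).1 hM, norm_zero] at this
      exact (Real.exp_pos _).ne this⟩
  let f : C(ℝ × ℝ, smoothComplement OX M) := ⟨fun p => ⟨q (c p), hqc p⟩,
    (hq.continuousOn.comp_continuous hcc hcB).subtype_mk hqc⟩
  have cov := isQuotientCoveringMap_smoothComplement.isCoveringMap
  have hc00 : ∀ t : ℝ, c (0, t) = ![Complex.exp (2 * Real.pi * Complex.I * t), 0] := fun t => by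
    simp [c]
  obtain ⟨F, ⟨hF0, hF⟩, -⟩ := cov.existsUnique_continuousMap_lifts f (0, 0) (γ 0) (Subtype.ext (by
    change proj (γ 0) = q (c (0, 0))
    rw [hγ, hc00]
    simp))
  have hFq : ∀ p, proj (F p) = q (c p) := fun p => congrArg Subtype.val (congrFun hF p)
  have hFγ : ∀ t : I, F (0, t) = γ t := by
    have := cov.eq_of_comp_eq (g₁ := fun t : I => F (0, t)) (g₂ := γ) (by fun_prop) (by fun_prop)
      (funext fun t => Subtype.ext (by
        change proj (F (0, (t : ℝ))) = proj (γ t)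
        rw [hFq, hγ, hc00])) 0 hF0
    exact congrFun this
  -- the relation between the end points of the lifted circles persists along the homotopy
  have hFk : ∀ p : ℝ × ℝ, F (p.1, p.2 + 1) = k • F p := by
    have := cov.eq_of_comp_eq (g₁ := fun p : ℝ × ℝ => F (p.1, p.2 + 1)) (g₂ := fun p => k • F p)
      (by fun_prop) (isQuotientCoveringMap_smoothComplement.continuous_const_smul k |>.comp
        F.continuous) (funext fun p => Subtype.ext (by
        change proj (F (p.1, p.2 + 1)) = proj ((k : C2 ≃ᵃ[ℂ] C2) (F p))
        rw [proj_apply k.2, hFq, hFq]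
        congr 1
        simp only [c]
        congr 1
        rw [Complex.exp_eq_exp_iff_exists_int]
        exact ⟨1, by push_cast; ring⟩)) (0, 0) (by
        have h1 : F (0, (1 : ℝ)) = γ 1 := hFγ 1
        have h0 : F (0, (0 : ℝ)) = γ 0 := hFγ 0
        rw [h0, zero_add, h1, hk])
    exact congrFun this
  obtain ⟨z, hz⟩ := surjective_proj (q ![0, b₁])
  have hziso : z ∉ isolatedPoints := fun h => hgen (hz ▸ mem_image_of_mem proj h)
  obtain ⟨S, hS, -⟩ := exists_isSlice z univ_mem
  have hO : IsOpen (B ∩ q ⁻¹' (proj '' ((fun b => z + b) '' S))) :=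
    hq.continuousOn.isOpen_inter_preimage hq.isOpen
      (isOpenMap_proj _ (isOpenMap_add_left z _ hS.isOpen))
  obtain ⟨ε, hε, hball⟩ := Metric.isOpen_iff.1 hO ![0, b₁]
    ⟨hB 0 b₁ (by simp) hb₁, ⟨z, ⟨0, hS.zero_mem, add_zero z⟩, hz⟩⟩
  obtain ⟨x, hx1, hx2⟩ : ∃ x : ℝ, Real.exp (-x ^ 2) < ε ∧ ‖b₁‖ / (1 + x ^ 2) < ε := by
    have h2 : Tendsto (fun x : ℝ => x ^ 2) atTop atTop := tendsto_pow_atTop two_ne_zero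
    have h3 : Tendsto (fun x : ℝ => Real.exp (-x ^ 2)) atTop (𝓝 0) :=
      Real.tendsto_exp_neg_atTop_nhds_zero.comp h2
    have h4 : Tendsto (fun x : ℝ => ‖b₁‖ / (1 + x ^ 2)) atTop (𝓝 0) :=
      (tendsto_atTop_add_const_left _ 1 h2).const_div_atTop _
    exact ((h3.eventually_lt_const hε).and (h4.eventually_lt_const hε)).exists
  have hcS : ∀ t, c (x, t) ∈ Metric.ball ![0, b₁] ε := fun t => by
    rw [Metric.mem_ball, dist_pi_lt_iff hε]
    intro i
    fin_cases i
    · change dist (c (x, t) 0) 0 < ε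
      rw [dist_zero_right, hc0]
      exact hx1
    · change dist (b₁ * ((x ^ 2 / (1 + x ^ 2) : ℝ) : ℂ)) b₁ < ε
      have hpos : (0 : ℝ) < 1 + x ^ 2 := by positivity
      have : b₁ * ((x ^ 2 / (1 + x ^ 2) : ℝ) : ℂ) - b₁ = -(b₁ * ((1 / (1 + x ^ 2) : ℝ) : ℂ)) := by
        rw [show x ^ 2 / (1 + x ^ 2) = 1 - 1 / (1 + x ^ 2) by field_simp; ring]
        push_cast
        ring
      rw [dist_eq_norm, this, norm_neg, norm_mul, Complex.norm_real,
        Real.norm_of_nonneg (by positivity), mul_one_div]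
      exact hx2
  -- the lifted circle lies in a single translate of the slice at `z`
  have htile : ∀ w ∈ range fun t : ℝ => (F (x, t) : C2), ∃ g ∈ G, w ∈ tile z S g := by
    rintro _ ⟨t, rfl⟩
    obtain ⟨_, ⟨a, ha, rfl⟩, hac⟩ := (hball (hcS t)).2
    obtain ⟨g, hg, hga⟩ := proj_eq_iff.1 (hac.trans (hFq (x, t)).symm)
    exact ⟨g, hg, a, ha, hga⟩
  obtain ⟨g, hg, hg0⟩ := htile _ (mem_range_self 0)
  have hFx : Continuous fun t : ℝ => (F (x, t) : C2) := by fun_prop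
  have hsub := hS.subset_tile (isPreconnected_range hFx) htile hg ⟨_, mem_range_self 0, hg0⟩
  obtain ⟨a, ha, haF⟩ := hg0
  obtain ⟨a', ha', haF'⟩ := hsub (mem_range_self 1)
  have hm : g⁻¹ * k * g ∈ G := mul_mem (mul_mem (inv_mem hg) k.2) hg
  have hmz : (g⁻¹ * k * g) z = z := by
    refine hS.fixed _ hm a ha a' ha' ?_
    change g⁻¹ ((k : C2 ≃ᵃ[ℂ] C2) (g (z + a))) = z + a'
    have h1 := hFk (x, 0)
    simp only [zero_add] at h1
    have h2 : (F (x, 1) : C2) = (k : C2 ≃ᵃ[ℂ] C2) (F (x, 0)) := congrArg Subtype.val h1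
    have h3 : g (z + a) = (F (x, 0) : C2) := haF
    have h4 : g (z + a') = (F (x, 1) : C2) := haF'
    rw [h3, ← h2, ← h4]
    exact g.symm_apply_apply _
  obtain ⟨w, hw, hne⟩ : ∃ w, (g⁻¹ * k * g) w = w ∧ z ≠ w := by
    by_contra hcon
    push Not at hcon
    exact hziso ⟨_, hm, hmz, fun w hw => (hcon w hw).symm⟩
  have h2 := mul_self_eq_one_of_fixed hm hne hmz hw
  refine Subtype.ext ?_
  change (k : C2 ≃ᵃ[ℂ] C2) * k = 1
  have h3 : g⁻¹ * ((k : C2 ≃ᵃ[ℂ] C2) * k) * g = 1 := by rw [← h2]; group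
  rw [show (k : C2 ≃ᵃ[ℂ] C2) * k = g * (g⁻¹ * ((k : C2 ≃ᵃ[ℂ] C2) * k) * g) * g⁻¹ by group, h3]
  group

/-- The homomorphism from the fundamental group of the regular part of `X` to the opposite of the
deck group: a loop lifts to a path from `e` to the translate of `e` by its image. -/
def deckHom {x₀ : smoothComplement OX M} (e : regProj smoothComplement_eq ⁻¹' {x₀}) :
    FundamentalGroup (smoothComplement OX M) x₀ →* Gᵐᵒᵖ :=
  isQuotientCoveringMap_smoothComplement.fundamentalGroupToMulOpposite e

theorem deckHom_meridian_sq {x₀ : smoothComplement OX M}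
    (e : regProj smoothComplement_eq ⁻¹' {x₀}) {c} (hc : c ∈ meridians OX M x₀) :
    deckHom e (c ^ 2) = 1 := by
  obtain ⟨B, q, hq, hD, hdisc, y, l, a, hl, rfl⟩ := hc
  have hp := isQuotientCoveringMap_smoothComplement
  have cov := hp.isCoveringMap
  set e' := cov.monodromy (Path.Homotopic.Quotient.mk a) e with he'
  obtain ⟨k, hk⟩ := hp.exists_toPermFiber_eq e'
    (cov.monodromy (Path.Homotopic.Quotient.mk l) e')
  have hkk : k * k = 1 := by
    have hl0 : l 0 = regProj smoothComplement_eq e' := l.source.trans e'.2.symm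
    refine mul_self_eq_one_of_meridian hq hD hdisc (cov.liftPath l e' hl0) (fun t => ?_) ?_
    · rw [← hl t]
      exact congrArg Subtype.val (congrFun (cov.liftPath_lifts l e' hl0) t)
    · rw [cov.liftPath_zero]
      exact (congrArg Subtype.val hk).symm
  have hΦ : deckHom e (FundamentalGroup.fromPath
      (Path.Homotopic.Quotient.mk ((a.trans l).trans a.symm))) = MulOpposite.op k := by
    rw [deckHom, hp.fundamentalGroupToMulOpposite_apply_eq_Iff]
    have : cov.monodromy (Path.Homotopic.Quotient.mk ((a.trans l).trans a.symm)) e =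
        hp.toPermFiber x₀ k e := by
      rw [Path.Homotopic.Quotient.mk_trans, Path.Homotopic.Quotient.mk_trans,
        cov.monodromy_trans_apply, cov.monodromy_trans_apply, ← he', ← hk,
        hp.monodromy_toPermFiber, he', ← cov.monodromy_trans_apply,
        ← Path.Homotopic.Quotient.mk_trans]
      congr 1
      rw [show Path.Homotopic.Quotient.mk (a.trans a.symm) =
        Path.Homotopic.Quotient.mk (Path.refl x₀) from
          Path.Homotopic.Quotient.eq.2 ⟨(Path.Homotopy.reflTransSymm a).symm⟩]
      exact congrFun cov.monodromy_refl e
    exact (congrArg Subtype.val this).symm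
  rw [map_pow, hΦ, pow_two, ← MulOpposite.op_mul, hkk, MulOpposite.op_one]

/-! ### Removable singularities along a line -/

/-- At a zero of the first coordinate, continuity of the cofactor suffices. -/
theorem differentiableAt_fst_mul {K : ℂ × ℂ → ℂ} {w₀ : ℂ} (hK : ContinuousAt K (0, w₀)) :
    DifferentiableAt ℂ (fun p : ℂ × ℂ => p.1 * K p) (0, w₀) := by
  have h : HasFDerivAt (fun p : ℂ × ℂ => p.1 * K p)
      (K (0, w₀) • ContinuousLinearMap.fst ℂ ℂ ℂ) (0, w₀) := by
    refine HasFDerivAt.of_isLittleO ?_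
    have h1 : (fun p : ℂ × ℂ => p.1) =O[𝓝 (0, w₀)] fun p => p - (0, w₀) :=
      Asymptotics.isBigO_of_le _ fun p => by
        have := norm_fst_le (p - (0, w₀))
        simpa using this
    have h2 : (fun p => K p - K (0, w₀)) =o[𝓝 (0, w₀)] fun _ => (1 : ℝ) := by
      rw [Asymptotics.isLittleO_one_iff]
      exact tendsto_sub_nhds_zero_iff.2 hK.tendsto
    refine Asymptotics.IsLittleO.of_norm_right ((h1.norm_right.mul_isLittleO h2).congr
      (fun p => ?_) fun p => mul_one _)
    simp only [zero_mul, sub_zero, smul_apply, map_sub,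
      ContinuousLinearMap.coe_fst', smul_eq_mul]
    ring
  exact h.differentiableAt

/-- A continuous function of two complex variables which is holomorphic in the first variable off
the line `{0} × ℂ`, and whose restriction to that line is holomorphic, is differentiable at the
points of the line: by the maximum principle the difference quotients converge uniformly. -/
theorem differentiableAt_of_removable {F : ℂ → ℂ → ℂ} {w₀ : ℂ} {R : ℝ} (hR : 0 < R)
    (hc : ContinuousOn (fun p : ℂ × ℂ => F p.1 p.2)
      (Metric.closedBall 0 R ×ˢ Metric.closedBall w₀ R))
    (hd : ∀ w ∈ Metric.closedBall w₀ R, ∀ b ∈ Metric.ball (0 : ℂ) R, b ≠ 0 →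
      DifferentiableAt ℂ (fun b => F b w) b)
    (h0 : DifferentiableAt ℂ (F 0) w₀) :
    DifferentiableAt ℂ (fun p : ℂ × ℂ => F p.1 p.2) (0, w₀) := by
  have hnhds : Metric.closedBall (0 : ℂ) R ∈ 𝓝 0 := Metric.closedBall_mem_nhds _ hR
  have hcw : ∀ w ∈ Metric.closedBall w₀ R, ContinuousOn (fun b => F b w) (Metric.closedBall 0 R) :=
    fun w hw => hc.comp (f := fun b => (b, w)) (by fun_prop) fun b hb => ⟨hb, hw⟩
  have hdw : ∀ w ∈ Metric.closedBall w₀ R, DifferentiableOn ℂ (fun b => F b w) (Metric.ball 0 R) :=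
    fun w hw => (Complex.differentiableOn_compl_singleton_and_continuousAt_iff
      (Metric.ball_mem_nhds _ hR)).1 ⟨fun b hb => (hd w hw b hb.1 hb.2).differentiableWithinAt,
        (hcw w hw).continuousAt hnhds⟩
  -- the difference quotient, which is holomorphic in the first variable also at `0`
  let K : ℂ × ℂ → ℂ := fun p => dslope (fun b => F b p.2) 0 p.1
  have hKd : ∀ w ∈ Metric.closedBall w₀ R, DiffContOnCl ℂ (fun b => K (b, w)) (Metric.ball 0 R) :=
    fun w hw => ⟨(Complex.differentiableOn_dslope (Metric.ball_mem_nhds _ hR)).2 (hdw w hw), by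
      rw [closure_ball _ hR.ne']
      exact (continuousOn_dslope hnhds).2 ⟨hcw w hw,
        (hdw w hw).differentiableAt (Metric.ball_mem_nhds _ hR)⟩⟩
  have hKc : ContinuousOn K (Metric.sphere 0 R ×ˢ Metric.closedBall w₀ R) := by
    have hne : ∀ p ∈ Metric.sphere (0 : ℂ) R ×ˢ Metric.closedBall w₀ R, p.1 ≠ 0 := fun p hp h => by
      have := hp.1
      rw [h, mem_sphere_zero_iff_norm, norm_zero] at this
      exact hR.ne this
    have h1 : ContinuousOn (fun p : ℂ × ℂ => p.1⁻¹ * (F p.1 p.2 - F 0 p.2))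
        (Metric.sphere 0 R ×ˢ Metric.closedBall w₀ R) := by
      refine (continuousOn_fst.inv₀ hne).mul ((hc.mono (prod_mono_left
        Metric.sphere_subset_closedBall)).sub ?_)
      exact hc.comp (f := fun p : ℂ × ℂ => ((0 : ℂ), p.2)) (by fun_prop)
        fun p hp => ⟨Metric.mem_closedBall_self hR.le, hp.2⟩
    refine h1.congr fun p hp => ?_
    simp only [K, dslope_of_ne _ (hne p hp), slope_def_field, sub_zero]
    rw [div_eq_inv_mul]
  have hunif : ∀ ε > 0, ∃ δ > 0, ∀ w, dist w w₀ < δ → ∀ b ∈ Metric.closedBall (0 : ℂ) R,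
      ‖K (b, w) - K (b, w₀)‖ ≤ ε := by
    intro ε hε
    obtain ⟨δ, hδ, h⟩ := Metric.uniformContinuousOn_iff.1 (((isCompact_sphere _ _).prod
      (isCompact_closedBall _ _)).uniformContinuousOn_of_continuous hKc) ε hε
    refine ⟨min δ R, lt_min hδ hR, fun w hw b hb => ?_⟩
    have hwR : w ∈ Metric.closedBall w₀ R := (hw.trans_le (min_le_right _ _)).le
    have hw₀R : w₀ ∈ Metric.closedBall w₀ R := Metric.mem_closedBall_self hR.le
    refine Complex.norm_le_of_forall_mem_frontier_norm_le (f := fun b => K (b, w) - K (b, w₀))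
      Metric.isBounded_ball ((hKd w hwR).sub (hKd w₀ hw₀R)) (fun c hc => ?_)
      (closure_ball (0 : ℂ) hR.ne' ▸ hb)
    rw [frontier_ball _ hR.ne'] at hc
    rw [← dist_eq_norm]
    refine (h (c, w) ⟨hc, hwR⟩ (c, w₀) ⟨hc, hw₀R⟩ ?_).le
    rw [Prod.dist_eq, dist_self, max_eq_right dist_nonneg]
    exact hw.trans_le (min_le_left _ _)
  have hK : ContinuousAt K (0, w₀) := by
    rw [Metric.continuousAt_iff]
    intro ε hε
    obtain ⟨δ, hδ, h⟩ := hunif (ε / 2) (half_pos hε)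
    have hc0 : ContinuousAt (fun b => K (b, w₀)) 0 :=
      ((hKd w₀ (Metric.mem_closedBall_self hR.le)).differentiableAt Metric.isOpen_ball
        (Metric.mem_ball_self hR)).continuousAt
    obtain ⟨δ', hδ', h'⟩ := Metric.continuousAt_iff.1 hc0 (ε / 2) (half_pos hε)
    refine ⟨min δ (min δ' R), by positivity, fun {p} hp => ?_⟩
    rw [Prod.dist_eq, max_lt_iff, lt_min_iff, lt_min_iff, lt_min_iff] at hp
    have h1 := h p.2 hp.2.1 p.1 (Metric.mem_closedBall.2 hp.1.2.2.le)
    have h2 := h' hp.1.2.1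
    rw [← dist_eq_norm] at h1
    calc dist (K p) (K (0, w₀)) ≤ dist (K p) (K (p.1, w₀)) + dist (K (p.1, w₀)) (K (0, w₀)) :=
          dist_triangle _ _ _
      _ < ε := by linarith
  have heq : (fun p : ℂ × ℂ => F p.1 p.2) = fun p => p.1 * K p + F 0 p.2 := by
    funext p
    have := sub_smul_dslope (fun b => F b p.2) 0 p.1
    rw [sub_zero, smul_eq_mul] at this
    rw [this]
    ring
  rw [heq]
  have h0' : DifferentiableAt ℂ (fun p : ℂ × ℂ => F 0 p.2) (0, w₀) :=
    DifferentiableAt.comp (g := F 0) (f := Prod.snd) ((0 : ℂ), w₀) h0 differentiableAt_snd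
  exact (differentiableAt_fst_mul hK).add h0'

/-! ### The squaring map -/

/-- The quotient map of `ℂ²` by the reflection `u ↦ (-u₀, u₁)`. -/
def sqFst (u : C2) : C2 := ![u 0 ^ 2, u 1]

theorem differentiable_sqFst : Differentiable ℂ sqFst := by
  refine differentiable_pi.2 fun i => ?_
  fin_cases i
  · change Differentiable ℂ fun u : C2 => u 0 ^ 2
    fun_prop
  · change Differentiable ℂ fun u : C2 => u 1
    fun_prop

theorem isOpenMap_sqFst : IsOpenMap sqFst := by
  let e : C2 ≃ₜ ℂ × ℂ := Homeomorph.finTwoArrow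
  have h : sqFst = e.symm ∘ Prod.map (fun x : ℂ => x ^ 2) id ∘ e := by
    funext u
    rfl
  rw [h]
  exact e.symm.isOpenMap.comp
    (((Complex.isOpenQuotientMap_pow 2).isOpenMap.prodMap IsOpenMap.id).comp e.isOpenMap)

/-- A section of the squaring map; it is not continuous. -/
def sqrtFst (b : C2) : C2 := ![b 0 ^ ((2 : ℕ) : ℂ)⁻¹, b 1]

theorem sqFst_sqrtFst (b : C2) : sqFst (sqrtFst b) = b := by
  have := Complex.cpow_nat_inv_pow (b 0) two_ne_zero
  ext i
  fin_cases i
  · exact this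
  · rfl

theorem sqFst_eq_iff {u u' : C2} : sqFst u = sqFst u' ↔ u = u' ∨ u = ![-u' 0, u' 1] := by
  constructor
  · intro h
    have h0 : u 0 ^ 2 = u' 0 ^ 2 := congrFun h 0
    have h1 : u 1 = u' 1 := congrFun h 1
    rcases sq_eq_sq_iff_eq_or_eq_neg.1 h0 with h0 | h0
    · left; ext i; fin_cases i <;> assumption
    · right; ext i; fin_cases i <;> assumption
  · rintro (rfl | rfl)
    · rfl
    · simp [sqFst]

theorem sqFst_mem_iff {u : C2} :
    (‖sqFst u 0‖ < 4 ∧ ‖sqFst u 1‖ < 2) ↔ u ∈ Metric.ball (0 : C2) 2 := by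
  rw [mem_ball_zero_iff, pi_norm_lt_iff two_pos, Fin.forall_fin_two]
  refine and_congr ?_ Iff.rfl
  change ‖u 0 ^ 2‖ < 4 ↔ _
  rw [norm_pow, show (4 : ℝ) = 2 ^ 2 by norm_num]
  exact pow_lt_pow_iff_left₀ (norm_nonneg _) zero_le_two two_ne_zero

/-- A function whose pullback under the squaring map is holomorphic is holomorphic: off the branch
line the squaring map has local inverses, and the singularity along the line is removable. -/
theorem differentiableAt_of_comp_sqFst {F : C2 → ℂ} {O : Set C2} (hO : IsOpen O)
    (hF : DifferentiableOn ℂ (F ∘ sqFst) (sqFst ⁻¹' O)) {b : C2} (hb : b ∈ O) :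
    DifferentiableAt ℂ F b := by
  have hO' : IsOpen (sqFst ⁻¹' O) := hO.preimage differentiable_sqFst.continuous
  have hat : ∀ {u}, sqFst u ∈ O → DifferentiableAt ℂ (F ∘ sqFst) u := fun hu =>
    hF.differentiableAt (hO'.mem_nhds hu)
  have hne : ∀ {b : C2}, b ∈ O → b 0 ≠ 0 → DifferentiableAt ℂ F b := by
    intro b hb hb0
    set u := sqrtFst b 0 with hu
    have hu2 : u ^ 2 = b 0 := congrFun (sqFst_sqrtFst b) 0
    have hu0 : u ≠ 0 := fun h => hb0 (by rw [← hu2, h]; norm_num)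
    -- the branch of the inverse near `b` which takes the value `u` in the first coordinate at `b`
    let root : C2 → C2 := fun c => ![u * (c 0 / b 0) ^ ((2 : ℕ) : ℂ)⁻¹, c 1]
    have hroot : ∀ c, sqFst (root c) = c := fun c => by
      have := Complex.cpow_nat_inv_pow (c 0 / b 0) two_ne_zero
      ext i
      fin_cases i
      · change (u * (c 0 / b 0) ^ ((2 : ℕ) : ℂ)⁻¹) ^ 2 = c 0
        rw [mul_pow, this, hu2]
        field_simp
      · rfl
    have hroot_diff : DifferentiableAt ℂ root b := by
      refine differentiableAt_pi.2 fun i => ?_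
      fin_cases i
      · change DifferentiableAt ℂ (fun c : C2 => u * (c 0 / b 0) ^ ((2 : ℕ) : ℂ)⁻¹) b
        refine DifferentiableAt.const_mul (DifferentiableAt.cpow (by fun_prop)
          (differentiableAt_const _) ?_) u
        rw [div_self hb0]
        exact Complex.one_mem_slitPlane
      · change DifferentiableAt ℂ (fun c : C2 => c 1) b
        fun_prop
    have heq : F = (F ∘ sqFst) ∘ root := by
      funext c
      simp only [Function.comp_apply, hroot]
    rw [heq]
    exact (hat ((hroot b).symm ▸ hb)).comp b hroot_diff
  by_cases hb0 : b 0 = 0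
  swap
  · exact hne hb hb0
  have hcont : ContinuousOn F O := by
    intro c hc
    rw [← sqFst_sqrtFst c] at hc ⊢
    refine ContinuousAt.continuousWithinAt ?_
    have h1 : Tendsto (F ∘ sqFst) (𝓝 (sqrtFst c)) (𝓝 (F (sqFst (sqrtFst c)))) :=
      (hat hc).continuousAt
    exact (tendsto_map'_iff.2 h1).mono_left (isOpenMap_sqFst.nhds_le _)
  have hpair : Continuous fun p : ℂ × ℂ => (![p.1, p.2] : C2) := by fun_prop
  have hb' : (![0, b 1] : C2) = b := by
    ext i; fin_cases i
    · exact hb0.symm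
    · rfl
  obtain ⟨R, hR, hball⟩ := Metric.nhds_basis_closedBall.mem_iff.1
    ((hO.preimage hpair).mem_nhds (show ((0 : ℂ), b 1) ∈ _ from by
      rw [mem_preimage]; simpa only [hb'] using hb))
  rw [← closedBall_prod_same] at hball
  have key := differentiableAt_of_removable (F := fun x w => F ![x, w]) (w₀ := b 1) hR
    (hcont.comp hpair.continuousOn hball) (fun w hw x hx hx0 => ?_) ?_
  · have h2 : F = (fun p : ℂ × ℂ => F ![p.1, p.2]) ∘ fun c : C2 => (c 0, c 1) := by
      funext c
      simp only [Function.comp_apply]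
      congr 1
      ext i; fin_cases i <;> rfl
    rw [h2]
    refine DifferentiableAt.comp b ?_ (by fun_prop)
    rw [hb0]
    exact key
  · have hmem : (![x, w] : C2) ∈ O := hball (mk_mem_prod (Metric.ball_subset_closedBall hx) hw)
    exact (hne hmem hx0).comp x (f := fun x => (![x, w] : C2)) (differentiableAt_pi.2 fun i => by
      fin_cases i
      · exact differentiableAt_id
      · exact differentiableAt_const _)
  · have hsq : ∀ w : ℂ, sqFst ![0, w] = ![0, w] := fun w => by
      ext i; fin_cases i <;> simp [sqFst]
    have heq : (fun w => F ![0, w]) = (F ∘ sqFst) ∘ fun w => (![0, w] : C2) := by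
      funext w
      simp only [Function.comp_apply, hsq]
    change DifferentiableAt ℂ (fun w => F ![0, w]) (b 1)
    rw [heq]
    refine DifferentiableAt.comp _ (hat (by rw [hsq, hb']; exact hb))
      (differentiableAt_pi.2 fun i => ?_)
    fin_cases i
    · exact differentiableAt_const _
    · exact differentiableAt_id

/-! ### Charts of `X` at generic points of the discriminant -/

/-- Linear coordinates `u` at a generic point `z` of a mirror, in which the reflection `ρ` is
`(u₀, u₁) ↦ (-u₀, u₁)`, scaled so that the polydisc of radius two is contained in a slice. -/
structure IsMirrorFrame (z : C2) (ρ : C2 ≃ᵃ[ℂ] C2) (T : C2 ≃ₗ[ℂ] C2) : Prop where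
  mem : ρ ∈ G
  ne_one : ρ ≠ 1
  stab : ∀ g ∈ G, g z = z → g = 1 ∨ g = ρ
  apply_add : ∀ u, ρ (z + T u) = z + T ![-u 0, u 1]
  fixed : ∀ g ∈ G, ∀ u ∈ Metric.ball (0 : C2) 2, ∀ u' ∈ Metric.ball (0 : C2) 2,
    g (z + T u) = z + T u' → g z = z
  notMem : ∀ u ∈ Metric.ball (0 : C2) 2, z + T u ∉ isolatedPoints

/-- Eigenvectors of the reflection give the coordinates. -/
theorem exists_isMirrorFrame {z : C2} (hz : z ∉ isolatedPoints) (hfree : z ∉ freePoints) :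
    ∃ ρ T, IsMirrorFrame z ρ T := by
  obtain ⟨ρ, hρ, hρz, hρ1⟩ : ∃ ρ ∈ G, ρ z = z ∧ ρ ≠ 1 := by
    by_contra hcon
    push Not at hcon
    exact hfree hcon
  obtain ⟨w, hw, hne⟩ : ∃ w, ρ w = w ∧ z ≠ w := by
    by_contra hcon
    push Not at hcon
    exact hz ⟨ρ, hρ, hρz, fun w hw => (hcon w hw).symm⟩
  have hsq : ∀ b, ρ.linear (ρ.linear b) = b := fun b => by
    have h := mul_self_eq_one_of_fixed hρ hne hρz hw
    have h2 : (ρ * ρ).linear b = (1 : C2 ≃ᵃ[ℂ] C2).linear b := by rw [h]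
    exact h2
  set v₁ := w - z with hv₁
  have hv₁0 : v₁ ≠ 0 := sub_ne_zero.2 hne.symm
  have hv₁ρ : ρ.linear v₁ = v₁ := by
    rw [← apply_eq_iff_linear hρz, hv₁, add_sub_cancel]
    exact hw
  obtain ⟨c, hc⟩ : ∃ c, ρ.linear c ≠ c := by
    by_contra hcon
    push Not at hcon
    exact hρ1 (eq_one_of_linear_eq_one hρz hcon)
  set v₀ := c - ρ.linear c with hv₀
  have hv₀0 : v₀ ≠ 0 := sub_ne_zero.2 hc.symm
  have hv₀ρ : ρ.linear v₀ = -v₀ := by rw [hv₀, map_sub, hsq, neg_sub]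
  obtain ⟨S, hS, hSV⟩ := exists_isSlice z (isOpen_compl_isolatedPoints.mem_nhds hz)
  let L : C2 →ₗ[ℂ] C2 := (LinearMap.proj 0).smulRight v₀ + (LinearMap.proj 1).smulRight v₁
  have hL : ∀ u, L u = u 0 • v₀ + u 1 • v₁ := fun u => rfl
  have hρL : ∀ u, ρ.linear (L u) = L ![-u 0, u 1] := fun u => by
    rw [hL, hL, map_add, map_smul, map_smul, hv₀ρ, hv₁ρ]
    simp
  have hinj : Function.Injective L := by
    refine LinearMap.ker_eq_bot.1 (LinearMap.ker_eq_bot'.2 fun u hu => ?_)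
    have h1 := hρL u
    rw [hu, map_zero, hL] at h1
    rw [hL] at hu
    simp only [Matrix.cons_val_zero, Matrix.cons_val_one] at h1
    have h2 : (2 * u 1) • v₁ = 0 := by
      calc (2 * u 1) • v₁ = (u 0 • v₀ + u 1 • v₁) + (-u 0 • v₀ + u 1 • v₁) := by module
        _ = 0 := by rw [hu, ← h1, add_zero]
    have hu1 : u 1 = 0 := by simpa [hv₁0] using h2
    rw [hu1, zero_smul, add_zero, smul_eq_zero, or_iff_left hv₀0] at hu
    ext i; fin_cases i
    · exact hu
    · exact hu1
  have hLc : Continuous L := L.continuous_of_finiteDimensional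
  obtain ⟨ε, hε, hball⟩ := Metric.isOpen_iff.1 (hS.isOpen.preimage hLc) 0
    (by rw [mem_preimage, map_zero]; exact hS.zero_mem)
  have ha : ((ε / 2 : ℝ) : ℂ) ≠ 0 := by exact_mod_cast (half_pos hε).ne'
  let T : C2 ≃ₗ[ℂ] C2 :=
    (LinearEquiv.smulOfNeZero ℂ C2 ((ε / 2 : ℝ) : ℂ) ha).trans (LinearEquiv.ofInjectiveEndo L hinj)
  have hT : ∀ u, T u = L (((ε / 2 : ℝ) : ℂ) • u) := fun u => rfl
  have hTS : ∀ u ∈ Metric.ball (0 : C2) 2, T u ∈ S := fun u hu => by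
    refine hball (mem_ball_zero_iff.2 ?_)
    rw [mem_ball_zero_iff] at hu
    change ‖((ε / 2 : ℝ) : ℂ) • u‖ < ε
    rw [norm_smul, Complex.norm_real, Real.norm_of_nonneg (half_pos hε).le]
    nlinarith
  refine ⟨ρ, T, hρ, hρ1, fun g hg hgz => ?_, fun u => ?_, fun g hg u hu u' hu' h =>
    hS.fixed g hg _ (hTS u hu) _ (hTS u' hu') h, fun u hu => hSV _ (hTS u hu)⟩
  · by_cases h : g = 1
    · exact Or.inl h
    · exact Or.inr (eq_of_fixed_of_notMem_isolatedPoints hz hg hρ hgz hρz h hρ1)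
  · rw [AffineG12.apply_add, hρz, hT, hT, hρL]
    simp

/-- The chart of `X` at `proj z` given by the coordinates `(u₀², u₁)`. The choice of the square root
does not matter, since `(±u₀, u₁)` are exchanged by the reflection. -/
def mirrorChart (z : C2) (T : C2 ≃ₗ[ℂ] C2) (b : C2) : X := proj (z + T (sqrtFst b))

/-- The domain of the chart `mirrorChart`. -/
def mirrorDomain : Set C2 := {b | ‖b 0‖ < 4 ∧ ‖b 1‖ < 2}

theorem sqFst_mem_mirrorDomain {u : C2} : sqFst u ∈ mirrorDomain ↔ u ∈ Metric.ball (0 : C2) 2 :=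
  sqFst_mem_iff

theorem isOpen_mirrorDomain : IsOpen mirrorDomain :=
  (isOpen_lt (f := fun b : C2 => ‖b 0‖) (by fun_prop) continuous_const).inter
    (isOpen_lt (f := fun b : C2 => ‖b 1‖) (by fun_prop) continuous_const)

theorem convex_mirrorDomain : Convex ℝ mirrorDomain := by
  have h : mirrorDomain = ((LinearMap.proj 0 : C2 →ₗ[ℂ] ℂ).restrictScalars ℝ) ⁻¹' Metric.ball 0 4 ∩
      ((LinearMap.proj 1 : C2 →ₗ[ℂ] ℂ).restrictScalars ℝ) ⁻¹' Metric.ball 0 2 := by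
    ext b
    simp [mirrorDomain]
  rw [h]
  exact ((convex_ball _ _).linear_preimage _).inter ((convex_ball _ _).linear_preimage _)

section MirrorFrame

variable {z : C2} {ρ : C2 ≃ᵃ[ℂ] C2} {T : C2 ≃ₗ[ℂ] C2}

theorem continuous_add_linear (z : C2) (T : C2 ≃ₗ[ℂ] C2) : Continuous fun u => z + T u :=
  (continuous_const_add z).comp (LinearMap.continuous_of_finiteDimensional (T : C2 →ₗ[ℂ] C2))

theorem differentiable_linear (T : C2 ≃ₗ[ℂ] C2) : Differentiable ℂ T :=
  (LinearMap.toContinuousLinearMap (T : C2 →ₗ[ℂ] C2)).differentiable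

theorem isOpenMap_add_linear (z : C2) (T : C2 ≃ₗ[ℂ] C2) : IsOpenMap fun u => z + T u :=
  (isOpenMap_add_left z).comp (T.toContinuousLinearEquiv.toHomeomorph.isOpenMap)

theorem IsMirrorFrame.mirrorChart_sqFst (h : IsMirrorFrame z ρ T) (u : C2) :
    mirrorChart z T (sqFst u) = proj (z + T u) := by
  rcases sqFst_eq_iff.1 (sqFst_sqrtFst (sqFst u)) with h1 | h1
  · rw [mirrorChart, h1]
  · rw [mirrorChart, h1, ← h.apply_add, proj_apply h.mem]

theorem IsMirrorFrame.continuous_mirrorChart (h : IsMirrorFrame z ρ T) :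
    Continuous (mirrorChart z T) := by
  refine continuous_iff_continuousAt.2 fun b => ?_
  have h1 : Tendsto (mirrorChart z T ∘ sqFst) (𝓝 (sqrtFst b)) (𝓝 (mirrorChart z T b)) := by
    rw [show mirrorChart z T ∘ sqFst = fun u => proj (z + T u) from funext h.mirrorChart_sqFst]
    exact (continuous_proj.comp (continuous_add_linear z T)).continuousAt
  have h2 := (tendsto_map'_iff.2 h1).mono_left (isOpenMap_sqFst.nhds_le _)
  rwa [sqFst_sqrtFst] at h2

theorem IsMirrorFrame.mem_freePoints (h : IsMirrorFrame z ρ T) {u : C2}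
    (hu : u ∈ Metric.ball (0 : C2) 2) : z + T u ∈ freePoints ↔ u 0 ≠ 0 := by
  constructor
  · intro hfree h0
    refine h.ne_one (hfree ρ h.mem ?_)
    rw [h.apply_add]
    congr 2
    ext i; fin_cases i <;> simp [h0]
  · intro h0 g hg hgu
    rcases h.stab g hg (h.fixed g hg u hu u hu hgu) with h1 | rfl
    · exact h1
    · rw [h.apply_add, add_right_inj, T.injective.eq_iff] at hgu
      exact absurd (self_eq_neg.1 (congrFun hgu 0).symm) h0

theorem IsMirrorFrame.proj_mem_M_iff (h : IsMirrorFrame z ρ T) {u : C2}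
    (hu : u ∈ Metric.ball (0 : C2) 2) : proj (z + T u) ∈ M ↔ u 0 = 0 := by
  constructor
  · intro hM
    by_contra h0
    exact (proj_mem_smoothComplement ((h.mem_freePoints hu).2 h0)).2 hM
  · intro h0
    rw [AffineG12.proj_mem_M_iff]
    have hfix : ∀ u : C2, u 0 = 0 → ρ (z + T u) = z + T u := fun u h0 => by
      rw [h.apply_add]
      congr 2
      ext i; fin_cases i <;> simp [h0]
    refine ⟨ρ, h.mem, (isAffineReflection_iff_ne_one h.mem).2 ⟨h.ne_one, z + T 0, z + T ![0, 1],
      fun heq => ?_, hfix _ rfl, hfix _ rfl⟩, hfix u h0⟩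
    rw [add_right_inj, T.injective.eq_iff] at heq
    simpa using congrFun heq 1

theorem IsMirrorFrame.isQuotientChart (h : IsMirrorFrame z ρ T) :
    IsQuotientChart OX ⊥ mirrorDomain (mirrorChart z T) where
  isOpen := isOpen_mirrorDomain
  isConnected := ⟨⟨0, by simp [mirrorDomain]⟩, convex_mirrorDomain.isPreconnected⟩
  zero_mem := by simp [mirrorDomain]
  invariant γ hγ b hb := by rw [Subgroup.mem_bot.1 hγ]; exact hb
  continuousOn := h.continuous_mirrorChart.continuousOn
  isOpen_image V _ hV := by
    have h1 : mirrorChart z T '' V = proj '' ((fun u => z + T u) '' (sqFst ⁻¹' V)) := by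
      rw [image_image]
      ext x
      constructor
      · rintro ⟨b, hb, rfl⟩
        exact ⟨sqrtFst b, by rwa [mem_preimage, sqFst_sqrtFst], rfl⟩
      · rintro ⟨u, hu, rfl⟩
        exact ⟨sqFst u, hu, h.mirrorChart_sqFst u⟩
    rw [h1]
    exact isOpenMap_proj _ (isOpenMap_add_linear z T _
      (hV.preimage differentiable_sqFst.continuous))
  fiber b hb b' hb' := by
    constructor
    · intro heq
      refine ⟨1, one_mem _, ?_⟩
      change b = b'
      rw [← sqFst_sqrtFst b, sqFst_mem_mirrorDomain] at hb
      rw [← sqFst_sqrtFst b', sqFst_mem_mirrorDomain] at hb'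
      obtain ⟨g, hg, hgb⟩ := proj_eq_iff.1 heq
      rw [← sqFst_sqrtFst b, ← sqFst_sqrtFst b']
      rcases h.stab g hg (h.fixed g hg _ hb _ hb' hgb) with rfl | rfl
      · change z + T (sqrtFst b) = z + T (sqrtFst b') at hgb
        rw [T.injective (add_left_cancel hgb)]
      · rw [h.apply_add] at hgb
        rw [eq_comm, sqFst_eq_iff]
        exact Or.inr (T.injective (add_left_cancel hgb)).symm
    · rintro ⟨γ, hγ, rfl⟩
      rw [Subgroup.mem_bot.1 hγ]
      rfl
  isHol_iff U hU f := by
    change DifferentiableOn ℂ (f ∘ proj) (proj ⁻¹' U) ↔ _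
    have hO : IsOpen (proj ⁻¹' (U : Set X)) := U.isOpen.preimage continuous_proj
    have hBO : IsOpen (mirrorDomain ∩ mirrorChart z T ⁻¹' U) :=
      isOpen_mirrorDomain.inter (U.isOpen.preimage h.continuous_mirrorChart)
    have hcomp : (f ∘ mirrorChart z T) ∘ sqFst = (f ∘ proj) ∘ fun u => z + T u := by
      funext u
      simp only [Function.comp_apply, h.mirrorChart_sqFst]
    constructor
    · intro hf b hb
      refine (differentiableAt_of_comp_sqFst hBO ?_ hb).differentiableWithinAt
      rw [hcomp]
      refine DifferentiableOn.comp (t := proj ⁻¹' (U : Set X)) hf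
        ((differentiable_linear T).const_add z).differentiableOn fun u hu => ?_
      have := hu.2
      rw [mem_preimage, h.mirrorChart_sqFst] at this
      exact this
    · intro hf y hy
      obtain ⟨b, hb, hby⟩ := hU hy
      obtain ⟨g, hg, hgy⟩ := proj_eq_iff.1 hby.symm
      have heq : f ∘ proj = ((f ∘ mirrorChart z T) ∘ sqFst) ∘ fun w => T.symm (g w - z) := by
        rw [hcomp]
        funext w
        simp only [Function.comp_apply, LinearEquiv.apply_symm_apply, add_sub_cancel, proj_apply hg]
      have hsq : sqFst (T.symm (g y - z)) = b := by
        rw [hgy, add_sub_cancel_left, LinearEquiv.symm_apply_apply, sqFst_sqrtFst]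
      have hbO : sqFst (T.symm (g y - z)) ∈ mirrorDomain ∩ mirrorChart z T ⁻¹' U := by
        rw [hsq]
        refine ⟨hb, ?_⟩
        rw [mem_preimage, hby]
        exact hy
      have h1 := (hf _ hbO).differentiableAt (hBO.mem_nhds hbO)
      rw [heq]
      have h2 : DifferentiableAt ℂ (fun w => T.symm (g w - z)) y :=
        DifferentiableAt.comp (g := T.symm) (f := fun w => g w - z) y
          (differentiable_linear T.symm _) ((differentiable_affine g y).sub_const z)
      exact ((h1.comp _ (differentiable_sqFst _)).comp y h2).differentiableWithinAt

/-- The circle `u ↦ (e^{2πit}, 0)` in the coordinates `(u₀², u₁)` is a meridian loop. -/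
theorem IsMirrorFrame.mem_meridians (h : IsMirrorFrame z ρ T) {x₀ y : smoothComplement OX M}
    (l : Path y y) (a : Path x₀ y) (hl : ∀ t, (l t : X) =
      mirrorChart z T ![Complex.exp (2 * Real.pi * Complex.I * (t : ℝ)), 0]) :
    FundamentalGroup.fromPath (Path.Homotopic.Quotient.mk ((a.trans l).trans a.symm)) ∈
      meridians OX M x₀ := by
  refine ⟨mirrorDomain, mirrorChart z T, h.isQuotientChart, fun b hb => ?_, fun w hw => ?_, y, l, a,
    hl, rfl⟩
  · rw [← sqFst_sqrtFst b] at hb ⊢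
    rw [h.mirrorChart_sqFst, h.proj_mem_M_iff (sqFst_mem_mirrorDomain.1 hb)]
    change _ ↔ sqrtFst b 0 ^ 2 = 0
    rw [sq_eq_zero_iff]
  · simp only [mirrorDomain, mem_ofPred_eq, Matrix.cons_val_zero, Matrix.cons_val_one, norm_zero]
    exact ⟨by linarith, two_pos⟩

end MirrorFrame

/-! ### Holonomy around a mirror -/

section Holonomy

/-- A function on homotopy classes of paths depends only on the underlying map of a path, also when
the end points are not definitionally equal. -/
theorem holonomy_congr {Q Y : Type*} [TopologicalSpace Y]
    (θ : ∀ {y y' : Y}, Path.Homotopic.Quotient y y' → Q) {x x' y y' : Y} (γ : Path x x')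
    (γ' : Path y y') (h : ∀ t, γ t = γ' t) :
    θ (Path.Homotopic.Quotient.mk γ) = θ (Path.Homotopic.Quotient.mk γ') := by
  have h0 : x = y := by rw [← γ.source, h, γ'.source]
  have h1 : x' = y' := by rw [← γ.target, h, γ'.target]
  subst h0 h1
  congr 2
  exact Path.ext (funext h)

/-- The domain of the logarithmic coordinates `(log u₀, u₁)` on the complement of
the mirror in the polydisc of radius two. -/
def logDomain : Set C2 := {p | (p 0).re < Real.log 2 ∧ ‖p 1‖ < 2}

theorem convex_logDomain : Convex ℝ logDomain := by
  have h : logDomain = {p : C2 | (p 0).re < Real.log 2} ∩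
      ((LinearMap.proj 1 : C2 →ₗ[ℂ] ℂ).restrictScalars ℝ) ⁻¹' Metric.ball 0 2 := by
    ext b
    simp [logDomain]
  rw [h]
  refine Convex.inter (convex_halfSpace_lt (f := fun p : C2 => (p 0).re) ⟨fun _ _ => rfl,
    fun c p => ?_⟩ _) ((convex_ball _ _).linear_preimage _)
  simp

/-- The translation of the logarithmic coordinates by `2πin`. -/
def logShift (n : ℤ) (p : logDomain) : logDomain :=
  ⟨![(p : C2) 0 + n * (2 * Real.pi * Complex.I), (p : C2) 1], by
    have h : ((n : ℂ) * (2 * Real.pi * Complex.I)).re = 0 := by simp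
    have := p.2
    simp only [logDomain, mem_ofPred_eq, Matrix.cons_val_zero, Matrix.cons_val_one,
      Complex.add_re, h, add_zero] at this ⊢
    exact this⟩

/-- The straight path in logarithmic coordinates. -/
def logSegment (p p' : logDomain) : Path p p' where
  toFun t := ⟨AffineMap.lineMap (p : C2) (p' : C2) (t : ℝ),
    convex_logDomain.lineMap_mem p.2 p'.2 t.2⟩
  continuous_toFun := by
    simp only [AffineMap.lineMap_apply_module]
    fun_prop
  source' := by simp
  target' := by simp

variable {z : C2} {ρ : C2 ≃ᵃ[ℂ] C2} {T : C2 ≃ₗ[ℂ] C2}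

theorem exp_mem_ball {p : C2} (hp : p ∈ logDomain) :
    ![Complex.exp (p 0), p 1] ∈ Metric.ball (0 : C2) 2 := by
  rw [mem_ball_zero_iff, pi_norm_lt_iff two_pos, Fin.forall_fin_two]
  refine ⟨?_, hp.2⟩
  rw [Matrix.cons_val_zero, Complex.norm_exp]
  exact (Real.lt_log_iff_exp_lt two_pos).1 hp.1

/-- The universal covering of the complement of the mirror in the polydisc of radius two. -/
def IsMirrorFrame.expMap (h : IsMirrorFrame z ρ T) (p : logDomain) : freePoints :=
  ⟨z + T ![Complex.exp ((p : C2) 0), (p : C2) 1],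
    (h.mem_freePoints (exp_mem_ball p.2)).2 (Complex.exp_ne_zero _)⟩

theorem IsMirrorFrame.continuous_expMap (h : IsMirrorFrame z ρ T) : Continuous h.expMap := by
  have hc : Continuous fun p : C2 => (![Complex.exp (p 0), p 1] : C2) := by fun_prop
  exact Continuous.subtype_mk ((continuous_add_linear z T).comp
    (hc.comp continuous_subtype_val)) _

theorem IsMirrorFrame.expMap_logShift (h : IsMirrorFrame z ρ T) (n : ℤ) (p : logDomain) :
    h.expMap (logShift n p) = h.expMap p := by
  refine Subtype.ext ?_
  change z + T ![Complex.exp ((p : C2) 0 + n * (2 * Real.pi * Complex.I)), (p : C2) 1] =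
    z + T ![Complex.exp ((p : C2) 0), (p : C2) 1]
  rw [Complex.exp_eq_exp_iff_exists_int.2 ⟨n, rfl⟩]

/-- If the holonomy around the circle `t ↦ (e^{2πit}, 0)` is trivial, then so is that of all loops
near a generic point of the mirror: in logarithmic coordinates a loop becomes a path between two
points that differ by an integral multiple of `2πi`. -/
theorem IsMirrorFrame.holonomy_eq_one {Q : Type*} [Group Q] (h : IsMirrorFrame z ρ T)
    (θ : ∀ {y y' : freePoints}, Path.Homotopic.Quotient y y' → Q)
    (hθ : ∀ {y y' y'' : freePoints} (a : Path.Homotopic.Quotient y y')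
      (b : Path.Homotopic.Quotient y' y''), θ (a.trans b) = θ a * θ b)
    (hcirc : ∀ (y : freePoints) (c : Path y y),
      (∀ t : I, (c t : C2) = z + T ![Complex.exp (2 * Real.pi * Complex.I * (t : ℝ)), 0]) →
      θ (Path.Homotopic.Quotient.mk c) = 1)
    {y : freePoints} (γ : Path y y)
    (hγ : ∀ t, (γ t : C2) ∈ (fun u => z + T u) '' Metric.ball (0 : C2) 2) :
    θ (Path.Homotopic.Quotient.mk γ) = 1 := by
  let Θ : logDomain → logDomain → Q := fun p p' =>
    θ (Path.Homotopic.Quotient.mk ((logSegment p p').map h.continuous_expMap))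
  have hΘ : ∀ {p p' : logDomain} (δ : Path p p'),
      θ (Path.Homotopic.Quotient.mk (δ.map h.continuous_expMap)) = Θ p p' := fun {p p'} δ => by
    have h1 : δ.Homotopic (logSegment p p') := homotopic_of_lineMap_mem δ _ fun s t =>
      convex_logDomain.lineMap_mem (δ t).2 (logSegment p p' t).2 s.2
    change θ _ = θ _
    rw [Path.Homotopic.Quotient.eq.2 (h1.map ⟨_, h.continuous_expMap⟩)]
  have hmul : ∀ p p' p'', Θ p p' * Θ p' p'' = Θ p p'' := fun p p' p'' => by
    rw [← hΘ ((logSegment p p').trans (logSegment p' p'')), Path.map_trans,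
      Path.Homotopic.Quotient.mk_trans, hθ]
  have hself : ∀ p, Θ p p = 1 := fun p => by simpa using hmul p p p
  have hshift : ∀ n p p', Θ (logShift n p) (logShift n p') = Θ p p' := fun n p p' => by
    refine holonomy_congr θ _ _ fun t => ?_
    rw [Path.map_coe, Path.map_coe, Function.comp_apply, Function.comp_apply,
      ← h.expMap_logShift n (logSegment p p' t)]
    congr 1
    refine Subtype.ext ?_
    change AffineMap.lineMap (logShift n p : C2) (logShift n p' : C2) (t : ℝ) =
      (logShift n (logSegment p p' t) : C2)
    ext i
    fin_cases i
    · simp [logShift, logSegment, AffineMap.lineMap_apply_module]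
      ring
    · simp [logShift, logSegment, AffineMap.lineMap_apply_module]
  let o : logDomain := ⟨0, by simp [logDomain, Real.log_pos one_lt_two]⟩
  have ho : Θ o (logShift 1 o) = 1 := by
    have h1 := h.expMap_logShift 1 o
    rw [← hcirc _ (((logSegment o (logShift 1 o)).map h.continuous_expMap).cast rfl h1.symm)
      fun t => ?_]
    · exact holonomy_congr θ _ _ fun t => rfl
    · change z + T ![Complex.exp (AffineMap.lineMap (o : C2) (logShift 1 o : C2) (t : ℝ) 0),
        AffineMap.lineMap (o : C2) (logShift 1 o : C2) (t : ℝ) 1] = _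
      congr 4
      · simp [o, logShift, AffineMap.lineMap_apply_module]
        ring
      · simp [o, logShift, AffineMap.lineMap_apply_module]
  have h1 : ∀ p, Θ p (logShift 1 p) = 1 := fun p => by
    rw [← hmul p o, ← hmul o (logShift 1 o), ho, one_mul, hshift, hmul, hself]
  have hadd : ∀ (m n : ℤ) p, logShift m (logShift n p) = logShift (m + n) p := fun m n p => by
    refine Subtype.ext ?_
    ext i
    fin_cases i
    · simp [logShift]
      ring
    · rfl
  have hn : ∀ (n : ℤ) p, Θ p (logShift n p) = 1 := fun n p => by
    induction n with
    | zero =>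
      have : logShift 0 p = p := by
        refine Subtype.ext ?_
        ext i
        fin_cases i <;> simp [logShift]
      rw [this, hself]
    | succ n ih => rw [← hmul p (logShift n p), ih, one_mul, ← hadd, hshift, h1]
    | pred n ih =>
      have h2 := hmul p (logShift (-n - 1) p) (logShift (-n) p)
      have h3 : logShift (-n) p = logShift (-n - 1) (logShift 1 p) := by
        rw [hadd, sub_add_cancel]
      rw [ih, h3, hshift, h1, mul_one] at h2
      exact h2
  -- the lift of the loop to logarithmic coordinates
  let u : I → C2 := fun t => T.symm ((γ t : C2) - z)
  have huc : Continuous u := (differentiable_linear T.symm).continuous.comp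
    ((continuous_subtype_val.comp γ.continuous).sub continuous_const)
  have hu : ∀ t, u t ∈ Metric.ball (0 : C2) 2 ∧ z + T (u t) = γ t := fun t => by
    obtain ⟨v, hv, hvt⟩ := hγ t
    have : u t = v := by simp only [u, ← hvt, add_sub_cancel_left, LinearEquiv.symm_apply_apply]
    rw [this]
    exact ⟨hv, hvt⟩
  have hu0 : ∀ t, u t 0 ≠ 0 := fun t => (h.mem_freePoints (hu t).1).1 ((hu t).2 ▸ (γ t).2)
  have cov := Complex.isCoveringMap_exp
  let f : C(I, {w : ℂ // w ≠ 0}) := ⟨fun t => ⟨u t 0, hu0 t⟩, by fun_prop⟩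
  have hf0 : f 0 = ⟨_, (Complex.log (u 0 0)).exp_ne_zero⟩ :=
    Subtype.ext (Complex.exp_log (hu0 0)).symm
  set lam := cov.liftPath f (Complex.log (u 0 0)) hf0 with hlam
  have hexp : ∀ t, Complex.exp (lam t) = u t 0 := fun t =>
    congrArg Subtype.val (congrFun (cov.liftPath_lifts f _ hf0) t)
  have hlog : ∀ t, (![lam t, u t 1] : C2) ∈ logDomain := fun t => by
    have h2 := (hu t).1
    rw [mem_ball_zero_iff, pi_norm_lt_iff two_pos, Fin.forall_fin_two, ← hexp,
      Complex.norm_exp] at h2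
    exact ⟨(Real.lt_log_iff_exp_lt two_pos).2 h2.1, h2.2⟩
  let δ : Path (⟨_, hlog 0⟩ : logDomain) ⟨_, hlog 1⟩ :=
    { toFun := fun t => ⟨_, hlog t⟩
      continuous_toFun := by
        refine Continuous.subtype_mk ?_ hlog
        fun_prop
      source' := rfl
      target' := rfl }
  have hδ : θ (Path.Homotopic.Quotient.mk γ) =
      θ (Path.Homotopic.Quotient.mk (δ.map h.continuous_expMap)) := by
    refine holonomy_congr θ _ _ fun t => Subtype.ext ?_
    rw [← (hu t).2]
    change _ = z + T ![Complex.exp (lam t), u t 1]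
    rw [hexp]
    congr 2
    ext i; fin_cases i <;> rfl
  have hu01 : u 1 = u 0 := by simp only [u, γ.source, γ.target]
  obtain ⟨n, hn'⟩ := Complex.exp_eq_exp_iff_exists_int.1
    ((hexp 1).trans ((congrFun hu01 0).trans (hexp 0).symm))
  have hend : (⟨_, hlog 1⟩ : logDomain) = logShift n ⟨_, hlog 0⟩ := by
    refine Subtype.ext ?_
    ext i; fin_cases i
    · exact hn'
    · exact congrFun hu01 1
  rw [hδ, hΘ, hend, hn]

end Holonomy

/-! ### The orbifold fundamental group -/

section Quotients

variable {Y Z : Type*} [TopologicalSpace Y] [TopologicalSpace Z]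

theorem quotient_map_trans {x y z : Y} (a : Path.Homotopic.Quotient x y)
    (b : Path.Homotopic.Quotient y z) (f : C(Y, Z)) :
    (a.trans b).map f = (a.map f).trans (b.map f) := by
  induction a using Path.Homotopic.Quotient.ind with | mk a => ?_
  induction b using Path.Homotopic.Quotient.ind with | mk b => ?_
  rw [← Path.Homotopic.Quotient.mk_trans, ← Path.Homotopic.Quotient.mk_map,
    ← Path.Homotopic.Quotient.mk_map, ← Path.Homotopic.Quotient.mk_map,
    ← Path.Homotopic.Quotient.mk_trans, Path.map_trans]

theorem quotient_conj_trans {x y y' y'' : Y} (p : Path.Homotopic.Quotient x y)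
    (p' : Path.Homotopic.Quotient x y') (p'' : Path.Homotopic.Quotient x y'')
    (a : Path.Homotopic.Quotient y y') (b : Path.Homotopic.Quotient y' y'') :
    ((p.trans a).trans p'.symm).trans ((p'.trans b).trans p''.symm) =
      (p.trans (a.trans b)).trans p''.symm := by
  have h : p'.symm.trans ((p'.trans b).trans p''.symm) = b.trans p''.symm := by
    rw [Path.Homotopic.Quotient.trans_assoc, ← Path.Homotopic.Quotient.trans_assoc,
      Path.Homotopic.Quotient.symm_trans, Path.Homotopic.Quotient.refl_trans]
  rw [Path.Homotopic.Quotient.trans_assoc (p.trans a), h, Path.Homotopic.Quotient.trans_assoc,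
    Path.Homotopic.Quotient.trans_assoc, Path.Homotopic.Quotient.trans_assoc]

end Quotients

instance : PathConnectedSpace freePoints :=
  isPathConnected_iff_pathConnectedSpace.1 isPathConnected_freePoints

/-- The covering of the regular part of `X`. -/
def regMap : C(freePoints, smoothComplement OX M) :=
  ⟨regProj smoothComplement_eq, isQuotientCoveringMap_smoothComplement.continuous⟩

/-- The normal subgroup generated by the squares of the meridians. -/
abbrev meridianSquares (x₀ : smoothComplement OX M) :
    Subgroup (FundamentalGroup (smoothComplement OX M) x₀) :=
  Subgroup.normalClosure {c | ∃ μ ∈ meridians OX M x₀, c = μ ^ 2}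

/-- The class, modulo squares of meridians, of the image in the regular part of `X` of a path of
points with trivial stabilizer, closed up by paths from the base point. The opposite group accounts
for the order of composition in the fundamental group. -/
def holonomy (y₀ : freePoints) {y y' : freePoints} (γ : Path.Homotopic.Quotient y y') :
    (FundamentalGroup (smoothComplement OX M) (regMap y₀) ⧸ meridianSquares (regMap y₀))ᵐᵒᵖ :=
  MulOpposite.op (QuotientGroup.mk (FundamentalGroup.fromPath
    ((((Path.Homotopic.Quotient.mk (PathConnectedSpace.somePath y₀ y)).trans γ).trans
      (Path.Homotopic.Quotient.mk (PathConnectedSpace.somePath y₀ y')).symm).map regMap)))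

theorem holonomy_trans (y₀ : freePoints) {y y' y'' : freePoints}
    (a : Path.Homotopic.Quotient y y') (b : Path.Homotopic.Quotient y' y'') :
    holonomy y₀ (a.trans b) = holonomy y₀ a * holonomy y₀ b := by
  simp only [holonomy]
  rw [← MulOpposite.op_mul, ← QuotientGroup.mk_mul, FundamentalGroup.mul_def, ← quotient_map_trans,
    quotient_conj_trans]

/-- In the coordinates `(u₀², u₁)` of `X` the circle `t ↦ (e^{2πit}, 0)` is run through twice, so
that its image in `X` is the square of a meridian loop. -/
theorem IsMirrorFrame.holonomy_circle {z : C2} {ρ : C2 ≃ᵃ[ℂ] C2} {T : C2 ≃ₗ[ℂ] C2}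
    (h : IsMirrorFrame z ρ T) (y₀ y : freePoints) (c : Path y y)
    (hc : ∀ t : I, (c t : C2) = z + T ![Complex.exp (2 * Real.pi * Complex.I * (t : ℝ)), 0]) :
    holonomy y₀ (Path.Homotopic.Quotient.mk c) = 1 := by
  have hsq : ∀ w : ℂ, proj (z + T ![w, 0]) = mirrorChart z T ![w ^ 2, 0] := fun w =>
    (h.mirrorChart_sqFst ![w, 0]).symm
  -- half of the circle closes up downstairs to a meridian
  let half : ℝ → freePoints := fun t => h.expMap
    ⟨![Real.pi * Complex.I * t, 0], by simp [logDomain, Real.log_pos one_lt_two]⟩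
  have hhalf : ∀ t : ℝ, (regMap (half t) : X) =
      mirrorChart z T ![Complex.exp (2 * Real.pi * Complex.I * t), 0] := fun t => by
    change proj (z + T ![Complex.exp (Real.pi * Complex.I * t), 0]) = _
    rw [hsq, ← Complex.exp_nat_mul]
    have h1 : ((2 : ℕ) : ℂ) * (Real.pi * Complex.I * t) = 2 * Real.pi * Complex.I * t := by
      push_cast
      ring
    rw [h1]
  have hcX : ∀ t : I, (regMap (c t) : X) =
      mirrorChart z T ![Complex.exp (2 * Real.pi * Complex.I * ((2 * (t : ℝ) : ℝ))), 0] :=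
    fun t => by
      change proj (c t) = _
      rw [hc, hsq, ← Complex.exp_nat_mul]
      have h1 : ((2 : ℕ) : ℂ) * (2 * Real.pi * Complex.I * (t : ℝ)) =
          2 * Real.pi * Complex.I * ((2 * (t : ℝ) : ℝ)) := by
        push_cast
        ring
      rw [h1]
  have hcont : Continuous fun t : ℝ => regMap (half t) := by
    refine regMap.continuous.comp (h.continuous_expMap.comp (Continuous.subtype_mk ?_ _))
    fun_prop
  have hy : (regMap y : X) = mirrorChart z T ![1, 0] := by
    have := hcX 0
    rw [c.source] at this
    rw [this]
    simp
  let l : Path (regMap y) (regMap y) :=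
    { toFun := fun t => regMap (half t)
      continuous_toFun := hcont.comp continuous_subtype_val
      source' := Subtype.ext (by rw [hhalf, hy]; simp)
      target' := Subtype.ext (by rw [hhalf, hy]; simp [Complex.exp_two_pi_mul_I]) }
  have hl : ∀ t : I, (l t : X) =
      mirrorChart z T ![Complex.exp (2 * Real.pi * Complex.I * (t : ℝ)), 0] := fun t => hhalf t
  have hcl : c.map regMap.continuous = l.trans l := by
    ext t
    rw [Path.map_coe, Function.comp_apply, hcX, Path.trans_apply]
    split_ifs with ht
    · exact (hhalf (2 * t)).symm
    · refine Eq.trans ?_ (hhalf (2 * t - 1)).symm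
      congr 2
      rw [Complex.exp_eq_exp_iff_exists_int]
      exact ⟨1, by push_cast; ring⟩
  set p := PathConnectedSpace.somePath y₀ y with hp
  have hmem := h.mem_meridians l (p.map regMap.continuous) hl
  refine MulOpposite.unop_injective ?_
  change (QuotientGroup.mk _ : FundamentalGroup (smoothComplement OX M) (regMap y₀) ⧸
    meridianSquares (regMap y₀)) = 1
  rw [QuotientGroup.eq_one_iff]
  refine Subgroup.subset_normalClosure ⟨_, hmem, ?_⟩
  rw [pow_two, FundamentalGroup.mul_def, Path.Homotopic.Quotient.mk_trans,
    Path.Homotopic.Quotient.mk_trans, Path.Homotopic.Quotient.mk_symm, quotient_conj_trans,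
    ← Path.Homotopic.Quotient.mk_trans l l, ← hcl, quotient_map_trans, quotient_map_trans]
  rfl

/-- Every point outside the isolated fixed points has a convex neighbourhood in which all loops of
points with trivial stabilizer have trivial holonomy. -/
theorem exists_convex_nhds_holonomy (y₀ : freePoints) {z : C2} (hz : z ∉ isolatedPoints) :
    ∃ U : Set C2, IsOpen U ∧ z ∈ U ∧ U ⊆ isolatedPointsᶜ ∧ Convex ℝ U ∧
      ∀ (y : freePoints) (γ : Path y y), (∀ t, (γ t : C2) ∈ U) →
        holonomy y₀ (Path.Homotopic.Quotient.mk γ) = 1 := by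
  by_cases hfree : z ∈ freePoints
  · obtain ⟨ε, hε, hball⟩ := Metric.isOpen_iff.1 isOpen_freePoints z hfree
    refine ⟨Metric.ball z ε, Metric.isOpen_ball, Metric.mem_ball_self hε,
      hball.trans freePoints_subset_compl_isolatedPoints, convex_ball _ _, fun y γ hγ => ?_⟩
    have h1 : γ.Homotopic (Path.refl y) := homotopic_of_lineMap_mem γ _ fun s t =>
      hball (lineMap_mem_ball (hγ t) (γ.source ▸ hγ 0) s.2)
    rw [Path.Homotopic.Quotient.eq.2 h1]
    have h2 := holonomy_trans y₀ (Path.Homotopic.Quotient.refl y) (Path.Homotopic.Quotient.refl y)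
    rw [Path.Homotopic.Quotient.refl_trans] at h2
    exact left_eq_mul.1 h2
  · obtain ⟨ρ, T, h⟩ := exists_isMirrorFrame hz hfree
    refine ⟨(fun u => z + T u) '' Metric.ball 0 2, isOpenMap_add_linear z T _ Metric.isOpen_ball,
      ⟨0, Metric.mem_ball_self two_pos, by simp⟩, ?_, ?_, fun y γ hγ =>
        h.holonomy_eq_one (holonomy y₀) (holonomy_trans y₀)
          (fun y c hc => h.holonomy_circle y₀ y c hc) γ hγ⟩
    · rintro _ ⟨u, hu, rfl⟩
      exact h.notMem u hu
    · rw [← image_image (fun w => z + w) T]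
      exact ((convex_ball (0 : C2) 2).linear_image
        ((T : C2 →ₗ[ℂ] C2).restrictScalars ℝ)).translate z

/-- The monodromy principle on the complement of the isolated fixed points, which is simply
connected. -/
theorem holonomy_loop_eq_one (y₀ : freePoints) {y : freePoints} (γ : Path y y) :
    holonomy y₀ (Path.Homotopic.Quotient.mk γ) = 1 := by
  have := isOpen_compl_isolatedPoints.locallyPathConnectedSpace
  choose U hUo hzU hUW hUconv hloc using fun z : (isolatedPointsᶜ : Set C2) =>
    exists_convex_nhds_holonomy y₀ z.2
  refine holonomy_eq_one isSimplyConnected_compl_isolatedPoints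
    freePoints_subset_compl_isolatedPoints (holonomy y₀) (holonomy_trans y₀) U hUo hzU hUW
    (fun z => (hUconv z).isPreconnected) (fun z w hne => ?_) (fun z w v hne => ?_) hloc γ
  · exact isPathConnected_inter_freePoints ((hUo z).inter (hUo w))
      ((hUconv z).inter (hUconv w)) hne
  · exact (isPathConnected_inter_freePoints (((hUo z).inter (hUo w)).inter (hUo v))
      (((hUconv z).inter (hUconv w)).inter (hUconv v)) hne).nonempty

/-- The loops of `X` in the kernel are those that lift to loops. -/
theorem ker_deckHom (y₀ : freePoints) :
    (deckHom (⟨y₀, rfl⟩ : regProj smoothComplement_eq ⁻¹' {regMap y₀})).ker =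
      meridianSquares (regMap y₀) := by
  refine le_antisymm (fun c hc => ?_) (Subgroup.normalClosure_le_normal ?_)
  · rw [deckHom, isQuotientCoveringMap_smoothComplement.ker_fundamentalGroupToMulOpposite,
      isQuotientCoveringMap_smoothComplement.ker_monodromyPerm
        (⟨y₀, rfl⟩ : regProj smoothComplement_eq ⁻¹' {regMap y₀})] at hc
    obtain ⟨γ, rfl⟩ := hc
    change FundamentalGroup freePoints y₀ at γ
    have h0 : FundamentalGroup.mapOfEq regMap (rfl : regMap y₀ = regMap y₀) γ =
        Path.Homotopic.Quotient.map γ regMap :=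
      (FundamentalGroup.mapOfEq_apply ..).trans (Path.Homotopic.Quotient.cast_rfl_rfl _)
    change FundamentalGroup.mapOfEq regMap (rfl : regMap y₀ = regMap y₀) γ ∈ _
    rw [h0]
    obtain ⟨γ, rfl⟩ := Path.Homotopic.Quotient.mk_surjective γ
    have h1 := congrArg MulOpposite.unop (holonomy_loop_eq_one y₀ γ)
    change (QuotientGroup.mk _ : FundamentalGroup (smoothComplement OX M) (regMap y₀) ⧸
      meridianSquares (regMap y₀)) = 1 at h1
    rw [QuotientGroup.eq_one_iff, quotient_map_trans, quotient_map_trans] at h1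
    set b : FundamentalGroup (smoothComplement OX M) (regMap y₀) := FundamentalGroup.fromPath
      ((Path.Homotopic.Quotient.mk (PathConnectedSpace.somePath y₀ y₀)).map regMap)
    set c : FundamentalGroup (smoothComplement OX M) (regMap y₀) := FundamentalGroup.fromPath
      ((Path.Homotopic.Quotient.mk γ).map regMap)
    have h2 : b⁻¹ * (c * b) ∈ meridianSquares (regMap y₀) := h1
    have h3 := Subgroup.normalClosure_normal.conj_mem _ h2 b
    have h4 : b * (b⁻¹ * (c * b)) * b⁻¹ = c := by group
    rw [h4] at h3
    exact h3
  · rintro _ ⟨μ, hμ, rfl⟩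
    exact deckHom_meridian_sq _ hμ

/-- The orbifold fundamental group is the deck group. -/
theorem nonempty_orbifoldFundamentalGroup_mulEquiv (x₀ : smoothComplement OX M) :
    Nonempty (OrbifoldFundamentalGroup OX M 2 x₀ ≃* G) := by
  obtain ⟨y₀, rfl⟩ := isQuotientCoveringMap_smoothComplement.surjective x₀
  exact ⟨((QuotientGroup.quotientMulEquivOfEq (ker_deckHom y₀).symm).trans
    (QuotientGroup.quotientKerEquivOfSurjective _
      (isQuotientCoveringMap_smoothComplement.fundamentalGroupToMulOpposite_surjective
        (e := ⟨y₀, rfl⟩)))).trans (MulEquiv.inv' G).symm⟩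

end AffineG12

end

theorem mainTheorem4 :
    AffineG12.IsAffineCrystallographicReflectionGroup AffineG12.G ∧
    (∃ E : GroupExtension (Multiplicative AffineG12.Λ) AffineG12.G AffineG12.G₁₂,
      (∀ v : AffineG12.Λ, (E.inl (Multiplicative.ofAdd v) : AffineG12.C2 ≃ᵃ[ℂ] AffineG12.C2) =
        AffineEquiv.constVAdd ℂ AffineG12.C2 (v : AffineG12.C2)) ∧
      (∃ P : AffineG12.C2 ≃ₗ[ℂ] AffineG12.C2, ∀ g : AffineG12.G,
        (E.rightHom g : AffineG12.C2 ≃ₗ[ℂ] AffineG12.C2) =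
          P * (g : AffineG12.C2 ≃ᵃ[ℂ] AffineG12.C2).linear * P⁻¹) ∧
      IsEmpty E.Splitting) ∧
    AffineG12.IsOrbifoldPair AffineG12.OX AffineG12.M 2 ∧
    AffineG12.IsUniformization AffineG12.OX AffineG12.M 2 AffineG12.proj ∧
    (∀ φ : AffineG12.C2 ≃ₜ AffineG12.C2,
      (∀ z, AffineG12.proj (φ z) = AffineG12.proj z) ↔
        ∃ g ∈ AffineG12.G, ∀ z, φ z = g z) ∧
    IsPathConnected (AffineG12.smoothComplement AffineG12.OX AffineG12.M) ∧
    (∀ x₀ : AffineG12.smoothComplement AffineG12.OX AffineG12.M,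
      Nonempty
        (AffineG12.OrbifoldFundamentalGroup AffineG12.OX AffineG12.M 2 x₀ ≃* AffineG12.G)) :=
  ⟨AffineG12.isAffineCrystallographicReflectionGroup_G,
    ⟨AffineG12.extension, fun _ => rfl, ⟨AffineG12.conjEquiv, fun _ => rfl⟩,
      AffineG12.isEmpty_extension_splitting⟩,
    AffineG12.isOrbifoldPair, AffineG12.isUniformization_proj, AffineG12.deck_iff,
    AffineG12.isPathConnected_smoothComplement,
    AffineG12.nonempty_orbifoldFundamentalGroup_mulEquiv⟩
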